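/- **Setting.** Let $a>1$ and $s,r\in\mathbb R$, and let $d\ge 1$. Let $S=\mathrm{diag}(\lambda_1,\dots,\lambda_d)$ with $\lambda_1\ge\dots\ge\lambda_d>0$ and $\lambda_i\eqsim i^{-a}$, and let $M=\mathrm{diag}(m_1,\dots,m_d)$ (so $M$ commutes with $S$) with $m_i\eqsim\lambda_i^{1-s}$. Put $W=\{w\in\mathbb R^d: w^\top M w\le 1\}$ and $\|v\|_T^2=v^\top Tv$. For a positive semi-definite $T$, a constant $\psi\ge1$ and $\sigma\ge 0$, the class $\mathcal P(W,S,T)$ consists of all pairs $(P,Q)$ of (source, target) distributions of $(x,y)\in\mathbb R^d\times\mathbb R$ with $\mathbb E_P[xx^\top]=S$ and $\mathbb E_Q[xx^\top]=T$, such that the source risk $\frac12\mathbb E_P(y-\langle w,x\rangle)^2$ and the target risk $\frac12\mathbb E_Q(y-\langle w,x\rangle)^2$ have a common minimizer $w^*\in W$, and such that $\mathbb E_P[xx^\top Axx^\top]\preceq\psi\,\mathrm{tr}(SA)\,S$ for every positive semi-definite $A$, and $\mathbb E_P[(y-\langle w^*,x\rangle)^2xx^\top]\preceq\sigma^2S$.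 Let $\mathcal Q$ be an $r$-smooth class: a set of distributions $Q_x$ on $\mathbb R^d$, with finite second moments $T_{Q_x}=\mathbb E_{Q_x}[xx^\top]$, such that $S^{-1/2}T_{Q_x}S^{-1/2}\preceq C S^{r}$ for all $Q_x\in\mathcal Q$ and $S^{-1/2}T_{Q_{x,0}}S^{-1/2}\succeq c S^{r}$ for at least one $Q_{x,0}\in\mathcal Q$, where $C,c>0$ are constants. Accelerated SGD (ASGD) with momentum parameters $\alpha,\beta\in[0,1]$ and step sizes $0<\delta\le\gamma$ starts from $w_0=v_0=0$ and passes once through samples from $P$, in $\lfloor\log_2n\rfloor$ phases of $K=\lfloor n/\lfloor\log_2n\rfloor\rfloor$ steps. A step of phase $\ell$ on the sample $(x_i,y_i)$ is $u_{i-1}=\alpha w_{i-1}+(1-\alpha)v_{i-1}$, $g_i=(x_i^\top u_{i-1}-y_i)x_i$, $w_i=u_{i-1}-\delta4^{-(\ell-1)}g_i$, $v_i=\beta u_{i-1}+(1-\beta)v_{i-1}-\gamma4^{-(\ell-1)}g_i$; the output $w_n^{\mathrm{SGD}}$ is the last $w_i$. If $\gamma=\delta$ this is vanilla SGD. For an estimator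 $\hat w$ (possibly randomized) computed from $n$ i.i.d. samples from $P$ write $$R_n(\hat w)=\sup_{Q_x\in\mathcal Q,\ (P,Q)\in\mathcal P(W,S,T_{Q_x})}\mathbb E\,\|\hat w-w^*\|_{T_{Q_x}}^2 .$$ **Theorem 5.** Assume $s>\frac{(a-1)^2}{a(2a-1)}$ and $r>\max\{\frac1a-2,-s\}$. The parameters $\alpha,\beta,\delta,\gamma$ of ASGD can be chosen, depending only on $n$, $a$, $s$, $r$, $\psi$ and on the constants in $\lambda_i\eqsim i^{-a}$, $m_i\eqsim\lambda_i^{1-s}$ and in the definition of an $r$-smooth class, with $\gamma=\delta$ (vanilla SGD) if $s\ge1-\frac1a$, such that, with $\rho=\frac{(r+s)a}{sa+1}$, $$R_n(w_n^{\mathrm{SGD}})\eqsim\begin{cases}(1+\sigma^2)\,\ln n/n,& r>1/a;\\ (1+\sigma^2)\,(\ln n)^3/n,& r=1/a;\\ (1+\sigma^2)\,n^{-\rho}(\ln n)^{3\rho},& r<1/a.\end{cases}$$ Moreover the minimax risk satisfies $$\inf_{\hat w}R_n(\hat w)\gtrsim\begin{cases}1/n,& r>1/a;\\ \ln n/n,&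 r=1/a;\\ n^{-\rho},& r<1/a,\end{cases}$$ where the infimum is over all randomized estimators, and $R_n(w_n^{\mathrm{SGD}})\lesssim(\ln n)^3\inf_{\hat w}R_n(\hat w)$. So vanilla SGD is optimal up to logarithmic factors for $s\ge1-\frac1a$, and ASGD is optimal up to logarithmic factors for $1-\frac1a>s>\frac{(a-1)^2}{a(2a-1)}$. Here the upper bound on $R_n(w_n^{\mathrm{SGD}})$ by the displayed rate holds for all sufficiently large $n$, all $d$ and all $\sigma\ge0$, with a constant and a threshold for $n$ that do not depend on $n,d,\sigma,S,M,\mathcal Q$ (beyond the constants named above). The other bounds (the lower bound in the first display, the minimax lower bound, and the comparison with the minimax risk) hold for fixed $\sigma>0$ and $\psi\ge3$, all sufficiently large $n$ and all $d\ge n^{1/(sa+1)}$, with constants and a threshold for $n$ that may depend on $\sigma$ in addition. -/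

import Mathlib

open MeasureTheory ProbabilityTheory Matrix
open scoped ENNReal

namespace CovShift

/-- Vectors of `ℝ^d` (only coordinates are used, never the norm of this type). -/
abbrev Vec (d : ℕ) := Fin d → ℝ

/-- A covariate-response pair `(x, y)`. -/
abbrev Sample (d : ℕ) := Vec d × ℝ

/-- A data set `((x₁, y₁), …, (xₙ, yₙ))`. -/
abbrev Data (n d : ℕ) := Fin n → Sample d

/-- `‖v‖²_A = vᵀ A v`. -/
def quadForm {d : ℕ} (A : Matrix (Fin d) (Fin d) ℝ) (v : Vec d) : ℝ := v ⬝ᵥ (A *ᵥ v)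

/-- Loewner order `A ⪯ B`. -/
def Loewner {d : ℕ} (A B : Matrix (Fin d) (Fin d) ℝ) : Prop := (B - A).PosSemidef

/-- The second moment matrix `E[x xᵀ]` of a distribution on `ℝ^d`. -/
noncomputable def secondMoment {d : ℕ} (μ : Measure (Vec d)) : Matrix (Fin d) (Fin d) ℝ :=
  Matrix.of fun i j => ∫ x, x i * x j ∂μ

/-! ### Problem instances -/

/-- The risk `(1/2) E (y - ⟨w, x⟩)²` of the regressor `w`. -/
noncomputable def sqRisk {d : ℕ} (μ : Measure (Sample d)) (w : Vec d) : ℝ :=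
  (1 / 2) * ∫ z, (z.2 - w ⬝ᵥ z.1) ^ 2 ∂μ

/-- The matrix `E[x xᵀ A x xᵀ] = E[(xᵀ A x) x xᵀ]`. -/
noncomputable def fourthMoment {d : ℕ} (μ : Measure (Sample d)) (A : Matrix (Fin d) (Fin d) ℝ) :
    Matrix (Fin d) (Fin d) ℝ :=
  Matrix.of fun i j => ∫ z, quadForm A z.1 * (z.1 i * z.1 j) ∂μ

/-- The matrix `E[ε² x xᵀ]` with `ε = y - ⟨w, x⟩`. -/
noncomputable def noiseMatrix {d : ℕ} (μ : Measure (Sample d)) (w : Vec d) :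
    Matrix (Fin d) (Fin d) ℝ :=
  Matrix.of fun i j => ∫ z, (z.2 - w ⬝ᵥ z.1) ^ 2 * (z.1 i * z.1 j) ∂μ

/-- `(P, Q)` is a pair of source and target distributions of `(x, y)` with source second moment
matrix `S`, target second moment matrix `T` and common best regressor `w` in the ellipsoid
`{w : ‖w‖²_M ≤ 1}`, whose source satisfies the fourth moment condition with constant `ψ` and the
noise condition with level `σ²`. The integrability fields say that all the expectations exist. -/
structure IsProblem {d : ℕ} (S M T : Matrix (Fin d) (Fin d) ℝ) (ψ σ : ℝ)
    (P Q : Measure (Sample d)) (w : Vec d) : Prop where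
  prob_source : IsProbabilityMeasure P
  prob_target : IsProbabilityMeasure Q
  source_x : ∀ i, MemLp (fun z : Sample d => z.1 i) 4 P
  source_y : MemLp (fun z : Sample d => z.2) 2 P
  target_x : ∀ i, MemLp (fun z : Sample d => z.1 i) 2 Q
  target_y : MemLp (fun z : Sample d => z.2) 2 Q
  source_cov : secondMoment P.fst = S
  target_cov : secondMoment Q.fst = T
  source_min : ∀ v, sqRisk P w ≤ sqRisk P v
  target_min : ∀ v, sqRisk Q w ≤ sqRisk Q v
  mem_ellipsoid : quadForm M w ≤ 1
  fourth_moment : ∀ A : Matrix (Fin d) (Fin d) ℝ, A.PosSemidef →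
    Loewner (fourthMoment P A) ((ψ * (S * A).trace) • S)
  noise_integrable : ∀ i, Integrable (fun z : Sample d => (z.2 - w ⬝ᵥ z.1) ^ 2 * z.1 i ^ 2) P
  noise : Loewner (noiseMatrix P w) (σ ^ 2 • S)

/-! ### Power-law spectra and smooth target classes -/

/-- `S = diag(lam)` with non-increasing eigenvalues `lam_i ≍ i^{-a}`, and `M = diag(m)` with
`m_i ≍ lam_i^{1-s}`; `B ≥ 1` is the constant in both relations. (`i : Fin d` counts from `0`.) -/
structure PowerLaw {d : ℕ} (a s B : ℝ) (lam m : Fin d → ℝ) : Prop where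
  anti : Antitone lam
  lam_lower : ∀ i : Fin d, B⁻¹ * (((i : ℕ) : ℝ) + 1) ^ (-a) ≤ lam i
  lam_upper : ∀ i : Fin d, lam i ≤ B * (((i : ℕ) : ℝ) + 1) ^ (-a)
  m_lower : ∀ i, B⁻¹ * lam i ^ (1 - s) ≤ m i
  m_upper : ∀ i, m i ≤ B * lam i ^ (1 - s)

/-- The power `S^p` of `S = diag(lam)`. -/
noncomputable def diagPow {d : ℕ} (lam : Fin d → ℝ) (p : ℝ) : Matrix (Fin d) (Fin d) ℝ :=
  Matrix.diagonal fun i => lam i ^ p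

/-- `S^{-1/2} E_Q[x xᵀ] S^{-1/2}` for `S = diag(lam)`. -/
noncomputable def similarity {d : ℕ} (lam : Fin d → ℝ) (Q : Measure (Vec d)) :
    Matrix (Fin d) (Fin d) ℝ :=
  diagPow lam (-(1 / 2)) * secondMoment Q * diagPow lam (-(1 / 2))

/-- `𝒬` is an `r`-smooth class of target covariate distributions, relative to `S = diag(lam)`, with
constants `C` (upper) and `c` (lower). -/
structure IsSmoothClass {d : ℕ} (r C c : ℝ) (lam : Fin d → ℝ) (𝒬 : Set (Measure (Vec d))) :
    Prop where
  prob : ∀ Q ∈ 𝒬, IsProbabilityMeasure Q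
  sq_integrable : ∀ Q ∈ 𝒬, ∀ i, MemLp (fun x : Vec d => x i) 2 Q
  upper : ∀ Q ∈ 𝒬, Loewner (similarity lam Q) (C • diagPow lam r)
  lower : ∃ Q₀ ∈ 𝒬, Loewner (c • diagPow lam r) (similarity lam Q₀)

/-! ### Accelerated SGD with exponentially decaying step sizes -/

/-- Momentum parameters `α`, `β` and initial step sizes `δ`, `γ`. -/
structure Params where
  α : ℝ
  β : ℝ
  δ : ℝ
  γ : ℝ

/-- The admissible range of the parameters. -/
def Params.Admissible (θ : Params) : Prop :=
  0 ≤ θ.α ∧ θ.α ≤ 1 ∧ 0 ≤ θ.β ∧ θ.β ≤ 1 ∧ 0 < θ.δ ∧ θ.δ ≤ θ.γ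

/-- Vanilla SGD: with equal step sizes the two sequences `w` and `v` coincide. -/
def Params.Vanilla (θ : Params) : Prop := θ.γ = θ.δ

/-- One step `(w, v) ↦ (w⁺, v⁺)` with step sizes `δ`, `γ` on the sample `z = (x, y)`. -/
def step {d : ℕ} (α β δ γ : ℝ) (z : Sample d) (p : Vec d × Vec d) : Vec d × Vec d :=
  let u : Vec d := α • p.1 + (1 - α) • p.2
  let g : Vec d := (z.1 ⬝ᵥ u - z.2) • z.1
  (u - δ • g, β • u + (1 - β) • p.2 - γ • g)

/-- The number of phases, `⌊log₂ n⌋`. -/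
def numPhases (n : ℕ) : ℕ := Nat.log 2 n

/-- The length of a phase, `⌊n / ⌊log₂ n⌋⌋`. -/
def phaseLength (n : ℕ) : ℕ := n / numPhases n

/-- The state `(w_t, v_t)` after `t` steps, started from `w₀ = v₀ = 0`. Step `t + 1` uses sample
`t + 1` and lies in phase `ℓ = t / K + 1`, whose step sizes are `δ / 4^(ℓ-1)` and `γ / 4^(ℓ-1)`. -/
noncomputable def iterate {n d : ℕ} (θ : Params) (z : Data n d) : ℕ → Vec d × Vec d
  | 0 => (0, 0)
  | t + 1 =>
    if h : t < n then
      step θ.α θ.β (θ.δ / 4 ^ (t / phaseLength n)) (θ.γ / 4 ^ (t / phaseLength n)) (z ⟨t, h⟩)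
        (iterate θ z t)
    else iterate θ z t

/-- The output of the algorithm, after all phases. -/
noncomputable def asgd {n d : ℕ} (θ : Params) (z : Data n d) : Vec d :=
  (iterate θ z (numPhases n * phaseLength n)).1

/-! ### Worst-case and minimax excess risk -/

/-- `sup E ‖ŵ - w*‖²_T`, over all `Q_x ∈ 𝒬` and all problem instances whose target second moment
matrix `T` is that of `Q_x`. The estimator is given by the law `est z` of its output on the data
`z`, which is a random sample of size `n` from the source. -/
noncomputable def worstRisk {n d : ℕ} (S M : Matrix (Fin d) (Fin d) ℝ) (ψ σ : ℝ)
    (𝒬 : Set (Measure (Vec d))) (est : Data n d → Measure (Vec d)) : ℝ≥0∞ :=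
  ⨆ (Qx ∈ 𝒬) (P : Measure (Sample d)) (Q : Measure (Sample d)) (w : Vec d)
    (_ : IsProblem S M (secondMoment Qx) ψ σ P Q w),
    ∫⁻ z, ∫⁻ v, ENNReal.ofReal (quadForm (secondMoment Qx) (v - w)) ∂(est z)
      ∂(Measure.pi fun _ : Fin n => P)

/-- The worst-case risk of the (deterministic) estimator `asgd θ`. -/
noncomputable def asgdRisk (n : ℕ) {d : ℕ} (S M : Matrix (Fin d) (Fin d) ℝ) (ψ σ : ℝ)
    (𝒬 : Set (Measure (Vec d))) (θ : Params) : ℝ≥0∞ :=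
  worstRisk S M ψ σ 𝒬 fun z : Data n d => Measure.dirac (asgd θ z)

/-- The minimax risk: the infimum over all randomized estimators, that is, over all Markov kernels
from the data to `ℝ^d`. -/
noncomputable def minimaxRisk (n : ℕ) {d : ℕ} (S M : Matrix (Fin d) (Fin d) ℝ) (ψ σ : ℝ)
    (𝒬 : Set (Measure (Vec d))) : ℝ≥0∞ :=
  ⨅ (κ : Kernel (Data n d) (Vec d)) (_ : IsMarkovKernel κ),
    worstRisk S M ψ σ 𝒬 fun z => κ z

/-! ### Rates -/

/-- The exponent `(r + s) a / (s a + 1)`. -/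
noncomputable def rateExp (a s r : ℝ) : ℝ := (r + s) * a / (s * a + 1)

/-- The rate of (accelerated) SGD. -/
noncomputable def sgdRate (a s r : ℝ) (n : ℕ) : ℝ :=
  if 1 / a < r then Real.log n / n
  else if r = 1 / a then Real.log n ^ 3 / n
  else (1 / (n : ℝ)) ^ rateExp a s r * Real.log n ^ (3 * rateExp a s r)

/-- The minimax rate. -/
noncomputable def minimaxRate (a s r : ℝ) (n : ℕ) : ℝ :=
  if 1 / a < r then 1 / n
  else if r = 1 / a then Real.log n / n
  else (1 / (n : ℝ)) ^ rateExp a s r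

end CovShift

open CovShift

/-! Upper bound. As `S` is diagonal, the mean dynamics act on each coordinate separately.
Coordinates interact only through the second moment of the gradient, which the fourth moment and
noise conditions bound by a multiple of `ψ ∑ λ_k u_k² + σ²`, where `u` is the error of the query
point. With `α = 1 / (1 + β)` the quadratic form `(v-error)² + max(1, γ λ / β) (w-error)²` contracts
at the rate `min(β, γ λ) / 2` and, alternatively, dissipates `u²` (`lyapMean_le`,
`lyapMean_add_le`). Since the steps shrink by four, the noise of a phase decays in the next one, and
what survives at the end telescopes to the order `min(1, (γ λ K)²) / (λ K)` (`PhaseRec.final_le`).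
The noise depends on the error that it causes. This circle is cut at the phase of largest noise:
`feedback` measures the share of the noise that a coordinate returns, and if these shares add up to
little, the noise level remains of the order of its initial value (`IsProblem.exists_noise_bound`).

Rates. Put `Γ = γ K`. Coordinates with `λ` above `1/Γ` are learned, so the bias is of order
`Γ^{-(r+s)}` and the variance is `K⁻¹ ∑ λ^r min(1, (Γ λ)²)`, which for `r < 1/a` has the order
`Γ^{1/a-r} / K`. They balance at `Γ = n^{a/(sa+1)}`, up to logarithms. For `s ≥ 1 - 1/a` the
exponent is at most one and `δ = γ → 0` is possible. Otherwise `γ` has to grow. Then `δ` is a small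
constant, `β = n^{ε-1}`, and the feedback is bounded by interpolating between eigenvalue decay and
momentum (`feedback_min_le`). This works if the exponent is below `2 - 1/a`, which is the threshold
for `s` (`stepExp_lt`).

Lower bounds. Both use covariates with independent entries `±√λ_i` and Gaussian noise, for which
`x_i²` is not random. For the minimax risk, two regressors that differ in one coordinate by the
order `(n λ_i)^{-1/2}` are hard to distinguish; averaging over the vertices of a cube with such
sides in the first `n^{1/(sa+1)}` coordinates gives the rate (`le_minimaxRisk`,
`minimaxRisk_ge_sum`). For SGD, the error is driven by martingale kicks, and its mean square
dominates the squared responses of the mean flow to the initial error and to all kicks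
(`le_lintegral_response`). For `r ≤ 1/a` the bias of one coordinate with `λ ≍ 1/Γ` matches the rate;
for `r > 1/a` the noise of one phase in the first coordinate does, where the logarithm appears
because a phase has only about `n / ln n` steps. -/

namespace CovShift

/-! ### One step of the recursion in a single coordinate -/

/-- The weight of the squared `w`-coordinate in the Lyapunov function. -/
noncomputable def lyapWeight (β γ lam : ℝ) : ℝ := max 1 (γ * lam / β)

/-- The contraction rate of the Lyapunov function. -/
noncomputable def lyapRate (β γ lam : ℝ) : ℝ := min β (γ * lam) / 2

/-- The rate at which the Lyapunov function dissipates `u²`. -/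
noncomputable def lyapDec (β δ γ lam : ℝ) : ℝ := γ * lam / 8 * max 1 (δ * lam / β)

/-- The value of the Lyapunov function at the noise direction `(δ, γ)`. -/
noncomputable def lyapNoise (β δ γ lam : ℝ) : ℝ := γ ^ 2 + lyapWeight β γ lam * δ ^ 2

lemma one_le_lyapWeight (β γ lam : ℝ) : 1 ≤ lyapWeight β γ lam := le_max_left _ _

lemma lyapWeight_nonneg (β γ lam : ℝ) : 0 ≤ lyapWeight β γ lam :=
  zero_le_one.trans (one_le_lyapWeight _ _ _)

lemma lyapNoise_nonneg (β δ γ lam : ℝ) : 0 ≤ lyapNoise β δ γ lam := by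
  have := lyapWeight_nonneg β γ lam
  unfold lyapNoise; positivity

section OneStep

variable {β δ γ lam p q u : ℝ}

lemma sq_average_le (hβ : 0 < β) (hu : u * (1 + β) = p + β * q) (θ : ℝ)
    (hθ : 1 ≤ θ) : u ^ 2 ≤ q ^ 2 + θ * p ^ 2 := by
  have h1 : u = (p + β * q) / (1 + β) := by field_simp; linarith
  have h2 : u ^ 2 ≤ (p ^ 2 + β * q ^ 2) / (1 + β) := by
    rw [h1, div_pow, div_le_div_iff₀ (by positivity) (by positivity)]
    nlinarith [mul_nonneg hβ.le (mul_nonneg (by linarith : 0 ≤ 1 + β) (sq_nonneg (p - q)))]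
  have h3 : (p ^ 2 + β * q ^ 2) / (1 + β) ≤ q ^ 2 + p ^ 2 := by
    rw [div_le_iff₀ (by positivity)]
    nlinarith [sq_nonneg p, sq_nonneg q, mul_nonneg hβ.le (sq_nonneg p)]
  nlinarith [sq_nonneg p]

/-- The conditional mean of the Lyapunov function after a step, without its noise part. -/
noncomputable def lyapMean (β δ γ lam q u : ℝ) : ℝ :=
  (β * u + (1 - β) * q) ^ 2 - 2 * γ * (β * u + (1 - β) * q) * (lam * u)
    + lyapWeight β γ lam * (u ^ 2 - 2 * δ * lam * u ^ 2)

/-- The cross term dictates the weight `γ λ / β`: since `β (q - u) = u - p`, it becomes a multiple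
of `u² - p² + (u - p)²` with exactly this weight, so that `p²` appears with the contracted weight
and the positive `u²` is absorbed. -/
lemma lyapMean_fast (hβ : 0 < β) (hβ1 : β ≤ 1) (hlam : 0 < lam) (hγ : 0 < γ)
    (hu : u * (1 + β) = p + β * q) (h : β ≤ γ * lam) :
    lyapMean β δ γ lam q u ≤ (1 - β) * (q ^ 2 + lyapWeight β γ lam * p ^ 2)
      - (γ * lam - β + 2 * δ * lam * lyapWeight β γ lam) * u ^ 2 := by
  have hθ : lyapWeight β γ lam = γ * lam / β := by
    unfold lyapWeight; exact max_eq_right (by rwa [one_le_div hβ])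
  unfold lyapMean
  have hθ' : γ * lam = β * (γ * lam / β) := by field_simp
  rw [hθ]
  set θ := γ * lam / β with hθd
  have hθ0 : 0 ≤ θ := by positivity
  have hq : β * (q - u) = u - p := by linarith
  have e1 : (β * u + (1 - β) * q) ^ 2 ≤ β * u ^ 2 + (1 - β) * q ^ 2 := by
    nlinarith [mul_nonneg (mul_nonneg hβ.le (by linarith : 0 ≤ 1 - β)) (sq_nonneg (u - q))]
  have e2 : 2 * γ * (β * u + (1 - β) * q) * (lam * u)
      = 2 * (β * θ) * u ^ 2 + (1 - β) * θ * (u ^ 2 - p ^ 2 + (u - p) ^ 2) := by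
    have : 2 * γ * (β * u + (1 - β) * q) * (lam * u)
      = 2 * (γ * lam) * u * (u + (1 - β) * (q - u)) := by ring
    rw [this, hθ']
    have : 2 * (β * θ) * u * (u + (1 - β) * (q - u))
      = 2 * (β * θ) * u ^ 2 + 2 * θ * u * (1 - β) * (β * (q - u)) := by ring
    rw [this, hq]; ring
  rw [hθ', e2]
  nlinarith [mul_nonneg (mul_nonneg (by linarith : 0 ≤ 1 - β) hθ0) (sq_nonneg (u - p))]

/-- Completing the square merges the gradient into the update of `v`. The coefficients become `1 -
β` and `β - x` with `x = γ λ`; they are nonnegative with sum `1 - x`, so convexity gives the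
contraction. The remaining `u²` is at most the average of `p²` and `q²` with weights proportional to
`1` and `β`. -/
lemma lyapMean_slow (hβ : 0 < β) (hβ1 : β ≤ 1) (hlam : 0 < lam) (hγ : 0 < γ) (hδ : 0 ≤ δ)
    (hu : u * (1 + β) = p + β * q) (h : γ * lam ≤ β) :
    lyapMean β δ γ lam q u ≤ (1 - γ * lam / 2) * (q ^ 2 + lyapWeight β γ lam * p ^ 2) := by
  have hθ : lyapWeight β γ lam = 1 := by
    unfold lyapWeight; exact max_eq_left (by rwa [div_le_one hβ])
  unfold lyapMean
  rw [hθ]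
  set x := γ * lam with hx
  have hx0 : 0 < x := by positivity
  have e1 : (β * u + (1 - β) * q) ^ 2 - 2 * γ * (β * u + (1 - β) * q) * (lam * u)
      ≤ ((1 - β) * q + (β - x) * u) ^ 2 := by
    have : 2 * γ * (β * u + (1 - β) * q) * (lam * u) = 2 * x * (β * u + (1 - β) * q) * u := by
      rw [hx]; ring
    rw [this]; nlinarith [sq_nonneg (x * u)]
  have e2 : ((1 - β) * q + (β - x) * u) ^ 2 ≤ (1 - x) * ((1 - β) * q ^ 2 + (β - x) * u ^ 2) := by
    nlinarith [mul_nonneg (mul_nonneg (by linarith : 0 ≤ 1 - β) (by linarith : 0 ≤ β - x))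
      (sq_nonneg (q - u))]
  have e3 : u ^ 2 * (1 + β) ≤ p ^ 2 + β * q ^ 2 := by
    have h1 : u = (p + β * q) / (1 + β) := by field_simp; linarith
    have : u ^ 2 * (1 + β) = (p + β * q) ^ 2 / (1 + β) := by rw [h1]; field_simp
    rw [this, div_le_iff₀ (by positivity)]
    nlinarith [mul_nonneg hβ.le (sq_nonneg (p - q))]
  have e4 : 0 ≤ 2 * δ * lam * u ^ 2 := by positivity
  have e5 : (1 - x) * (β - x) + 1 ≤ 1 + β - x := by nlinarith
  have e6 : ((1 - x) * (β - x) + 1) * u ^ 2 ≤ (1 + β - x) * u ^ 2 :=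
    mul_le_mul_of_nonneg_right e5 (sq_nonneg u)
  have e7 : (1 + β - x) * u ^ 2 ≤ (1 - x / 2) * (p ^ 2 + β * q ^ 2) := by
    have : (1 + β - x) * u ^ 2 ≤ (1 - x / 2) * (u ^ 2 * (1 + β)) := by
      nlinarith [mul_nonneg hx0.le (sq_nonneg u)]
    exact this.trans (mul_le_mul_of_nonneg_left e3 (by linarith))
  nlinarith [mul_nonneg hx0.le (sq_nonneg q), mul_nonneg (mul_nonneg hx0.le hβ.le) (sq_nonneg q)]

lemma lyapMean_le (hβ : 0 < β) (hβ1 : β ≤ 1) (hlam : 0 < lam) (hγ : 0 < γ) (hδ : 0 ≤ δ)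
    (hu : u * (1 + β) = p + β * q) :
    lyapMean β δ γ lam q u ≤ (1 - lyapRate β γ lam) * (q ^ 2 + lyapWeight β γ lam * p ^ 2) := by
  have hV : 0 ≤ q ^ 2 + lyapWeight β γ lam * p ^ 2 := by
    have := lyapWeight_nonneg β γ lam; positivity
  rcases le_total β (γ * lam) with h | h
  · refine (lyapMean_fast (δ := δ) hβ hβ1 hlam hγ hu h).trans ?_
    rw [lyapRate, min_eq_left h]
    have h1 : 0 ≤ (γ * lam - β + 2 * δ * lam * lyapWeight β γ lam) * u ^ 2 := by
      have := lyapWeight_nonneg β γ lam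
      have h3 : 0 ≤ γ * lam - β := by linarith
      positivity
    nlinarith
  · refine (lyapMean_slow hβ hβ1 hlam hγ hδ hu h).trans ?_
    rw [lyapRate, min_eq_right h]

/-- Here the contraction is spent on dissipating `u²`. If `δ λ ≥ β`, the descent step of `w`
provides the gain; otherwise the slack in the contraction does, which for fast coordinates needs `β
γ λ ≤ 1`. -/
lemma lyapMean_add_le (hβ : 0 < β) (hβ1 : β ≤ 1) (hlam : 0 < lam) (hγ : 0 < γ) (hδ : 0 ≤ δ)
    (hδγ : δ ≤ γ) (hb : β * γ * lam ≤ 1) (hu : u * (1 + β) = p + β * q) :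
    lyapMean β δ γ lam q u + lyapDec β δ γ lam * u ^ 2
      ≤ q ^ 2 + lyapWeight β γ lam * p ^ 2 := by
  have hV : 0 ≤ q ^ 2 + lyapWeight β γ lam * p ^ 2 := by
    have := lyapWeight_nonneg β γ lam; positivity
  have hx : 0 < γ * lam := by positivity
  rcases le_total β (γ * lam) with h | h
  · have h1 := lyapMean_fast (δ := δ) hβ hβ1 hlam hγ hu h
    have hθ : lyapWeight β γ lam = γ * lam / β := by
      unfold lyapWeight; exact max_eq_right (by rwa [one_le_div hβ])
    rw [lyapDec]
    rcases le_total 1 (δ * lam / β) with h2 | h2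
    · rw [max_eq_right h2]
      have h3 : γ * lam / 8 * (δ * lam / β) ≤ 2 * δ * lam * lyapWeight β γ lam := by
        rw [hθ]
        have : 2 * δ * lam * (γ * lam / β) = 16 * (γ * lam / 8 * (δ * lam / β)) := by
          field_simp; ring
        rw [this]
        have : 0 ≤ γ * lam / 8 * (δ * lam / β) := by positivity
        linarith
      nlinarith [sq_nonneg u, mul_nonneg hβ.le hV, mul_nonneg (sub_nonneg.2 h) (sq_nonneg u),
        mul_nonneg (sub_nonneg.2 h3) (sq_nonneg u)]
    · rw [max_eq_left h2, mul_one]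
      have h3 : γ * lam / 8 * u ^ 2 ≤ β * (q ^ 2 + lyapWeight β γ lam * p ^ 2) := by
        have h4 : u ^ 2 ≤ (p + β * q) ^ 2 := by
          rw [← hu, mul_pow]
          exact le_mul_of_one_le_right (sq_nonneg u) (one_le_pow₀ (by linarith))
        have h5 : (p + β * q) ^ 2 ≤ 2 * p ^ 2 + 2 * β ^ 2 * q ^ 2 := by
          nlinarith [sq_nonneg (p - β * q)]
        have h6 : β * (q ^ 2 + lyapWeight β γ lam * p ^ 2) = β * q ^ 2 + γ * lam * p ^ 2 := by
          rw [hθ]; field_simp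
        rw [h6]
        have h7 : β ^ 2 * (γ * lam) * q ^ 2 ≤ β * q ^ 2 := by
          have : β * (β * γ * lam) ≤ β * 1 := mul_le_mul_of_nonneg_left hb hβ.le
          nlinarith [sq_nonneg q]
        nlinarith [mul_le_mul_of_nonneg_left (h4.trans h5) hx.le, sq_nonneg p, sq_nonneg q]
      have h8 : 0 ≤ (γ * lam - β + 2 * δ * lam * lyapWeight β γ lam) * u ^ 2 := by
        have := lyapWeight_nonneg β γ lam
        have h3 : 0 ≤ γ * lam - β := by linarith
        positivity
      linarith
  · have h1 := lyapMean_slow hβ hβ1 hlam hγ hδ hu h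
    have h2 : δ * lam / β ≤ 1 := by
      rw [div_le_one hβ]; exact (mul_le_mul_of_nonneg_right hδγ hlam.le).trans h
    rw [lyapDec, max_eq_left h2, mul_one]
    have h3 := sq_average_le hβ hu _ (one_le_lyapWeight β γ lam)
    nlinarith [mul_le_mul_of_nonneg_left h3 hx.le, mul_nonneg hx.le hV]

end OneStep

end CovShift

/-! ### Moments of the source distribution -/

namespace CovShift

lemma Loewner.diag_le {d : ℕ} {A B : Matrix (Fin d) (Fin d) ℝ} (h : Loewner A B) (i : Fin d) :
    A i i ≤ B i i := by
  have := Matrix.PosSemidef.diag_nonneg h (i := i)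
  simpa using this

lemma Loewner.quadForm_le {d : ℕ} {A B : Matrix (Fin d) (Fin d) ℝ} (h : Loewner A B) (v : Vec d) :
    quadForm A v ≤ quadForm B v := by
  have := Matrix.PosSemidef.dotProduct_mulVec_nonneg h v
  simp only [star_trivial, Matrix.sub_mulVec, dotProduct_sub] at this
  unfold quadForm; linarith

lemma quadForm_vecMulVec {d : ℕ} (u x : Vec d) : quadForm (vecMulVec u u) x = (x ⬝ᵥ u) ^ 2 := by
  simp [quadForm, vecMulVec_mulVec, dotProduct_comm, sq]

lemma quadForm_diagonal {d : ℕ} (m : Fin d → ℝ) (v : Vec d) :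
    quadForm (diagonal m) v = ∑ i, m i * v i ^ 2 := by
  simp only [quadForm, dotProduct, mulVec_diagonal]
  exact Finset.sum_congr rfl fun i _ => by ring

section Source

variable {d : ℕ} {lam : Fin d → ℝ} {M T : Matrix (Fin d) (Fin d) ℝ} {ψ σ : ℝ}
  {P Q : Measure (Sample d)} {w : Vec d}

lemma measurable_sample_x (j : Fin d) : Measurable fun z : Sample d => z.1 j :=
  (measurable_pi_apply j).comp measurable_fst

lemma measurable_sample_dot (u : Vec d) : Measurable fun z : Sample d => z.1 ⬝ᵥ u := by
  simp only [dotProduct]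
  exact Finset.measurable_sum _ fun i _ => (measurable_sample_x i).mul_const _

lemma measurable_sample_dot' (u : Vec d) : Measurable fun z : Sample d => u ⬝ᵥ z.1 := by
  simpa only [dotProduct_comm] using measurable_sample_dot u

namespace IsProblem

variable (hP : IsProblem (diagonal lam) M T ψ σ P Q w)
include hP

lemma memLp_x (j : Fin d) : MemLp (fun z : Sample d => z.1 j) 2 P :=
  have := hP.prob_source
  (hP.source_x j).mono_exponent (by norm_num)

lemma memLp_dot (u : Vec d) : MemLp (fun z : Sample d => z.1 ⬝ᵥ u) 2 P := by
  simp only [dotProduct]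
  exact memLp_finsetSum _ fun i _ => (hP.memLp_x i).mul_const _

lemma memLp_dot_four (u : Vec d) : MemLp (fun z : Sample d => z.1 ⬝ᵥ u) 4 P := by
  simp only [dotProduct]
  exact memLp_finsetSum _ fun i _ => (hP.source_x i).mul_const _

lemma memLp_residual : MemLp (fun z : Sample d => z.2 - w ⬝ᵥ z.1) 2 P := by
  have := hP.memLp_dot w
  simp only [dotProduct_comm] at this
  exact hP.source_y.sub this

lemma integral_x_mul_x (i j : Fin d) :
    ∫ z, z.1 i * z.1 j ∂P = if i = j then lam i else 0 := by
  have h := congrFun (congrFun hP.source_cov i) j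
  rw [secondMoment, Matrix.of_apply, Measure.fst, integral_map measurable_fst.aemeasurable] at h
  · rw [h, diagonal_apply]
  · exact ((measurable_pi_apply i).mul (measurable_pi_apply j)).aestronglyMeasurable

lemma integrable_x_mul_x (i j : Fin d) : Integrable (fun z : Sample d => z.1 i * z.1 j) P :=
  (hP.memLp_x i).integrable_mul (hP.memLp_x j)

lemma integrable_residual_mul_x (j : Fin d) :
    Integrable (fun z : Sample d => (z.2 - w ⬝ᵥ z.1) * z.1 j) P :=
  hP.memLp_residual.integrable_mul (hP.memLp_x j)

/-- The first-order condition: along a coordinate direction the risk changes by a quadratic in `t`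
that is never negative, so its linear coefficient vanishes. -/
lemma integral_residual_mul_x (j : Fin d) : ∫ z, (z.2 - w ⬝ᵥ z.1) * z.1 j ∂P = 0 := by
  set A := ∫ z, (z.2 - w ⬝ᵥ z.1) * z.1 j ∂P with hA
  set D := ∫ z, z.1 j * z.1 j ∂P with hD
  have key : ∀ t : ℝ, 0 ≤ -2 * t * A + t ^ 2 * D := by
    intro t
    have h := hP.source_min (w + t • Pi.single j 1)
    unfold sqRisk at h
    have e : ∀ z : Sample d, (z.2 - (w + t • Pi.single j 1) ⬝ᵥ z.1) ^ 2
        = (z.2 - w ⬝ᵥ z.1) ^ 2 + (-2 * t * ((z.2 - w ⬝ᵥ z.1) * z.1 j)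
          + t ^ 2 * (z.1 j * z.1 j)) := by
      intro z
      simp only [add_dotProduct, smul_dotProduct, single_one_dotProduct, smul_eq_mul]
      ring
    simp only [e] at h
    rw [integral_add hP.memLp_residual.integrable_sq, integral_add, integral_const_mul,
      integral_const_mul] at h
    · linarith
    · exact (hP.integrable_residual_mul_x j).const_mul _
    · exact (hP.integrable_x_mul_x j j).const_mul _
    · exact ((hP.integrable_residual_mul_x j).const_mul _).add
        ((hP.integrable_x_mul_x j j).const_mul _)
  have hD0 : 0 ≤ D := integral_nonneg fun z => mul_self_nonneg _
  -- `D + 1` instead of `D` keeps the denominator positive when `D = 0`.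
  have h1 := key (A / (D + 1))
  have h2 : -2 * (A / (D + 1)) * A + (A / (D + 1)) ^ 2 * D
      = -(A ^ 2 * (D + 2)) / (D + 1) ^ 2 := by
    field_simp; ring
  rw [h2, div_nonneg_iff] at h1
  have h3 : A ^ 2 * (D + 2) ≤ 0 := by
    rcases h1 with h1 | h1
    · linarith [h1.1]
    · exfalso; nlinarith [h1.2]
  nlinarith [sq_nonneg A, mul_nonneg (sq_nonneg A) hD0]

/-- The stochastic gradient at a point whose distance to the minimizer is `u` is integrable. -/
lemma integrable_grad (u : Vec d) (j : Fin d) :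
    Integrable (fun z : Sample d => (z.1 ⬝ᵥ u - (z.2 - w ⬝ᵥ z.1)) * z.1 j) P :=
  ((hP.memLp_dot u).sub hP.memLp_residual).integrable_mul (hP.memLp_x j)

/-- The residual is uncorrelated with `x` and `S` is diagonal, so no other coordinate enters on
average. This decouples the mean dynamics. -/
lemma integral_grad (u : Vec d) (j : Fin d) :
    ∫ z, (z.1 ⬝ᵥ u - (z.2 - w ⬝ᵥ z.1)) * z.1 j ∂P = lam j * u j := by
  have hI : Integrable (fun z : Sample d => z.1 ⬝ᵥ u * z.1 j) P :=
    (hP.memLp_dot u).integrable_mul (hP.memLp_x j)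
  simp only [sub_mul (_ ⬝ᵥ u)]
  rw [integral_sub hI
    (hP.integrable_residual_mul_x j), hP.integral_residual_mul_x, sub_zero]
  have e : ∀ z : Sample d, z.1 ⬝ᵥ u * z.1 j = ∑ i, u i * (z.1 i * z.1 j) := by
    intro z
    rw [dotProduct, Finset.sum_mul]
    exact Finset.sum_congr rfl fun i _ => by ring
  simp only [e]
  rw [integral_finsetSum _ fun i _ => (hP.integrable_x_mul_x i j).const_mul _]
  simp [integral_const_mul, hP.integral_x_mul_x, mul_comm]

lemma integrable_sq_dot_mul_sq (u : Vec d) (j : Fin d) :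
    Integrable (fun z : Sample d => (z.1 ⬝ᵥ u) ^ 2 * z.1 j ^ 2) P := by
  have h := (hP.source_x j).mul (hP.memLp_dot_four u) (r := 2) (hpqr := ⟨by
    rw [← ENNReal.toReal_eq_toReal_iff' (by simp) (by simp)]
    rw [ENNReal.toReal_add (by simp) (by simp)]
    norm_num⟩)
  have h2 := h.integrable_sq
  refine h2.congr (ae_of_all _ fun z => ?_)
  simp [mul_pow]

/-- The fourth moment condition is used only for the rank-one matrix `u uᵀ`, and only on the
diagonal. -/
lemma integral_sq_dot_mul_sq_le (u : Vec d) (j : Fin d) :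
    ∫ z, (z.1 ⬝ᵥ u) ^ 2 * z.1 j ^ 2 ∂P ≤ ψ * (∑ k, lam k * u k ^ 2) * lam j := by
  have h := (hP.fourth_moment (vecMulVec u u) (by
    simpa using Matrix.posSemidef_vecMulVec_self_star u)).diag_le j
  simp only [fourthMoment, Matrix.of_apply, quadForm_vecMulVec, Matrix.smul_apply,
    diagonal_apply_eq, smul_eq_mul, ← sq] at h
  refine h.trans (le_of_eq ?_)
  congr 2
  simp [Matrix.trace, Matrix.diag, diagonal_mul, vecMulVec_apply, sq]

lemma integral_sq_residual_mul_sq_le (j : Fin d) :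
    ∫ z, (z.2 - w ⬝ᵥ z.1) ^ 2 * z.1 j ^ 2 ∂P ≤ σ ^ 2 * lam j := by
  have h := hP.noise.diag_le j
  simpa [noiseMatrix, ← sq] using h

lemma integrable_grad_sq (u : Vec d) (j : Fin d) :
    Integrable (fun z : Sample d => ((z.1 ⬝ᵥ u - (z.2 - w ⬝ᵥ z.1)) * z.1 j) ^ 2) P := by
  refine Integrable.mono' (((hP.integrable_sq_dot_mul_sq u j).const_mul 2).add
    ((hP.noise_integrable j).const_mul 2)) ?_ (ae_of_all _ fun z => ?_)
  · refine Measurable.aestronglyMeasurable ?_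
    exact (((measurable_sample_dot u).sub
      (measurable_snd.sub (measurable_sample_dot' w))).mul (measurable_sample_x j)).pow_const _
  · rw [Real.norm_of_nonneg (sq_nonneg _)]
    simp only [Pi.add_apply]
    nlinarith [sq_nonneg ((z.1 ⬝ᵥ u + (z.2 - w ⬝ᵥ z.1)) * z.1 j)]

lemma integral_grad_sq_le (u : Vec d) (j : Fin d) :
    ∫ z, ((z.1 ⬝ᵥ u - (z.2 - w ⬝ᵥ z.1)) * z.1 j) ^ 2 ∂P
      ≤ lam j * (2 * ψ * (∑ k, lam k * u k ^ 2) + 2 * σ ^ 2) := by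
  have h : ∫ z, ((z.1 ⬝ᵥ u - (z.2 - w ⬝ᵥ z.1)) * z.1 j) ^ 2 ∂P
      ≤ ∫ z, (2 * ((z.1 ⬝ᵥ u) ^ 2 * z.1 j ^ 2) + 2 * ((z.2 - w ⬝ᵥ z.1) ^ 2 * z.1 j ^ 2)) ∂P := by
    refine integral_mono (hP.integrable_grad_sq u j)
      (((hP.integrable_sq_dot_mul_sq u j).const_mul 2).add
      ((hP.noise_integrable j).const_mul 2)) fun z => ?_
    simp only
    nlinarith [sq_nonneg ((z.1 ⬝ᵥ u + (z.2 - w ⬝ᵥ z.1)) * z.1 j)]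
  rw [integral_add ((hP.integrable_sq_dot_mul_sq u j).const_mul 2)
      ((hP.noise_integrable j).const_mul 2), integral_const_mul, integral_const_mul] at h
  nlinarith [hP.integral_sq_dot_mul_sq_le u j, hP.integral_sq_residual_mul_sq_le j]

end IsProblem

end Source

/-! ### The iteration as a Markov chain -/

/-- Fubini in one coordinate: `G z` does not see `z i`, which may therefore be replaced by a fresh
independent copy. -/
lemma lintegral_pi_eq_of_update {n : ℕ} {X : Type*} [MeasurableSpace X] (P : Measure X)
    [IsProbabilityMeasure P] (i : Fin n) (G : (Fin n → X) → X → ℝ≥0∞)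
    (hG : Measurable (Function.uncurry G))
    (hupd : ∀ z x, G (Function.update z i x) = G z) :
    ∫⁻ z, G z (z i) ∂(Measure.pi fun _ : Fin n => P)
      = ∫⁻ z, ∫⁻ x, G z x ∂P ∂(Measure.pi fun _ : Fin n => P) := by
  refine lintegral_eq_of_lmarginal_eq {i} ?_ ?_ ?_
  · exact hG.comp (measurable_id.prodMk (measurable_pi_apply i))
  · exact hG.lintegral_prod_right
  · rw [lmarginal_singleton, lmarginal_singleton]
    funext z
    simp [hupd]

section Chain

variable {n d : ℕ}

lemma measurable_step (α β δ γ : ℝ) :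
    Measurable fun x : Sample d × (Vec d × Vec d) => step α β δ γ x.1 x.2 := by
  refine Continuous.measurable ?_
  unfold step dotProduct
  fun_prop

lemma measurable_iterate (θ : Params) (t : ℕ) : Measurable fun z : Data n d => iterate θ z t := by
  induction t with
  | zero => simp only [iterate]; exact measurable_const
  | succ t ih =>
    by_cases h : t < n
    · simp only [iterate, h, dite_true]
      exact (measurable_step _ _ _ _).comp ((measurable_pi_apply (⟨t, h⟩ : Fin n)).prodMk ih)
    · simp only [iterate, h, dite_false]; exact ih

lemma iterate_update (θ : Params) (z : Data n d) (t : ℕ) (i : Fin n) (hi : t ≤ i) (x : Sample d) :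
    iterate θ (Function.update z i x) t = iterate θ z t := by
  induction t with
  | zero => rfl
  | succ t ih =>
    have h : t < n := lt_of_lt_of_le (Nat.lt_of_succ_le hi) i.2.le
    have hne : (⟨t, h⟩ : Fin n) ≠ i := by
      intro e; rw [← e] at hi; simp at hi
    simp only [iterate, h, dite_true]
    rw [ih (by omega), Function.update_of_ne hne]

/-- The Markov property of the iteration. -/
lemma lintegral_iterate_succ (P : Measure (Sample d)) [IsProbabilityMeasure P] (θ : Params)
    {t : ℕ} (ht : t < n) (F : Vec d × Vec d → ℝ≥0∞) (hF : Measurable F) :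
    ∫⁻ z, F (iterate θ z (t + 1)) ∂(Measure.pi fun _ : Fin n => P)
      = ∫⁻ z, ∫⁻ x, F (step θ.α θ.β (θ.δ / 4 ^ (t / phaseLength n)) (θ.γ / 4 ^ (t / phaseLength n))
          x (iterate θ z t)) ∂P ∂(Measure.pi fun _ : Fin n => P) := by
  rw [← lintegral_pi_eq_of_update P ⟨t, ht⟩ (fun z x => F (step θ.α θ.β
    (θ.δ / 4 ^ (t / phaseLength n)) (θ.γ / 4 ^ (t / phaseLength n)) x (iterate θ z t)))]
  · simp only [iterate, ht, dite_true]
  · exact hF.comp ((measurable_step _ _ _ _).comp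
      (measurable_snd.prodMk ((measurable_iterate θ t).comp measurable_fst)))
  · intro z x
    rw [iterate_update θ z t ⟨t, ht⟩ le_rfl x]

end Chain

end CovShift

/-! ### The recursion for the expected Lyapunov function -/

namespace CovShift

/-- The error `u - w` of the query point `u` of the next step. -/
def queryErr {d : ℕ} (α : ℝ) (w : Vec d) (s : Vec d × Vec d) : Vec d :=
  fun j => α * (s.1 j - w j) + (1 - α) * (s.2 j - w j)

/-- The Lyapunov function of coordinate `j`, with weight `θ`. -/
def lyap {d : ℕ} (θ : ℝ) (w : Vec d) (j : Fin d) (s : Vec d × Vec d) : ℝ :=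
  (s.2 j - w j) ^ 2 + θ * (s.1 j - w j) ^ 2

/-- The stochastic gradient, in terms of the error `u` of the query point. -/
def grad {d : ℕ} (w u : Vec d) (z : Sample d) (j : Fin d) : ℝ :=
  (z.1 ⬝ᵥ u - (z.2 - w ⬝ᵥ z.1)) * z.1 j

section

variable {d : ℕ}

lemma step_grad (α : ℝ) (w : Vec d) (s : Vec d × Vec d) (z : Sample d) (j : Fin d) :
    (z.1 ⬝ᵥ (α • s.1 + (1 - α) • s.2) - z.2) * z.1 j = grad w (queryErr α w s) z j := by
  have : z.1 ⬝ᵥ (α • s.1 + (1 - α) • s.2) = z.1 ⬝ᵥ queryErr α w s + w ⬝ᵥ z.1 := by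
    rw [dotProduct_comm w, ← dotProduct_add]
    congr 1
    funext i
    simp [queryErr]; ring
  rw [grad, this]; ring

lemma step_fst_sub (α β δ γ : ℝ) (w : Vec d) (s : Vec d × Vec d) (z : Sample d) (j : Fin d) :
    (step α β δ γ z s).1 j - w j = queryErr α w s j - δ * grad w (queryErr α w s) z j := by
  rw [← step_grad]
  simp [step, queryErr]; ring

lemma step_snd_sub (α β δ γ : ℝ) (w : Vec d) (s : Vec d × Vec d) (z : Sample d) (j : Fin d) :
    (step α β δ γ z s).2 j - w j = β * queryErr α w s j + (1 - β) * (s.2 j - w j)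
      - γ * grad w (queryErr α w s) z j := by
  rw [← step_grad]
  simp [step, queryErr]; ring

lemma lyap_nonneg {θ : ℝ} (hθ : 0 ≤ θ) (w : Vec d) (j : Fin d) (s : Vec d × Vec d) :
    0 ≤ lyap θ w j s := by unfold lyap; positivity

lemma lyap_mono {θ θ' : ℝ} (h : θ ≤ θ') (w : Vec d) (j : Fin d) (s : Vec d × Vec d) :
    lyap θ w j s ≤ lyap θ' w j s := by
  unfold lyap; gcongr

lemma measurable_lyap (θ : ℝ) (w : Vec d) (j : Fin d) : Measurable (lyap θ w j) := by
  refine Continuous.measurable ?_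
  unfold lyap; fun_prop

variable {lam : Fin d → ℝ} {M T : Matrix (Fin d) (Fin d) ℝ} {ψ σ : ℝ}
  {P Q : Measure (Sample d)} {w : Vec d}

/-- The bound for the second moment of the stochastic gradient, up to the factor `lam j`. -/
def noiseLevel (lam : Fin d → ℝ) (ψ σ : ℝ) (u : Vec d) : ℝ :=
  2 * ψ * (∑ k, lam k * u k ^ 2) + 2 * σ ^ 2

/-- After expansion the gradient occurs to first and second order only. The mean enters `lyapMean`;
the second moment is multiplied by the Lyapunov value of the direction `(δ, γ)` in which the
gradient acts. -/
lemma IsProblem.integral_lyap_step (hP : IsProblem (diagonal lam) M T ψ σ P Q w)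
    (α β δ γ : ℝ) (j : Fin d) (s : Vec d × Vec d) :
    Integrable (fun z => lyap (lyapWeight β γ (lam j)) w j (step α β δ γ z s)) P ∧
    ∫ z, lyap (lyapWeight β γ (lam j)) w j (step α β δ γ z s) ∂P
      ≤ lyapMean β δ γ (lam j) (s.2 j - w j) (queryErr α w s j)
        + lam j * lyapNoise β δ γ (lam j) * noiseLevel lam ψ σ (queryErr α w s) := by
  have := hP.prob_source
  set u := queryErr α w s with hu
  set θ := lyapWeight β γ (lam j) with hθ
  set b := β * u j + (1 - β) * (s.2 j - w j) with hb
  have h1 := hP.integrable_grad u j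
  have h2 := hP.integrable_grad_sq u j
  have e : ∀ z, lyap θ w j (step α β δ γ z s) = (b ^ 2 + θ * u j ^ 2)
      + ((-2 * γ * b - 2 * θ * δ * u j) * ((z.1 ⬝ᵥ u - (z.2 - w ⬝ᵥ z.1)) * z.1 j)
      + (γ ^ 2 + θ * δ ^ 2) * ((z.1 ⬝ᵥ u - (z.2 - w ⬝ᵥ z.1)) * z.1 j) ^ 2) := by
    intro z
    rw [lyap, step_fst_sub, step_snd_sub, ← hu, ← hb, grad]; ring
  have h3 : Integrable (fun z : Sample d =>
      (-2 * γ * b - 2 * θ * δ * u j) * ((z.1 ⬝ᵥ u - (z.2 - w ⬝ᵥ z.1)) * z.1 j)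
      + (γ ^ 2 + θ * δ ^ 2) * ((z.1 ⬝ᵥ u - (z.2 - w ⬝ᵥ z.1)) * z.1 j) ^ 2) P :=
    (h1.const_mul _).add (h2.const_mul _)
  simp only [e]
  refine ⟨(integrable_const _).add h3, ?_⟩
  rw [integral_add (integrable_const _) h3, integral_add (h1.const_mul _) (h2.const_mul _),
    integral_const_mul, integral_const_mul, hP.integral_grad, integral_const]
  have h4 := hP.integral_grad_sq_le u j
  have h5 : 0 ≤ γ ^ 2 + θ * δ ^ 2 := lyapNoise_nonneg β δ γ (lam j)
  have h6 := mul_le_mul_of_nonneg_left h4 h5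
  simp only [probReal_univ, one_smul, lyapMean, lyapNoise, noiseLevel, ← hθ, ← hb]
  nlinarith [h6]

/-- Integrability after the step is a conclusion: the Markov property is applied to integrals in
`ℝ≥0∞`, which require none, and the resulting bound shows that the value is finite. -/
lemma integral_iterate_succ_le {n : ℕ} [IsProbabilityMeasure P] (θ : Params) {t : ℕ} (ht : t < n)
    {F R : Vec d × Vec d → ℝ} (hF : Measurable F) (hF0 : ∀ s, 0 ≤ F s)
    (hstep : ∀ s, Integrable (fun x => F (step θ.α θ.β (θ.δ / 4 ^ (t / phaseLength n))
        (θ.γ / 4 ^ (t / phaseLength n)) x s)) P ∧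
      ∫ x, F (step θ.α θ.β (θ.δ / 4 ^ (t / phaseLength n))
        (θ.γ / 4 ^ (t / phaseLength n)) x s) ∂P ≤ R s)
    (hR : Integrable (fun z : Data n d => R (iterate θ z t)) (Measure.pi fun _ : Fin n => P)) :
    Integrable (fun z : Data n d => F (iterate θ z (t + 1))) (Measure.pi fun _ : Fin n => P) ∧
    ∫ z : Data n d, F (iterate θ z (t + 1)) ∂(Measure.pi fun _ : Fin n => P)
      ≤ ∫ z : Data n d, R (iterate θ z t) ∂(Measure.pi fun _ : Fin n => P) := by
  have hR0 : ∀ s, 0 ≤ R s := fun s => (integral_nonneg fun x => hF0 _).trans (hstep s).2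
  have key : ∫⁻ z : Data n d, ENNReal.ofReal (F (iterate θ z (t + 1)))
      ∂(Measure.pi fun _ : Fin n => P)
      ≤ ENNReal.ofReal (∫ z : Data n d, R (iterate θ z t) ∂(Measure.pi fun _ : Fin n => P)) := by
    rw [lintegral_iterate_succ P θ ht (fun s => ENNReal.ofReal (F s)) hF.ennreal_ofReal,
      ofReal_integral_eq_lintegral_ofReal hR (ae_of_all _ fun z => hR0 _)]
    refine lintegral_mono fun z => ?_
    rw [← ofReal_integral_eq_lintegral_ofReal (hstep _).1 (ae_of_all _ fun x => hF0 _)]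
    exact ENNReal.ofReal_le_ofReal (hstep _).2
  have hmeas : Measurable fun z : Data n d => F (iterate θ z (t + 1)) :=
    hF.comp (measurable_iterate θ (t + 1))
  have hint : Integrable (fun z : Data n d => F (iterate θ z (t + 1)))
      (Measure.pi fun _ : Fin n => P) := by
    refine ⟨hmeas.aestronglyMeasurable, ?_⟩
    rw [hasFiniteIntegral_iff_ofReal (ae_of_all _ fun z => hF0 _)]
    exact key.trans_lt ENNReal.ofReal_lt_top
  refine ⟨hint, ?_⟩
  rw [← ofReal_integral_eq_lintegral_ofReal hint (ae_of_all _ fun z => hF0 _)] at key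
  exact (ENNReal.ofReal_le_ofReal_iff (integral_nonneg fun z => hR0 _)).1 key

variable {n : ℕ}

/-- The expected Lyapunov function of coordinate `j` after `t` steps. -/
noncomputable def expLyap (n : ℕ) (lam : Fin d → ℝ) (P : Measure (Sample d)) (w : Vec d)
    (θ : Params) (j : Fin d) (t : ℕ) : ℝ :=
  ∫ z : Data n d, lyap (lyapWeight θ.β (θ.γ / 4 ^ (t / phaseLength n)) (lam j)) w j
    (iterate θ z t) ∂(Measure.pi fun _ : Fin n => P)

/-- The expected squared error of the query point in coordinate `j` after `t` steps. -/
noncomputable def expQuery (n : ℕ) (P : Measure (Sample d)) (w : Vec d)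
    (θ : Params) (j : Fin d) (t : ℕ) : ℝ :=
  ∫ z : Data n d, queryErr θ.α w (iterate θ z t) j ^ 2 ∂(Measure.pi fun _ : Fin n => P)

lemma lyapWeight_anti {β γ γ' l : ℝ} (hβ : 0 < β) (hl : 0 ≤ l) (h : γ' ≤ γ) :
    lyapWeight β γ' l ≤ lyapWeight β γ l := by
  unfold lyapWeight; gcongr

lemma div_four_pow_anti {x : ℝ} (hx : 0 ≤ x) {k l : ℕ} (h : k ≤ l) : x / 4 ^ l ≤ x / 4 ^ k := by
  gcongr; norm_num

/-- The noise level in one coordinate involves the query errors of all of them, so the induction has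
to carry all coordinates at once. -/
lemma IsProblem.memLp_iterate (hP : IsProblem (diagonal lam) M T ψ σ P Q w) (θ : Params)
    {t : ℕ} (ht : t ≤ n) (j : Fin d) :
    MemLp (fun z : Data n d => (iterate θ z t).1 j - w j) 2 (Measure.pi fun _ : Fin n => P) ∧
    MemLp (fun z : Data n d => (iterate θ z t).2 j - w j) 2 (Measure.pi fun _ : Fin n => P) := by
  have := hP.prob_source
  induction t generalizing j with
  | zero => simp only [iterate]; exact ⟨memLp_const _, memLp_const _⟩
  | succ t ih =>
    have ih' := fun j => ih (by omega) j
    have hq : ∀ j, MemLp (fun z : Data n d => queryErr θ.α w (iterate θ z t) j) 2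
        (Measure.pi fun _ : Fin n => P) := fun j =>
      ((ih' j).1.const_mul θ.α).add ((ih' j).2.const_mul (1 - θ.α))
    set γ := θ.γ / 4 ^ (t / phaseLength n)
    set δ := θ.δ / 4 ^ (t / phaseLength n)
    have hint := (integral_iterate_succ_le (P := P) θ (t := t) (n := n) (by omega)
      (measurable_lyap (lyapWeight θ.β γ (lam j)) w j)
      (fun s => lyap_nonneg (lyapWeight_nonneg _ _ _) w j s)
      (fun s => hP.integral_lyap_step θ.α θ.β δ γ j s) (by
        have hb : MemLp (fun z : Data n d => θ.β * queryErr θ.α w (iterate θ z t) j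
            + (1 - θ.β) * ((iterate θ z t).2 j - w j)) 2 (Measure.pi fun _ : Fin n => P) :=
          ((hq j).const_mul θ.β).add ((ih' j).2.const_mul (1 - θ.β))
        have h1 := hb.integrable_sq
        have h2 : Integrable (fun z : Data n d => (θ.β * queryErr θ.α w (iterate θ z t) j
            + (1 - θ.β) * ((iterate θ z t).2 j - w j)) * queryErr θ.α w (iterate θ z t) j)
            (Measure.pi fun _ : Fin n => P) := hb.integrable_mul (hq j)
        have h3 := (hq j).integrable_sq
        have h4 : Integrable (fun z : Data n d =>
            ∑ k, lam k * queryErr θ.α w (iterate θ z t) k ^ 2)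
            (Measure.pi fun _ : Fin n => P) :=
          integrable_finsetSum _ fun k _ => ((hq k).integrable_sq).const_mul _
        unfold lyapMean noiseLevel
        refine ((h1.sub ?_).add ((h3.sub (h3.const_mul _)).const_mul _)).add
          (((h4.const_mul _).add (integrable_const _)).const_mul _)
        exact (h2.const_mul (2 * γ * lam j)).congr (ae_of_all _ fun z => by simp only; ring))).1
    have hm : ∀ F : Vec d × Vec d → ℝ, Continuous F →
        Measurable fun z : Data n d => F (iterate θ z (t + 1)) := fun F hF =>
      hF.measurable.comp (measurable_iterate θ (t + 1))
    have m1 := hm (fun s => s.1 j - w j) (by fun_prop)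
    have m2 := hm (fun s => s.2 j - w j) (by fun_prop)
    have hθ := one_le_lyapWeight θ.β γ (lam j)
    constructor
    · rw [memLp_two_iff_integrable_sq m1.aestronglyMeasurable]
      refine hint.mono' (m1.pow_const 2).aestronglyMeasurable (ae_of_all _ fun z => ?_)
      rw [Real.norm_of_nonneg (sq_nonneg _), lyap]
      nlinarith [sq_nonneg ((iterate θ z (t + 1)).1 j - w j),
        sq_nonneg ((iterate θ z (t + 1)).2 j - w j)]
    · rw [memLp_two_iff_integrable_sq m2.aestronglyMeasurable]
      refine hint.mono' (m2.pow_const 2).aestronglyMeasurable (ae_of_all _ fun z => ?_)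
      rw [Real.norm_of_nonneg (sq_nonneg _), lyap]
      nlinarith [sq_nonneg ((iterate θ z (t + 1)).1 j - w j),
        sq_nonneg ((iterate θ z (t + 1)).2 j - w j)]

lemma IsProblem.memLp_query (hP : IsProblem (diagonal lam) M T ψ σ P Q w) (θ : Params)
    {t : ℕ} (ht : t ≤ n) (j : Fin d) :
    MemLp (fun z : Data n d => queryErr θ.α w (iterate θ z t) j) 2
      (Measure.pi fun _ : Fin n => P) :=
  ((hP.memLp_iterate θ ht j).1.const_mul θ.α).add ((hP.memLp_iterate θ ht j).2.const_mul (1 - θ.α))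

lemma IsProblem.integrable_lyap (hP : IsProblem (diagonal lam) M T ψ σ P Q w) (θ : Params)
    {t : ℕ} (ht : t ≤ n) (j : Fin d) (ω : ℝ) :
    Integrable (fun z : Data n d => lyap ω w j (iterate θ z t)) (Measure.pi fun _ : Fin n => P) :=
  (hP.memLp_iterate θ ht j).2.integrable_sq.add
    ((hP.memLp_iterate θ ht j).1.integrable_sq.const_mul ω)

/-- The expected noise level after `t` steps. -/
noncomputable def expNoise (n : ℕ) (lam : Fin d → ℝ) (ψ σ : ℝ) (P : Measure (Sample d))
    (w : Vec d) (θ : Params) (t : ℕ) : ℝ :=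
  2 * ψ * (∑ k, lam k * expQuery n P w θ k t) + 2 * σ ^ 2

/-- One step of the recursion of the expected Lyapunov function: whenever the conditional mean of
the Lyapunov function is bounded by `c V - e u²`, so is its expectation, up to noise. -/
lemma IsProblem.expLyap_succ_le_of (hP : IsProblem (diagonal lam) M T ψ σ P Q w) (θ : Params)
    {t : ℕ} (ht : t < n) (j : Fin d) (hβ : 0 < θ.β) (hγ : 0 ≤ θ.γ) (hl : 0 ≤ lam j) (c e : ℝ)
    (h : ∀ s : Vec d × Vec d, lyapMean θ.β (θ.δ / 4 ^ (t / phaseLength n))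
        (θ.γ / 4 ^ (t / phaseLength n)) (lam j) (s.2 j - w j) (queryErr θ.α w s j)
      ≤ c * lyap (lyapWeight θ.β (θ.γ / 4 ^ (t / phaseLength n)) (lam j)) w j s
        - e * queryErr θ.α w s j ^ 2) :
    expLyap n lam P w θ j (t + 1) ≤ c * expLyap n lam P w θ j t - e * expQuery n P w θ j t
      + lam j * lyapNoise θ.β (θ.δ / 4 ^ (t / phaseLength n)) (θ.γ / 4 ^ (t / phaseLength n))
        (lam j) * expNoise n lam ψ σ P w θ t := by
  have := hP.prob_source
  set γ := θ.γ / 4 ^ (t / phaseLength n) with hγd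
  set δ := θ.δ / 4 ^ (t / phaseLength n) with hδd
  set κ := lyapNoise θ.β δ γ (lam j)
  have i1 := (hP.integrable_lyap (n := n) θ ht.le j (lyapWeight θ.β γ (lam j))).const_mul c
  have i2 := ((hP.memLp_query (n := n) θ ht.le j).integrable_sq).const_mul e
  have i3 : Integrable (fun z : Data n d => ∑ k, lam k * queryErr θ.α w (iterate θ z t) k ^ 2)
      (Measure.pi fun _ : Fin n => P) :=
    integrable_finsetSum _ fun k _ => ((hP.memLp_query (n := n) θ ht.le k).integrable_sq).const_mul _
  have i4 : Integrable (fun z : Data n d => noiseLevel lam ψ σ (queryErr θ.α w (iterate θ z t)))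
      (Measure.pi fun _ : Fin n => P) := (i3.const_mul _).add (integrable_const _)
  have e4 : ∫ z : Data n d, noiseLevel lam ψ σ (queryErr θ.α w (iterate θ z t))
      ∂(Measure.pi fun _ : Fin n => P) = expNoise n lam ψ σ P w θ t := by
    unfold noiseLevel expNoise expQuery
    rw [integral_add (i3.const_mul _) (integrable_const _), integral_const_mul,
      integral_finsetSum _ fun k _ =>
        ((hP.memLp_query (n := n) θ ht.le k).integrable_sq).const_mul _]
    simp [integral_const_mul]
  have hmain := (integral_iterate_succ_le (P := P) (n := n) θ ht
    (R := fun s => c * lyap (lyapWeight θ.β γ (lam j)) w j s - e * queryErr θ.α w s j ^ 2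
      + lam j * κ * noiseLevel lam ψ σ (queryErr θ.α w s))
    (measurable_lyap (lyapWeight θ.β γ (lam j)) w j)
    (fun s => lyap_nonneg (lyapWeight_nonneg _ _ _) w j s)
    (fun s => by
      have h0 := hP.integral_lyap_step θ.α θ.β δ γ j s
      exact ⟨h0.1, h0.2.trans (by have := h s; linarith)⟩)
    ((i1.sub i2).add (i4.const_mul (lam j * κ)))).2
  have i12 : Integrable (fun z : Data n d => c * lyap (lyapWeight θ.β γ (lam j)) w j
      (iterate θ z t) - e * queryErr θ.α w (iterate θ z t) j ^ 2)
      (Measure.pi fun _ : Fin n => P) := i1.sub i2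
  rw [integral_add i12 (i4.const_mul _), integral_sub i1 i2, integral_const_mul,
    integral_const_mul, integral_const_mul, e4] at hmain
  refine le_trans ?_ hmain
  -- At a change of phase the weight at time `t + 1` belongs to the smaller step size, and the
  -- weight is monotone in it.
  refine integral_mono (hP.integrable_lyap θ (by omega) j _)
    (hP.integrable_lyap θ (by omega) j _) fun z => ?_
  refine lyap_mono (lyapWeight_anti hβ hl (div_four_pow_anti hγ ?_)) _ _ _
  exact Nat.div_le_div_right (by omega)

lemma queryErr_mul {α β : ℝ} (hβ : 0 < β) (hα : α = 1 / (1 + β)) (w : Vec d) (s : Vec d × Vec d)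
    (j : Fin d) : queryErr α w s j * (1 + β) = (s.1 j - w j) + β * (s.2 j - w j) := by
  rw [queryErr, hα]; field_simp; ring

lemma IsProblem.expLyap_succ_le (hP : IsProblem (diagonal lam) M T ψ σ P Q w) (θ : Params)
    {t : ℕ} (ht : t < n) (j : Fin d) (hβ : 0 < θ.β) (hβ1 : θ.β ≤ 1) (hα : θ.α = 1 / (1 + θ.β))
    (hγ : 0 < θ.γ) (hδ : 0 < θ.δ) (hl : 0 < lam j) :
    expLyap n lam P w θ j (t + 1)
      ≤ (1 - lyapRate θ.β (θ.γ / 4 ^ (t / phaseLength n)) (lam j)) * expLyap n lam P w θ j t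
      + lam j * lyapNoise θ.β (θ.δ / 4 ^ (t / phaseLength n)) (θ.γ / 4 ^ (t / phaseLength n))
        (lam j) * expNoise n lam ψ σ P w θ t := by
  have := hP.expLyap_succ_le_of θ ht j hβ hγ.le hl.le
    (1 - lyapRate θ.β (θ.γ / 4 ^ (t / phaseLength n)) (lam j)) 0 (fun s => by
      rw [zero_mul, sub_zero]
      exact lyapMean_le hβ hβ1 hl (by positivity) (by positivity) (queryErr_mul hβ hα w s j))
  linarith

lemma IsProblem.expLyap_succ_add_le (hP : IsProblem (diagonal lam) M T ψ σ P Q w) (θ : Params)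
    {t : ℕ} (ht : t < n) (j : Fin d) (hβ : 0 < θ.β) (hβ1 : θ.β ≤ 1) (hα : θ.α = 1 / (1 + θ.β))
    (hγ : 0 < θ.γ) (hδ : 0 < θ.δ) (hδγ : θ.δ ≤ θ.γ) (hl : 0 < lam j)
    (hb : θ.β * θ.γ * lam j ≤ 1) :
    expLyap n lam P w θ j (t + 1)
      + lyapDec θ.β (θ.δ / 4 ^ (t / phaseLength n)) (θ.γ / 4 ^ (t / phaseLength n)) (lam j)
        * expQuery n P w θ j t
      ≤ expLyap n lam P w θ j t
      + lam j * lyapNoise θ.β (θ.δ / 4 ^ (t / phaseLength n)) (θ.γ / 4 ^ (t / phaseLength n))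
        (lam j) * expNoise n lam ψ σ P w θ t := by
  have := hP.expLyap_succ_le_of θ ht j hβ hγ.le hl.le 1
    (lyapDec θ.β (θ.δ / 4 ^ (t / phaseLength n)) (θ.γ / 4 ^ (t / phaseLength n)) (lam j))
    (fun s => by
      rw [one_mul]
      refine le_sub_iff_add_le.2 (lyapMean_add_le hβ hβ1 hl (by positivity) (by positivity)
        (by gcongr) (le_trans ?_ hb) (queryErr_mul hβ hα w s j))
      have := div_four_pow_anti hγ.le (Nat.zero_le (t / phaseLength n))
      rw [pow_zero, div_one] at this
      gcongr)
  linarith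

lemma IsProblem.expQuery_le (hP : IsProblem (diagonal lam) M T ψ σ P Q w) (θ : Params)
    {t : ℕ} (ht : t ≤ n) (j : Fin d) (hβ : 0 < θ.β) (hα : θ.α = 1 / (1 + θ.β)) :
    expQuery n P w θ j t ≤ expLyap n lam P w θ j t :=
  integral_mono (hP.memLp_query θ ht j).integrable_sq (hP.integrable_lyap θ ht j _) fun _ =>
    sq_average_le hβ (queryErr_mul hβ hα w _ j) _ (one_le_lyapWeight _ _ _)

lemma expQuery_nonneg (θ : Params) (t : ℕ) (j : Fin d) : 0 ≤ expQuery n P w θ j t :=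
  integral_nonneg fun _ => sq_nonneg _

lemma IsProblem.expLyap_zero (hP : IsProblem (diagonal lam) M T ψ σ P Q w) (θ : Params)
    (j : Fin d) :
    expLyap n lam P w θ j 0 = (1 + lyapWeight θ.β θ.γ (lam j)) * w j ^ 2 := by
  have := hP.prob_source
  simp [expLyap, iterate, lyap]; ring

lemma IsProblem.integral_sq_iterate_le (hP : IsProblem (diagonal lam) M T ψ σ P Q w) (θ : Params)
    {t : ℕ} (ht : t ≤ n) (j : Fin d) :
    ∫ z : Data n d, ((iterate θ z t).1 j - w j) ^ 2 ∂(Measure.pi fun _ : Fin n => P)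
      ≤ expLyap n lam P w θ j t :=
  integral_mono (hP.memLp_iterate θ ht j).1.integrable_sq (hP.integrable_lyap θ ht j _) fun z => by
    have hθ := one_le_lyapWeight θ.β (θ.γ / 4 ^ (t / phaseLength n)) (lam j)
    simp only [lyap]
    nlinarith [sq_nonneg ((iterate θ z t).1 j - w j), sq_nonneg ((iterate θ z t).2 j - w j)]

end

end CovShift

/-! ### The recursion over the phases -/

namespace CovShift

/-- A smooth version of `min 1 x²`. -/
noncomputable def satSq (x : ℝ) : ℝ := x ^ 2 / (1 + x ^ 2)

lemma satSq_nonneg (x : ℝ) : 0 ≤ satSq x := by unfold satSq; positivity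

lemma satSq_le_one (x : ℝ) : satSq x ≤ 1 := by
  unfold satSq; rw [div_le_one (by positivity)]; linarith

lemma satSq_le_self {x : ℝ} (hx : 0 ≤ x) : satSq x ≤ x := by
  unfold satSq; rw [div_le_iff₀ (by positivity)]
  nlinarith [mul_nonneg hx (sq_nonneg (x - 1)), mul_nonneg hx hx]

lemma satSq_le_sq (x : ℝ) : satSq x ≤ x ^ 2 := by
  unfold satSq; rw [div_le_iff₀ (by positivity)]
  nlinarith [sq_nonneg x, sq_nonneg (x ^ 2)]

lemma sq_le_two_mul_satSq {x y : ℝ} (hy : 0 ≤ y) (hy1 : y ≤ 1) (hyx : y ≤ x) :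
    y ^ 2 ≤ 2 * satSq x := by
  unfold satSq
  rw [← mul_div_assoc, le_div_iff₀ (by positivity)]
  nlinarith [mul_nonneg (sq_nonneg x) (by nlinarith : 0 ≤ 1 - y ^ 2), pow_le_pow_left₀ hy hyx 2]

lemma half_le_satSq {x : ℝ} (hx : 1 ≤ x) : 1 / 2 ≤ satSq x := by
  have := sq_le_two_mul_satSq (x := x) zero_le_one le_rfl hx
  linarith

/-- The source of the telescoping: with `x = γ λ K`, the noise of a phase survives the next one with
the factor `exp (-x / 8)`, and there `x` is replaced by `x / 4`. Both sides have order `x²` near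
zero; for large `x` the right-hand side decays only like `x⁻²`. -/
lemma sq_mul_exp_le {x : ℝ} (hx : 0 ≤ x) :
    x ^ 2 * Real.exp (-(x / 8)) ≤ 100000 * (satSq x - satSq (x / 4)) := by
  have e1 : satSq x - satSq (x / 4)
      = (15 / 16) * x ^ 2 / ((1 + x ^ 2) * (1 + x ^ 2 / 16)) := by
    unfold satSq; field_simp; ring
  have e2 : (1 + x / 32) ^ 4 ≤ Real.exp (x / 8) := by
    have h := pow_le_pow_left₀ (by positivity) (Real.add_one_le_exp (x / 32)) 4
    rw [← Real.exp_nat_mul] at h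
    calc (1 + x / 32) ^ 4 = (x / 32 + 1) ^ 4 := by ring
      _ ≤ _ := h
      _ = _ := by congr 1; push_cast; ring
  have e3 : (1 + x ^ 2) * (1 + x ^ 2 / 16) ≤ 65536 * (1 + x / 32) ^ 4 := by
    have : 65536 * (1 + x / 32) ^ 4 - (1 + x ^ 2) * (1 + x ^ 2 / 16)
      = 65535 + 8192 * x + (384 - 17 / 16) * x ^ 2 + 8 * x ^ 3 := by ring
    have h3 : 0 ≤ 65535 + 8192 * x + (384 - 17 / 16) * x ^ 2 + 8 * x ^ 3 := by positivity
    linarith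
  rw [e1, Real.exp_neg, ← div_eq_mul_inv, ← mul_div_assoc, div_le_div_iff₀ (by positivity)
    (by positivity)]
  have h4 := e3.trans (mul_le_mul_of_nonneg_left e2 (by norm_num))
  nlinarith [mul_le_mul_of_nonneg_left h4 (sq_nonneg x),
    mul_nonneg (sq_nonneg x) (Real.exp_pos (x / 8)).le]

/-- The contribution of a coordinate with eigenvalue `l` to the feedback of the noise. -/
noncomputable def feedback (β δ γ l : ℝ) : ℝ := γ * l / max 1 (δ * l / β) + δ * l

lemma lyapWeight_eq_one {β γ l : ℝ} (hβ : 0 < β) (h : γ * l ≤ β) : lyapWeight β γ l = 1 :=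
  max_eq_left (by rwa [div_le_one hβ])

lemma lyapWeight_eq {β γ l : ℝ} (hβ : 0 < β) (h : β ≤ γ * l) : lyapWeight β γ l = γ * l / β :=
  max_eq_right (by rwa [one_le_div hβ])

/-- The recursion of the expected Lyapunov function `a` and of the expected squared error `u` of
the query point, in one coordinate with eigenvalue `l`; `N` is the noise level, with average at
most `Nb` over each of the `L` phases of length `K`. -/
structure PhaseRec (β δ γ l Nb w2 : ℝ) (K L : ℕ) (a u N : ℕ → ℝ) : Prop where
  β_pos : 0 < β
  β_le : β ≤ 1
  δ_pos : 0 < δ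
  δ_le : δ ≤ γ
  l_pos : 0 < l
  K_pos : 0 < K
  w2_nonneg : 0 ≤ w2
  contract : ∀ t < L * K, a (t + 1) ≤ (1 - lyapRate β (γ / 4 ^ (t / K)) l) * a t
    + l * lyapNoise β (δ / 4 ^ (t / K)) (γ / 4 ^ (t / K)) l * N t
  dissip : ∀ t < L * K, a (t + 1) + lyapDec β (δ / 4 ^ (t / K)) (γ / 4 ^ (t / K)) l * u t
    ≤ a t + l * lyapNoise β (δ / 4 ^ (t / K)) (γ / 4 ^ (t / K)) l * N t
  a_nonneg : ∀ t, 0 ≤ a t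
  u_le : ∀ t < L * K, u t ≤ a t
  N_nonneg : ∀ t, 0 ≤ N t
  N_sum : ∀ ℓ < L, ∑ i ∈ Finset.range K, N (ℓ * K + i) ≤ K * Nb
  Nb_nonneg : 0 ≤ Nb
  init : a 0 ≤ (1 + lyapWeight β γ l) * w2
  warm : 1 ≤ β * K
  -- A phase contracts a coordinate with `γ l ≥ β` by `exp (-(β K / 2))`. The next two conditions
  -- let this factor beat the noise of a phase and the initial weight.
  small₁ : L * K ^ 2 * l ^ 2 * lyapNoise β δ γ l * Real.exp (-(β * K / 2)) ≤ 1
  small₂ : γ * l / β * Real.exp (-(β * K / 2)) ≤ 1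
  -- In the last phase, step size times eigenvalue times phase length is at most one, so that even
  -- undamped noise has the final order.
  last : γ * l * K ≤ 4 ^ (L - 1)

namespace PhaseRec

variable {β δ γ l Nb w2 : ℝ} {K L : ℕ} {a u N : ℕ → ℝ}

lemma lyapRate_mem {β γ l : ℝ} (hβ : 0 < β) (hβ1 : β ≤ 1) (hγl : 0 ≤ γ * l) :
    0 ≤ lyapRate β γ l ∧ lyapRate β γ l ≤ 1 := by
  unfold lyapRate
  have h1 : 0 ≤ min β (γ * l) := le_min hβ.le hγl
  have h2 := min_le_left β (γ * l)
  constructor <;> linarith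

lemma index_div {ℓ i : ℕ} (hi : i < K) : (ℓ * K + i) / K = ℓ := by
  rw [mul_comm, Nat.mul_add_div (by omega), Nat.div_eq_of_lt hi, add_zero]

lemma index_lt {ℓ i : ℕ} (hℓ : ℓ < L) (hi : i < K) : ℓ * K + i < L * K := by
  have : (ℓ + 1) * K ≤ L * K := Nat.mul_le_mul_right _ hℓ
  rw [add_mul, one_mul] at this; omega

variable (h : PhaseRec β δ γ l Nb w2 K L a u N)
include h

lemma γ_pos : 0 < γ := h.δ_pos.trans_le h.δ_le

/-- Noise is not damped within its own phase, because only the sum of `N` over a phase is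
controlled. -/
lemma phase_step {ℓ : ℕ} (hℓ : ℓ < L) {i : ℕ} (hi : i ≤ K) :
    a (ℓ * K + i) ≤ (1 - lyapRate β (γ / 4 ^ ℓ) l) ^ i * a (ℓ * K)
      + l * lyapNoise β (δ / 4 ^ ℓ) (γ / 4 ^ ℓ) l * ∑ i' ∈ Finset.range i, N (ℓ * K + i') := by
  have hγ := h.γ_pos
  have hl := h.l_pos
  have hr := lyapRate_mem (γ := γ / 4 ^ ℓ) (l := l) h.β_pos h.β_le (by positivity)
  induction i with
  | zero => simp
  | succ i ih =>
    have h1 := h.contract (ℓ * K + i) (index_lt hℓ (by omega))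
    rw [index_div (by omega)] at h1
    have h2 := mul_le_mul_of_nonneg_left (ih (by omega)) (sub_nonneg.2 hr.2)
    rw [Finset.sum_range_succ, ← add_assoc, pow_succ]
    have h3 : 0 ≤ l * lyapNoise β (δ / 4 ^ ℓ) (γ / 4 ^ ℓ) l
        * ∑ i' ∈ Finset.range i, N (ℓ * K + i') := by
      have := lyapNoise_nonneg β (δ / 4 ^ ℓ) (γ / 4 ^ ℓ) l
      have := Finset.sum_nonneg (s := Finset.range i) fun i' _ => h.N_nonneg (ℓ * K + i')
      positivity
    nlinarith [mul_nonneg hr.1 h3]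

lemma noise_phase {ℓ : ℕ} (hℓ : ℓ < L) {i : ℕ} (hi : i ≤ K) :
    l * lyapNoise β (δ / 4 ^ ℓ) (γ / 4 ^ ℓ) l * ∑ i' ∈ Finset.range i, N (ℓ * K + i')
      ≤ l * lyapNoise β (δ / 4 ^ ℓ) (γ / 4 ^ ℓ) l * (K * Nb) := by
  refine mul_le_mul_of_nonneg_left ?_
    (mul_nonneg h.l_pos.le (lyapNoise_nonneg _ _ _ _))
  refine (Finset.sum_le_sum_of_subset_of_nonneg (Finset.range_mono hi)
    fun i' _ _ => h.N_nonneg _).trans (h.N_sum ℓ hℓ)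

lemma phase_le {ℓ : ℕ} (hℓ : ℓ < L) {i : ℕ} (hi : i ≤ K) :
    a (ℓ * K + i) ≤ a (ℓ * K) + l * lyapNoise β (δ / 4 ^ ℓ) (γ / 4 ^ ℓ) l * (K * Nb) := by
  have hγ := h.γ_pos
  have hl := h.l_pos
  have hr := lyapRate_mem (γ := γ / 4 ^ ℓ) (l := l) h.β_pos h.β_le (by positivity)
  refine (h.phase_step hℓ hi).trans (add_le_add ?_ (h.noise_phase hℓ hi))
  exact mul_le_of_le_one_left (h.a_nonneg _) (pow_le_one₀ (sub_nonneg.2 hr.2) (by linarith))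

lemma phase_succ {ℓ : ℕ} (hℓ : ℓ < L) :
    a ((ℓ + 1) * K) ≤ Real.exp (-(lyapRate β (γ / 4 ^ ℓ) l * K)) * a (ℓ * K)
      + l * lyapNoise β (δ / 4 ^ ℓ) (γ / 4 ^ ℓ) l * (K * Nb) := by
  have hγ := h.γ_pos
  have hl := h.l_pos
  have hr := lyapRate_mem (γ := γ / 4 ^ ℓ) (l := l) h.β_pos h.β_le (by positivity)
  rw [add_mul, one_mul]
  refine (h.phase_step hℓ le_rfl).trans (add_le_add ?_ (h.noise_phase hℓ le_rfl))
  refine mul_le_mul_of_nonneg_right ?_ (h.a_nonneg _)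
  have := pow_le_pow_left₀ (sub_nonneg.2 hr.2) (Real.one_sub_le_exp_neg (lyapRate β (γ / 4 ^ ℓ) l)) K
  rwa [← Real.exp_nat_mul, mul_neg, mul_comm (K : ℝ)] at this

/-- `dissip` telescopes over the phase, and the final value of `a` is dropped. -/
lemma phase_dissip {ℓ : ℕ} (hℓ : ℓ < L) :
    lyapDec β (δ / 4 ^ ℓ) (γ / 4 ^ ℓ) l * ∑ i ∈ Finset.range K, u (ℓ * K + i)
      ≤ a (ℓ * K) + l * lyapNoise β (δ / 4 ^ ℓ) (γ / 4 ^ ℓ) l * (K * Nb) := by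
  have key : ∀ i ≤ K, a (ℓ * K + i)
      + lyapDec β (δ / 4 ^ ℓ) (γ / 4 ^ ℓ) l * ∑ i' ∈ Finset.range i, u (ℓ * K + i')
      ≤ a (ℓ * K) + l * lyapNoise β (δ / 4 ^ ℓ) (γ / 4 ^ ℓ) l
        * ∑ i' ∈ Finset.range i, N (ℓ * K + i') := by
    intro i
    induction i with
    | zero => simp
    | succ i ih =>
      intro hi
      have h1 := h.dissip (ℓ * K + i) (index_lt hℓ (by omega))
      rw [index_div (by omega)] at h1
      have h2 := ih (by omega)
      rw [Finset.sum_range_succ, Finset.sum_range_succ, ← add_assoc]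
      linarith
  have h1 := key K le_rfl
  have h2 := h.noise_phase hℓ le_rfl
  have h3 := h.a_nonneg (ℓ * K + K)
  linarith

end PhaseRec

/-- The accumulated noise of the first `ℓ` phases, for noise level one. -/
noncomputable def phaseNoise (β δ γ l : ℝ) (K : ℕ) : ℕ → ℝ
  | 0 => 0
  | ℓ + 1 => Real.exp (-(lyapRate β (γ / 4 ^ ℓ) l * K)) * phaseNoise β δ γ l K ℓ
      + l * lyapNoise β (δ / 4 ^ ℓ) (γ / 4 ^ ℓ) l * K

lemma lyapNoise_le_of_le {β δ γ l c : ℝ} (hβ : 0 < β) (hδ : 0 ≤ δ) (hδγ : δ ≤ γ)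
    (hc : 1 ≤ c) (h : γ * l ≤ c * β) : lyapNoise β δ γ l ≤ (1 + c) * γ ^ 2 := by
  have h1 : lyapWeight β γ l ≤ c := max_le hc (by rwa [div_le_iff₀ hβ])
  have h2 : δ ^ 2 ≤ γ ^ 2 := pow_le_pow_left₀ hδ hδγ 2
  have h3 : lyapWeight β γ l * δ ^ 2 ≤ c * γ ^ 2 :=
    mul_le_mul h1 h2 (sq_nonneg _) (by linarith)
  unfold lyapNoise; linarith

lemma lyapNoise_anti {β δ γ l : ℝ} (hβ : 0 < β) (hδ : 0 ≤ δ) (hγ : 0 ≤ γ) (hl : 0 ≤ l) (k : ℕ) :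
    lyapNoise β (δ / 4 ^ k) (γ / 4 ^ k) l ≤ lyapNoise β δ γ l := by
  have h1 : γ / 4 ^ k ≤ γ := div_le_self hγ (one_le_pow₀ (by norm_num))
  have h2 : δ / 4 ^ k ≤ δ := div_le_self hδ (one_le_pow₀ (by norm_num))
  have h3 := lyapWeight_anti hβ hl h1
  have h4 := lyapWeight_nonneg β γ l
  unfold lyapNoise
  gcongr

namespace PhaseRec

variable {β δ γ l Nb w2 : ℝ} {K L : ℕ} {a u N : ℕ → ℝ}
variable (h : PhaseRec β δ γ l Nb w2 K L a u N)
include h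

lemma start_le {ℓ : ℕ} (hℓ : ℓ ≤ L) :
    a (ℓ * K) ≤ (∏ k ∈ Finset.range ℓ, Real.exp (-(lyapRate β (γ / 4 ^ k) l * K))) * a 0
      + Nb * phaseNoise β δ γ l K ℓ := by
  induction ℓ with
  | zero => simp [phaseNoise]
  | succ ℓ ih =>
    refine (h.phase_succ (by omega)).trans ?_
    have := mul_le_mul_of_nonneg_left (ih (by omega))
      (Real.exp_pos (-(lyapRate β (γ / 4 ^ ℓ) l * K))).le
    rw [Finset.prod_range_succ, phaseNoise]
    linarith

lemma exp_rate_le_one (k : ℕ) : Real.exp (-(lyapRate β (γ / 4 ^ k) l * K)) ≤ 1 := by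
  have hγ := h.γ_pos
  have hl := h.l_pos
  have hr := lyapRate_mem (γ := γ / 4 ^ k) (l := l) h.β_pos h.β_le (by positivity)
  rw [Real.exp_le_one_iff]
  have : (0 : ℝ) ≤ K := by positivity
  nlinarith [hr.1]

/-- The noise of a phase is credited with the decay of the following phase only; this already
suffices for a telescoping bound. -/
lemma phaseNoise_succ_le (ℓ : ℕ) :
    phaseNoise β δ γ l K (ℓ + 1) ≤ l * lyapNoise β (δ / 4 ^ ℓ) (γ / 4 ^ ℓ) l * K
      + ∑ k ∈ Finset.range ℓ, Real.exp (-(lyapRate β (γ / 4 ^ (k + 1)) l * K))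
        * (l * lyapNoise β (δ / 4 ^ k) (γ / 4 ^ k) l * K) := by
  have hl := h.l_pos
  induction ℓ with
  | zero => simp [phaseNoise]
  | succ ℓ ih =>
    rw [phaseNoise, Finset.sum_range_succ]
    have h1 := mul_le_mul_of_nonneg_left ih
      (Real.exp_pos (-(lyapRate β (γ / 4 ^ (ℓ + 1)) l * K))).le
    have h2 : 0 ≤ ∑ k ∈ Finset.range ℓ, Real.exp (-(lyapRate β (γ / 4 ^ (k + 1)) l * K))
        * (l * lyapNoise β (δ / 4 ^ k) (γ / 4 ^ k) l * K) := Finset.sum_nonneg fun k _ => by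
      have := lyapNoise_nonneg β (δ / 4 ^ k) (γ / 4 ^ k) l
      positivity
    have h3 := mul_le_of_le_one_left h2 (h.exp_rate_le_one (ℓ + 1))
    nlinarith

/-- The case distinction at `4 β` decides whether the following phase, with a quarter of the step,
is slow or fast. If it is slow, the noise is at most `5 γ²` and `sq_mul_exp_le` applies. If it is
fast, `small₁` leaves a share `1 / L` of the bound, so that all phases together cost a constant. -/
lemma decayed_noise_le (hL : 0 < L) (k : ℕ) :
    Real.exp (-(lyapRate β (γ / 4 ^ (k + 1)) l * K)) * (l * lyapNoise β (δ / 4 ^ k) (γ / 4 ^ k) l * K)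
      ≤ 500000 / (l * K) * (satSq (γ * l * K / 4 ^ k) - satSq (γ * l * K / 4 ^ (k + 1)))
        + 2 * satSq (γ * l * K) / (L * (l * K)) := by
  have hγ := h.γ_pos
  have hl := h.l_pos
  have hβ := h.β_pos
  have hδ := h.δ_pos
  have hK : (0 : ℝ) < K := by exact_mod_cast h.K_pos
  have hL' : (0 : ℝ) < L := by exact_mod_cast hL
  have hγk : (0 : ℝ) < γ / 4 ^ k := by positivity
  have hδk : (0 : ℝ) < δ / 4 ^ k := by positivity
  have hδγ : δ / 4 ^ k ≤ γ / 4 ^ k := by have := h.δ_le; gcongr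
  have eγ : γ / 4 ^ (k + 1) = γ / 4 ^ k / 4 := by rw [pow_succ]; field_simp
  have ex : γ * l * K / 4 ^ k = γ / 4 ^ k * l * K := by ring
  have ex' : γ * l * K / 4 ^ (k + 1) = γ / 4 ^ k * l * K / 4 := by rw [pow_succ]; field_simp
  have hx : 0 ≤ γ / 4 ^ k * l * K := by positivity
  have hf := sq_mul_exp_le hx
  rcases le_or_gt (γ / 4 ^ k * l) (4 * β) with hc | hc
  · have h1 : lyapNoise β (δ / 4 ^ k) (γ / 4 ^ k) l ≤ 5 * (γ / 4 ^ k) ^ 2 := by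
      have := lyapNoise_le_of_le (l := l) (c := 4) hβ hδk.le hδγ (by norm_num) hc
      linarith
    have h2 : lyapRate β (γ / 4 ^ (k + 1)) l * K = γ / 4 ^ k * l * K / 8 := by
      unfold lyapRate
      rw [eγ, min_eq_right (by linarith)]; ring
    rw [h2, ex, ex']
    have h3 : 0 ≤ 2 * satSq (γ * l * K) / (L * (l * K)) := by
      have := satSq_nonneg (γ * l * K); positivity
    refine le_trans ?_ (le_add_of_nonneg_right h3)
    calc Real.exp (-(γ / 4 ^ k * l * K / 8)) * (l * lyapNoise β (δ / 4 ^ k) (γ / 4 ^ k) l * K)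
        ≤ Real.exp (-(γ / 4 ^ k * l * K / 8)) * (l * (5 * (γ / 4 ^ k) ^ 2) * K) := by gcongr
      _ = 5 / (l * K) * ((γ / 4 ^ k * l * K) ^ 2 * Real.exp (-(γ / 4 ^ k * l * K / 8))) := by
          field_simp
      _ ≤ 5 / (l * K) * (100000 * (satSq (γ / 4 ^ k * l * K) - satSq (γ / 4 ^ k * l * K / 4))) := by
          gcongr
      _ = _ := by ring
  · have h2 : lyapRate β (γ / 4 ^ (k + 1)) l * K = β * K / 2 := by
      unfold lyapRate
      rw [eγ, min_eq_left (by linarith)]; ring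
    have h0 : 0 ≤ satSq (γ * l * K / 4 ^ k) - satSq (γ * l * K / 4 ^ (k + 1)) := by
      rw [ex, ex']
      have : 0 ≤ (γ / 4 ^ k * l * K) ^ 2 * Real.exp (-(γ / 4 ^ k * l * K / 8)) := by positivity
      linarith
    refine le_trans ?_ (le_add_of_nonneg_left (by positivity))
    rw [h2]
    have h4 := lyapNoise_anti (l := l) hβ hδ.le hγ.le hl.le k
    have hg : 1 ≤ γ * l * K := by
      have h5 : γ / 4 ^ k ≤ γ := div_le_self hγ.le (one_le_pow₀ (by norm_num))
      have h6 : 4 * β ≤ γ * l := hc.le.trans (by gcongr)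
      nlinarith [h.warm]
    have h7 := half_le_satSq hg
    calc Real.exp (-(β * K / 2)) * (l * lyapNoise β (δ / 4 ^ k) (γ / 4 ^ k) l * K)
        ≤ Real.exp (-(β * K / 2)) * (l * lyapNoise β δ γ l * K) := by gcongr
      _ = (L * K ^ 2 * l ^ 2 * lyapNoise β δ γ l * Real.exp (-(β * K / 2))) / (L * (l * K)) := by
          field_simp
      _ ≤ 2 * satSq (γ * l * K) / (L * (l * K)) := by
          exact div_le_div_of_nonneg_right (h.small₁.trans (by linarith)) (by positivity)

lemma phaseNoise_le {ℓ : ℕ} (hℓ : ℓ < L) :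
    phaseNoise β δ γ l K (ℓ + 1) ≤ l * lyapNoise β (δ / 4 ^ ℓ) (γ / 4 ^ ℓ) l * K
      + 500002 / (l * K) * satSq (γ * l * K) := by
  have hl := h.l_pos
  have hK : (0 : ℝ) < K := by exact_mod_cast h.K_pos
  have hL : 0 < L := by omega
  have hL' : (0 : ℝ) < L := by exact_mod_cast hL
  refine (h.phaseNoise_succ_le ℓ).trans (add_le_add le_rfl ?_)
  refine (Finset.sum_le_sum fun k _ => h.decayed_noise_le hL k).trans ?_
  rw [Finset.sum_add_distrib, ← Finset.mul_sum,
    Finset.sum_range_sub' (fun k => satSq (γ * l * K / 4 ^ k)), Finset.sum_const,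
    Finset.card_range, nsmul_eq_mul, pow_zero, div_one]
  have h1 := satSq_nonneg (γ * l * K / 4 ^ ℓ)
  have h2 := satSq_nonneg (γ * l * K)
  have h3 : (ℓ : ℝ) * (2 * satSq (γ * l * K) / (L * (l * K))) ≤ 2 / (l * K) * satSq (γ * l * K) := by
    have : (ℓ : ℝ) ≤ L := by exact_mod_cast hℓ.le
    calc (ℓ : ℝ) * (2 * satSq (γ * l * K) / (L * (l * K)))
        ≤ (L : ℝ) * (2 * satSq (γ * l * K) / (L * (l * K))) := by gcongr
      _ = _ := by field_simp
  have h4 : 500000 / (l * K) * (satSq (γ * l * K) - satSq (γ * l * K / 4 ^ ℓ))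
      ≤ 500000 / (l * K) * satSq (γ * l * K) := by gcongr; linarith
  have h5 : 500002 / (l * K) * satSq (γ * l * K) = 500000 / (l * K) * satSq (γ * l * K)
    + 2 / (l * K) * satSq (γ * l * K) := by ring
  linarith

/-- Only the first phase, which has the largest steps, is used to contract the initial error. -/
lemma bias_start_le {ℓ : ℕ} (hℓ : ℓ ≠ 0) :
    (∏ k ∈ Finset.range ℓ, Real.exp (-(lyapRate β (γ / 4 ^ k) l * K))) * a 0
      ≤ Real.exp (-(lyapRate β γ l * K)) * ((1 + lyapWeight β γ l) * w2) := by
  obtain ⟨ℓ, rfl⟩ := Nat.exists_eq_succ_of_ne_zero hℓ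
  rw [Finset.prod_range_succ', pow_zero, div_one]
  refine mul_le_mul ?_ h.init (h.a_nonneg 0) (Real.exp_pos _).le
  exact mul_le_of_le_one_left (Real.exp_pos _).le
    (Finset.prod_le_one (fun k _ => (Real.exp_pos _).le) fun k _ => h.exp_rate_le_one _)

/-- The error after the last phase. -/
lemma final_le (hL : 0 < L) :
    a (L * K) ≤ Real.exp (-(lyapRate β γ l * K)) * ((1 + lyapWeight β γ l) * w2)
      + Nb * (500006 / (l * K) * satSq (γ * l * K)) := by
  have hγ := h.γ_pos
  have hl := h.l_pos
  have hδ := h.δ_pos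
  have hK : (0 : ℝ) < K := by exact_mod_cast h.K_pos
  refine (h.start_le le_rfl).trans (add_le_add (h.bias_start_le hL.ne') ?_)
  refine mul_le_mul_of_nonneg_left ?_ h.Nb_nonneg
  have h1 := h.phaseNoise_le (ℓ := L - 1) (by omega)
  rw [Nat.sub_add_cancel hL] at h1
  refine h1.trans ?_
  have hx1 : γ / 4 ^ (L - 1) * l * K ≤ 1 := by
    have := h.last
    rw [div_mul_eq_mul_div, div_mul_eq_mul_div, div_le_one (by positivity)]; exact this
  have hγL : γ / 4 ^ (L - 1) ≤ γ := div_le_self hγ.le (one_le_pow₀ (by norm_num))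
  -- By `warm`, a coordinate with `γ l K ≤ 1` cannot be fast.
  have h2 : γ / 4 ^ (L - 1) * l ≤ 1 * β := by
    rw [one_mul]
    by_contra hcon
    push Not at hcon
    have := mul_lt_mul_of_pos_right hcon hK
    linarith [h.warm]
  have h3 := lyapNoise_le_of_le (l := l) (c := 1) h.β_pos (δ := δ / 4 ^ (L - 1))
    (by positivity) (by have := h.δ_le; gcongr) le_rfl h2
  have h4 := sq_le_two_mul_satSq (x := γ * l * K) (y := γ / 4 ^ (L - 1) * l * K) (by positivity) hx1
    (by gcongr)
  have h5 : l * lyapNoise β (δ / 4 ^ (L - 1)) (γ / 4 ^ (L - 1)) l * K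
      ≤ 2 / (l * K) * (γ / 4 ^ (L - 1) * l * K) ^ 2 := by
    calc _ ≤ l * ((1 + 1) * (γ / 4 ^ (L - 1)) ^ 2) * K := by gcongr
      _ = _ := by field_simp; ring
  have h6 : 2 / (l * K) * (γ / 4 ^ (L - 1) * l * K) ^ 2 ≤ 2 / (l * K) * (2 * satSq (γ * l * K)) := by
    gcongr
  have h7 : 500006 / (l * K) * satSq (γ * l * K) = 2 / (l * K) * (2 * satSq (γ * l * K))
    + 500002 / (l * K) * satSq (γ * l * K) := by ring
  linarith

end PhaseRec

end CovShift

/-! ### The noise returned by the query error over a phase -/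

namespace CovShift

/-- This explains the form of `feedback`: up to a constant it is the noise received over the
dissipation. With `m` the common maximum, `16 * feedback * lyapDec` expands to `l² (2 γ² + 2 γ δ
m)`, which dominates the noise term by term. -/
lemma sq_mul_lyapNoise_le {β δ γ l : ℝ} (hβ : 0 < β) (hδ : 0 < δ) (hδγ : δ ≤ γ) (hl : 0 < l) :
    l * (l * lyapNoise β δ γ l) ≤ 16 * feedback β δ γ l * lyapDec β δ γ l := by
  have hγ : 0 < γ := hδ.trans_le hδγ
  have hm : 1 ≤ max 1 (δ * l / β) := le_max_left _ _
  have hm' : δ * l / β ≤ max 1 (δ * l / β) := le_max_right _ _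
  have hκ : lyapNoise β δ γ l ≤ 2 * γ ^ 2 + γ * δ * max 1 (δ * l / β) := by
    have h1 : lyapWeight β γ l ≤ 1 + γ * l / β := max_le (by
      have : 0 ≤ γ * l / β := by positivity
      linarith) (by linarith)
    have h2 : lyapWeight β γ l * δ ^ 2 ≤ (1 + γ * l / β) * δ ^ 2 := by gcongr
    have h3 : γ * l / β * δ ^ 2 = γ * δ * (δ * l / β) := by ring
    have h4 : γ * δ * (δ * l / β) ≤ γ * δ * max 1 (δ * l / β) := by gcongr
    have h5 : δ ^ 2 ≤ γ ^ 2 := by gcongr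
    unfold lyapNoise; nlinarith
  unfold feedback lyapDec
  set m := max 1 (δ * l / β)
  have e : 16 * (γ * l / m + δ * l) * (γ * l / 8 * m) = l * (l * (2 * γ ^ 2 + 2 * (γ * δ * m))) := by
    field_simp; ring
  rw [e]
  have : 0 ≤ γ * δ * m := by positivity
  gcongr; linarith

/-- Dividing the steps by `4 ^ k` lowers the maximum in the denominator by at most this factor, and
the numerator loses all of it. -/
lemma feedback_div_le {β δ γ l : ℝ} (hβ : 0 < β) (hδ : 0 < δ) (hγ : 0 < γ) (hl : 0 < l) (k : ℕ) :
    feedback β (δ / 4 ^ k) (γ / 4 ^ k) l ≤ feedback β δ γ l := by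
  unfold feedback
  have h4 : (1 : ℝ) ≤ 4 ^ k := one_le_pow₀ (by norm_num)
  have h1 : max 1 (δ * l / β) ≤ 4 ^ k * max 1 (δ / 4 ^ k * l / β) := by
    refine max_le ?_ ?_
    · nlinarith [le_max_left 1 (δ / 4 ^ k * l / β)]
    · have e : δ * l / β = 4 ^ k * (δ / 4 ^ k * l / β) := by field_simp
      rw [e]; gcongr; exact le_max_right _ _
  have h2 : 0 < max 1 (δ * l / β) := lt_of_lt_of_le one_pos (le_max_left _ _)
  have h3 : 0 < max 1 (δ / 4 ^ k * l / β) := lt_of_lt_of_le one_pos (le_max_left _ _)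
  refine add_le_add ?_ ?_
  · rw [div_le_div_iff₀ h3 h2]
    calc γ / 4 ^ k * l * max 1 (δ * l / β)
        ≤ γ / 4 ^ k * l * (4 ^ k * max 1 (δ / 4 ^ k * l / β)) := by gcongr
      _ = _ := by field_simp
  · gcongr; exact div_le_self hδ.le h4

lemma lyapDec_pos {β δ γ l : ℝ} (hγ : 0 < γ) (hl : 0 < l) : 0 < lyapDec β δ γ l := by
  have : 0 < max 1 (δ * l / β) := lt_of_lt_of_le one_pos (le_max_left _ _)
  unfold lyapDec; positivity

lemma lyapDec_ge {β δ γ l : ℝ} (hγ : 0 < γ) (hl : 0 < l) : γ * l / 8 ≤ lyapDec β δ γ l :=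
  le_mul_of_one_le_right (by positivity) (le_max_left _ _)

/-- The noise present at the start of a phase has to be compared with the dissipation of that phase,
although it stems from the preceding one. Each of the two factors of `lyapDec` loses at most `4`. -/
lemma lyapDec_pred_le {β δ γ l : ℝ} (hγ : 0 < γ) (hl : 0 < l) (k : ℕ) :
    lyapDec β (δ / 4 ^ k) (γ / 4 ^ k) l
      ≤ 16 * lyapDec β (δ / 4 ^ (k + 1)) (γ / 4 ^ (k + 1)) l := by
  unfold lyapDec
  have e1 : γ / 4 ^ k = 4 * (γ / 4 ^ (k + 1)) := by rw [pow_succ]; field_simp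
  have e2 : δ / 4 ^ k = 4 * (δ / 4 ^ (k + 1)) := by rw [pow_succ]; field_simp
  rw [e1, e2]
  set g := γ / 4 ^ (k + 1) with hg
  set e := δ / 4 ^ (k + 1)
  have hg0 : 0 < g := by positivity
  have h1 : max 1 (4 * e * l / β) ≤ 4 * max 1 (e * l / β) := by
    refine max_le ?_ ?_
    · nlinarith [le_max_left 1 (e * l / β)]
    · have : 4 * e * l / β = 4 * (e * l / β) := by ring
      rw [this]; gcongr; exact le_max_right _ _
  calc 4 * g * l / 8 * max 1 (4 * e * l / β) ≤ 4 * g * l / 8 * (4 * max 1 (e * l / β)) := by gcongr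
    _ = _ := by ring

namespace PhaseRec

variable {β δ γ l Nb w2 : ℝ} {K L : ℕ} {a u N : ℕ → ℝ}
variable (h : PhaseRec β δ γ l Nb w2 K L a u N)
include h

lemma feedback_nonneg : 0 ≤ feedback β δ γ l := by
  have := h.γ_pos; have := h.l_pos; have := h.δ_pos
  unfold feedback; positivity

/-- If the maximum in `feedback` is one, its first term is `γ l`. Otherwise this term is at least
`β` because `δ ≤ γ`, and `β K ≥ 1` meets the saturation at one. -/
lemma satSq_le_feedback : satSq (γ * l * K) ≤ K * feedback β δ γ l := by
  have hγ := h.γ_pos; have hl := h.l_pos; have hδ := h.δ_pos; have hβ := h.β_pos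
  have hK : (0 : ℝ) < K := by exact_mod_cast h.K_pos
  rcases le_total (δ * l / β) 1 with hm | hm
  · refine (satSq_le_self (by positivity)).trans ?_
    rw [feedback, max_eq_left hm, div_one]
    nlinarith [mul_pos hK (mul_pos hδ hl)]
  · refine (satSq_le_one _).trans ?_
    rw [feedback, max_eq_right hm]
    have h1 : β ≤ γ * l / (δ * l / β) := by
      rw [le_div_iff₀ (by positivity)]
      have : β * (δ * l / β) = δ * l := by field_simp
      rw [this]; have := h.δ_le; gcongr
    have h2 : 0 < δ * l := by positivity
    nlinarith [h.warm, mul_le_mul_of_nonneg_left h1 hK.le, mul_pos hK h2]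

/-- The initial weight `γ l / β` of a fast coordinate may be huge, but by `small₂` the first phase
removes it. -/
lemma bias_start_le_two {ℓ : ℕ} (hℓ : ℓ ≠ 0) :
    (∏ k ∈ Finset.range ℓ, Real.exp (-(lyapRate β (γ / 4 ^ k) l * K))) * a 0 ≤ 2 * w2 := by
  have hγ := h.γ_pos; have hl := h.l_pos
  have hw := h.w2_nonneg
  refine (h.bias_start_le hℓ).trans ?_
  have h1 := h.exp_rate_le_one 0
  rw [pow_zero, div_one] at h1
  rcases le_total (γ * l) β with hc | hc
  · rw [lyapWeight_eq_one h.β_pos hc]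
    nlinarith
  · rw [lyapWeight_eq h.β_pos hc]
    have h2 := h.small₂
    have h3 : lyapRate β γ l * K = β * K / 2 := by
      rw [lyapRate, min_eq_left hc]; ring
    rw [h3] at h1 ⊢
    have : Real.exp (-(β * K / 2)) * ((1 + γ * l / β) * w2)
      = (Real.exp (-(β * K / 2)) + γ * l / β * Real.exp (-(β * K / 2))) * w2 := by ring
    rw [this]
    gcongr; linarith

lemma noise_term_le {ℓ : ℕ} (_hℓ : ℓ < L) :
    l * (l * lyapNoise β (δ / 4 ^ ℓ) (γ / 4 ^ ℓ) l * K)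
      ≤ K * (16 * feedback β δ γ l * lyapDec β (δ / 4 ^ ℓ) (γ / 4 ^ ℓ) l) := by
  have hγ := h.γ_pos; have hl := h.l_pos; have hδ := h.δ_pos; have hβ := h.β_pos
  have hK : (0 : ℝ) < K := by exact_mod_cast h.K_pos
  have h1 := sq_mul_lyapNoise_le (β := β) (δ := δ / 4 ^ ℓ) (γ := γ / 4 ^ ℓ) (l := l) hβ
    (by positivity) (by have := h.δ_le; gcongr) hl
  have h2 := feedback_div_le hβ hδ hγ hl ℓ
  have h3 := lyapDec_pos (β := β) (δ := δ / 4 ^ ℓ) (γ := γ / 4 ^ ℓ) (by positivity) hl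
  calc l * (l * lyapNoise β (δ / 4 ^ ℓ) (γ / 4 ^ ℓ) l * K)
      = K * (l * (l * lyapNoise β (δ / 4 ^ ℓ) (γ / 4 ^ ℓ) l)) := by ring
    _ ≤ K * (16 * feedback β (δ / 4 ^ ℓ) (γ / 4 ^ ℓ) l * lyapDec β (δ / 4 ^ ℓ) (γ / 4 ^ ℓ) l) := by
        gcongr
    _ ≤ _ := by gcongr

/-- A phase in which the coordinate moves: dissipation bounds the query error. -/
lemma sum_query_le_of_fast {ℓ : ℕ} (hℓ : ℓ < L) (hx : 1 ≤ γ / 4 ^ ℓ * l * K) :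
    l * ∑ i ∈ Finset.range K, u (ℓ * K + i)
      ≤ 10000000 * K * (l * w2 + Nb * feedback β δ γ l) := by
  have hγ := h.γ_pos; have hl := h.l_pos; have hδ := h.δ_pos; have hβ := h.β_pos
  have hK : (0 : ℝ) < K := by exact_mod_cast h.K_pos
  have hw := h.w2_nonneg; have hNb := h.Nb_nonneg; have hfb := h.feedback_nonneg
  set dec := lyapDec β (δ / 4 ^ ℓ) (γ / 4 ^ ℓ) l with hdec
  have hdec0 : 0 < dec := lyapDec_pos (by positivity) hl
  have hdecge : γ / 4 ^ ℓ * l / 8 ≤ dec := lyapDec_ge (by positivity) hl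
  -- Over the `K` steps of such a phase the total dissipation rate is bounded below, so a factor `8
  -- K dec` may be inserted into bounds for the starting error.
  have hdecK : 1 ≤ 8 * K * dec := by nlinarith
  have hmain : l * (lyapDec β (δ / 4 ^ ℓ) (γ / 4 ^ ℓ) l * ∑ i ∈ Finset.range K, u (ℓ * K + i))
      ≤ dec * (10000000 * K * (l * w2 + Nb * feedback β δ γ l)) := by
    have h1 := mul_le_mul_of_nonneg_left (h.phase_dissip hℓ) hl.le
    have h2 := mul_le_mul_of_nonneg_left (h.start_le hℓ.le) hl.le
    have h3 := mul_le_mul_of_nonneg_left (h.noise_term_le hℓ) hNb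
    rw [← hdec] at h3
    have hb : l * ((∏ k ∈ Finset.range ℓ, Real.exp (-(lyapRate β (γ / 4 ^ k) l * K))) * a 0)
        ≤ dec * (16 * K * (l * w2)) := by
      rcases Nat.eq_zero_or_pos ℓ with rfl | hpos
      · have h4 := mul_le_mul_of_nonneg_left h.init hl.le
        simp only [Finset.range_zero, Finset.prod_empty, one_mul]
        rw [pow_zero, div_one] at hdecge hx
        refine h4.trans ?_
        rcases le_total (γ * l) β with hc | hc
        · rw [lyapWeight_eq_one hβ hc]
          nlinarith [mul_nonneg hl.le hw, mul_le_mul_of_nonneg_right hdecK (mul_nonneg hl.le hw)]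
        · have h5 : 1 + lyapWeight β γ l ≤ 2 * (γ * l / β) := by
            rw [lyapWeight_eq hβ hc]
            have : 1 ≤ γ * l / β := by rwa [one_le_div hβ]
            linarith
          -- In the first phase the weight has not decayed yet, but it is affordable: `γ l ≤ 8 dec`
          -- and `1 / β ≤ K`.
          have h6 : γ * l / β ≤ 8 * K * dec := by
            rw [div_le_iff₀ hβ]
            nlinarith [h.warm, mul_le_mul_of_nonneg_left h.warm hdec0.le]
          nlinarith [mul_nonneg hl.le hw, mul_le_mul_of_nonneg_right (h5.trans
            (mul_le_mul_of_nonneg_left h6 (by norm_num))) (mul_nonneg hl.le hw)]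
      · have h4 := mul_le_mul_of_nonneg_left (h.bias_start_le_two hpos.ne') hl.le
        nlinarith [mul_nonneg hl.le hw, mul_le_mul_of_nonneg_right hdecK (mul_nonneg hl.le hw)]
    have hY : l * phaseNoise β δ γ l K ℓ ≤ dec * (4100000 * (K * feedback β δ γ l)) := by
      rcases Nat.eq_zero_or_pos ℓ with rfl | hpos
      · simp only [phaseNoise, mul_zero]; positivity
      · obtain ⟨k, rfl⟩ : ∃ k, ℓ = k + 1 := ⟨ℓ - 1, by omega⟩
        have h4 := mul_le_mul_of_nonneg_left (h.phaseNoise_le (ℓ := k) (by omega)) hl.le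
        have h5 := h.noise_term_le (ℓ := k) (by omega)
        have h6 := lyapDec_pred_le (β := β) (δ := δ) hγ hl k
        have h7 : K * (16 * feedback β δ γ l * lyapDec β (δ / 4 ^ k) (γ / 4 ^ k) l)
            ≤ K * (16 * feedback β δ γ l * (16 * dec)) := by gcongr
        have h8 : l * (500002 / (l * K) * satSq (γ * l * K))
            ≤ dec * (4000016 * (K * feedback β δ γ l)) := by
          have : l * (500002 / (l * K) * satSq (γ * l * K))
            = 500002 / K * satSq (γ * l * K) := by field_simp
          rw [this]
          have h9 : 500002 / K ≤ dec * 4000016 := by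
            rw [div_le_iff₀ hK]; nlinarith
          calc 500002 / K * satSq (γ * l * K) ≤ dec * 4000016 * (K * feedback β δ γ l) :=
                mul_le_mul h9 h.satSq_le_feedback (satSq_nonneg _) (by positivity)
            _ = _ := by ring
        have h10 : 0 ≤ dec * (K * feedback β δ γ l) := by positivity
        linarith
    have h4 := mul_le_mul_of_nonneg_left hY hNb
    have h5 : 0 ≤ dec * (K * (l * w2)) := by positivity
    have h6 : 0 ≤ Nb * (dec * (K * feedback β δ γ l)) := by positivity
    linarith
  have : l * (dec * ∑ i ∈ Finset.range K, u (ℓ * K + i))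
    = dec * (l * ∑ i ∈ Finset.range K, u (ℓ * K + i)) := by ring
  rw [← hdec, this] at hmain
  exact le_of_mul_le_mul_left hmain hdec0

/-- A phase in which the coordinate hardly moves. -/
lemma sum_query_le_of_slow {ℓ : ℕ} (hℓ : ℓ < L) (hx : γ / 4 ^ ℓ * l * K ≤ 1) :
    l * ∑ i ∈ Finset.range K, u (ℓ * K + i)
      ≤ 10000000 * K * (l * w2 + Nb * feedback β δ γ l) := by
  have hγ := h.γ_pos; have hl := h.l_pos; have hδ := h.δ_pos; have hβ := h.β_pos
  have hK : (0 : ℝ) < K := by exact_mod_cast h.K_pos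
  have hw := h.w2_nonneg; have hNb := h.Nb_nonneg; have hfb := h.feedback_nonneg
  have hsat := h.satSq_le_feedback
  have hlow : γ / 4 ^ ℓ * l ≤ 1 * β := by
    rw [one_mul]
    by_contra hcon
    push Not at hcon
    have := mul_lt_mul_of_pos_right hcon hK
    linarith [h.warm]
  -- Dissipation is useless here. Instead `u ≤ a`, and within the phase `a` grows by no more than
  -- the noise, which is small for such a step.
  have h1 : ∑ i ∈ Finset.range K, u (ℓ * K + i)
      ≤ K * (a (ℓ * K) + l * lyapNoise β (δ / 4 ^ ℓ) (γ / 4 ^ ℓ) l * (K * Nb)) := by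
    have : ∀ i ∈ Finset.range K, u (ℓ * K + i)
        ≤ a (ℓ * K) + l * lyapNoise β (δ / 4 ^ ℓ) (γ / 4 ^ ℓ) l * (K * Nb) := fun i hi => by
      have hi := Finset.mem_range.1 hi
      exact (h.u_le _ (index_lt hℓ hi)).trans (h.phase_le hℓ hi.le)
    refine (Finset.sum_le_sum this).trans (le_of_eq ?_)
    rw [Finset.sum_const, Finset.card_range, nsmul_eq_mul]
  have hγle : γ / 4 ^ ℓ ≤ γ := div_le_self hγ.le (one_le_pow₀ (by norm_num))
  have hxs := sq_le_two_mul_satSq (x := γ * l * K) (y := γ / 4 ^ ℓ * l * K) (by positivity) hx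
    (by gcongr)
  have hn : l * K * (l * lyapNoise β (δ / 4 ^ ℓ) (γ / 4 ^ ℓ) l * K) ≤ 4 * (K * feedback β δ γ l) := by
    have h3 := lyapNoise_le_of_le (l := l) (c := 1) hβ (δ := δ / 4 ^ ℓ)
      (by positivity) (by have := h.δ_le; gcongr) le_rfl hlow
    calc l * K * (l * lyapNoise β (δ / 4 ^ ℓ) (γ / 4 ^ ℓ) l * K)
        ≤ l * K * (l * ((1 + 1) * (γ / 4 ^ ℓ) ^ 2) * K) := by gcongr
      _ = 2 * (γ / 4 ^ ℓ * l * K) ^ 2 := by ring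
      _ ≤ _ := by linarith
  have hb : (∏ k ∈ Finset.range ℓ, Real.exp (-(lyapRate β (γ / 4 ^ k) l * K))) * a 0 ≤ 2 * w2 := by
    rcases Nat.eq_zero_or_pos ℓ with rfl | hpos
    · simp only [Finset.range_zero, Finset.prod_empty, one_mul]
      rw [pow_zero, div_one, one_mul] at hlow
      have := h.init
      rw [lyapWeight_eq_one hβ hlow] at this
      linarith
    · exact h.bias_start_le_two hpos.ne'
  have hY : l * K * phaseNoise β δ γ l K ℓ ≤ 600000 * (K * feedback β δ γ l) := by
    rcases Nat.eq_zero_or_pos ℓ with rfl | hpos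
    · simp only [phaseNoise, mul_zero]; positivity
    · obtain ⟨k, rfl⟩ : ∃ k, ℓ = k + 1 := ⟨ℓ - 1, by omega⟩
      have h4 := mul_le_mul_of_nonneg_left (h.phaseNoise_le (ℓ := k) (by omega))
        (mul_nonneg hl.le hK.le)
      have e1 : γ / 4 ^ k = 4 * (γ / 4 ^ (k + 1)) := by rw [pow_succ]; field_simp
      have h3 := lyapNoise_le_of_le (l := l) (c := 4) hβ (δ := δ / 4 ^ k) (γ := γ / 4 ^ k)
        (by positivity) (by have := h.δ_le; gcongr) (by norm_num)
        (by rw [e1]; nlinarith)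
      have h5 : l * K * (l * lyapNoise β (δ / 4 ^ k) (γ / 4 ^ k) l * K)
          ≤ 160 * (K * feedback β δ γ l) := by
        calc l * K * (l * lyapNoise β (δ / 4 ^ k) (γ / 4 ^ k) l * K)
            ≤ l * K * (l * ((1 + 4) * (γ / 4 ^ k) ^ 2) * K) := by gcongr
          _ = 80 * (γ / 4 ^ (k + 1) * l * K) ^ 2 := by rw [e1]; ring
          _ ≤ _ := by linarith
      have h6 : l * K * (500002 / (l * K) * satSq (γ * l * K)) = 500002 * satSq (γ * l * K) := by
        field_simp
      have h10 : 0 ≤ K * feedback β δ γ l := by positivity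
      linarith
  have h2 := h.start_le hℓ.le
  calc l * ∑ i ∈ Finset.range K, u (ℓ * K + i)
      ≤ l * (K * (a (ℓ * K) + l * lyapNoise β (δ / 4 ^ ℓ) (γ / 4 ^ ℓ) l * (K * Nb))) := by gcongr
    _ ≤ l * (K * ((2 * w2 + Nb * phaseNoise β δ γ l K ℓ)
        + l * lyapNoise β (δ / 4 ^ ℓ) (γ / 4 ^ ℓ) l * (K * Nb))) := by
        gcongr
        linarith
    _ = 2 * K * (l * w2) + Nb * (l * K * phaseNoise β δ γ l K ℓ)
        + Nb * (l * K * (l * lyapNoise β (δ / 4 ^ ℓ) (γ / 4 ^ ℓ) l * K)) := by ring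
    _ ≤ 2 * K * (l * w2) + Nb * (600000 * (K * feedback β δ γ l))
        + Nb * (4 * (K * feedback β δ γ l)) := by gcongr
    _ ≤ _ := by
        have h5 : 0 ≤ K * (l * w2) := by positivity
        have h6 : 0 ≤ Nb * (K * feedback β δ γ l) := by positivity
        linarith

/-- The query error of a coordinate, summed over a phase. -/
lemma sum_query_le {ℓ : ℕ} (hℓ : ℓ < L) :
    l * ∑ i ∈ Finset.range K, u (ℓ * K + i)
      ≤ 10000000 * K * (l * w2 + Nb * feedback β δ γ l) :=
  (le_total 1 (γ / 4 ^ ℓ * l * K)).elim (h.sum_query_le_of_fast hℓ) (h.sum_query_le_of_slow hℓ)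

end PhaseRec

end CovShift

/-! ### Closing the feedback, and the bound by bias and variance -/

namespace CovShift

/-- Conditions on the parameters `θ` under which the error of `n` steps is controlled. -/
structure StableParams {d : ℕ} (θ : Params) (n : ℕ) (ψ : ℝ) (lam : Fin d → ℝ) : Prop where
  lam_pos : ∀ j, 0 < lam j
  β_pos : 0 < θ.β
  β_le : θ.β ≤ 1
  α_eq : θ.α = 1 / (1 + θ.β)
  δ_pos : 0 < θ.δ
  δ_le : θ.δ ≤ θ.γ
  K_pos : 0 < phaseLength n
  L_pos : 0 < numPhases n
  curv : ∀ j, θ.β * θ.γ * lam j ≤ 1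
  warm : 1 ≤ θ.β * phaseLength n
  small₁ : ∀ j, numPhases n * phaseLength n ^ 2 * lam j ^ 2 * lyapNoise θ.β θ.δ θ.γ (lam j)
    * Real.exp (-(θ.β * phaseLength n / 2)) ≤ 1
  small₂ : ∀ j, θ.γ * lam j / θ.β * Real.exp (-(θ.β * phaseLength n / 2)) ≤ 1
  last : ∀ j, θ.γ * lam j * phaseLength n ≤ 4 ^ (numPhases n - 1)
  -- The constant of `PhaseRec.sum_query_le` times the factor `2 ψ` of the noise level: at most half
  -- of the noise may be returned.
  feedback_le : 2 * ψ * 10000000 * ∑ j, feedback θ.β θ.δ θ.γ (lam j) ≤ 1 / 2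

section

variable {n d : ℕ} {lam : Fin d → ℝ} {M T : Matrix (Fin d) (Fin d) ℝ} {ψ σ : ℝ}
  {P Q : Measure (Sample d)} {w : Vec d} {θ : Params}

lemma numPhases_mul_phaseLength_le (n : ℕ) : numPhases n * phaseLength n ≤ n :=
  Nat.mul_div_le n _

lemma IsProblem.phaseRec (hP : IsProblem (diagonal lam) M T ψ σ P Q w) (hψ : 1 ≤ ψ)
    (hθ : StableParams θ n ψ lam) (j : Fin d) {Nb : ℝ} (hNb : 0 ≤ Nb)
    (hsum : ∀ ℓ < numPhases n, ∑ i ∈ Finset.range (phaseLength n),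
      expNoise n lam ψ σ P w θ (ℓ * phaseLength n + i) ≤ phaseLength n * Nb) :
    PhaseRec θ.β θ.δ θ.γ (lam j) Nb (w j ^ 2) (phaseLength n) (numPhases n)
      (expLyap n lam P w θ j) (expQuery n P w θ j) (expNoise n lam ψ σ P w θ) where
  β_pos := hθ.β_pos
  β_le := hθ.β_le
  δ_pos := hθ.δ_pos
  δ_le := hθ.δ_le
  l_pos := hθ.lam_pos j
  K_pos := hθ.K_pos
  w2_nonneg := sq_nonneg _
  contract t ht := hP.expLyap_succ_le θ (ht.trans_le (numPhases_mul_phaseLength_le n)) j hθ.β_pos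
    hθ.β_le hθ.α_eq (hθ.δ_pos.trans_le hθ.δ_le) hθ.δ_pos (hθ.lam_pos j)
  dissip t ht := hP.expLyap_succ_add_le θ (ht.trans_le (numPhases_mul_phaseLength_le n)) j hθ.β_pos
    hθ.β_le hθ.α_eq (hθ.δ_pos.trans_le hθ.δ_le) hθ.δ_pos hθ.δ_le (hθ.lam_pos j) (hθ.curv j)
  a_nonneg t := integral_nonneg fun _ => lyap_nonneg (lyapWeight_nonneg _ _ _) _ _ _
  u_le t ht := hP.expQuery_le θ (ht.le.trans (numPhases_mul_phaseLength_le n)) j hθ.β_pos hθ.α_eq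
  N_nonneg t := by
    have : 0 ≤ ∑ k, lam k * expQuery n P w θ k t := Finset.sum_nonneg fun k _ =>
      mul_nonneg (hθ.lam_pos k).le (expQuery_nonneg θ t k)
    unfold expNoise; positivity
  N_sum := hsum
  Nb_nonneg := hNb
  init := (hP.expLyap_zero θ j).le
  warm := hθ.warm
  small₁ := hθ.small₁ j
  small₂ := hθ.small₂ j
  last := hθ.last j

/-- The average noise level in every phase is bounded by its level at the start. -/
lemma IsProblem.exists_noise_bound (hP : IsProblem (diagonal lam) M T ψ σ P Q w) (hψ : 1 ≤ ψ)
    (hθ : StableParams θ n ψ lam) :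
    ∃ Nb, 0 ≤ Nb ∧ Nb ≤ 40000000 * ψ * (∑ k, lam k * w k ^ 2) + 4 * σ ^ 2 ∧
      ∀ ℓ < numPhases n, ∑ i ∈ Finset.range (phaseLength n),
        expNoise n lam ψ σ P w θ (ℓ * phaseLength n + i) ≤ phaseLength n * Nb := by
  set K := phaseLength n with hKd
  have hK : (0 : ℝ) < K := by exact_mod_cast hθ.K_pos
  set F : ℕ → ℝ := fun ℓ => ∑ i ∈ Finset.range K, expNoise n lam ψ σ P w θ (ℓ * K + i) with hF
  -- The largest phase average bounds all the others, so it may serve as the input `Nb` of the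
  -- recursion, whose output is then evaluated at this very phase. An induction over the phases
  -- would compound the constants.
  obtain ⟨ℓ₀, hℓ₀, hmax⟩ := Finset.exists_max_image (Finset.range (numPhases n)) F
    ⟨0, Finset.mem_range.2 hθ.L_pos⟩
  have hℓ₀' := Finset.mem_range.1 hℓ₀
  have hN0 : ∀ t, 0 ≤ expNoise n lam ψ σ P w θ t := fun t => by
    have : 0 ≤ ∑ k, lam k * expQuery n P w θ k t := Finset.sum_nonneg fun k _ =>
      mul_nonneg (hθ.lam_pos k).le (expQuery_nonneg θ t k)
    unfold expNoise; positivity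
  have hNb : 0 ≤ F ℓ₀ / K := div_nonneg (Finset.sum_nonneg fun i _ => hN0 _) hK.le
  have hsum : ∀ ℓ < numPhases n, F ℓ ≤ K * (F ℓ₀ / K) := fun ℓ hℓ => by
    rw [mul_div_cancel₀ _ hK.ne']; exact hmax ℓ (Finset.mem_range.2 hℓ)
  refine ⟨F ℓ₀ / K, hNb, ?_, hsum⟩
  set Nb := F ℓ₀ / K with hNbd
  have hq : ∀ k, lam k * ∑ i ∈ Finset.range K, expQuery n P w θ k (ℓ₀ * K + i)
      ≤ 10000000 * K * (lam k * w k ^ 2 + Nb * feedback θ.β θ.δ θ.γ (lam k)) := fun k =>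
    (hP.phaseRec hψ hθ k hNb hsum).sum_query_le hℓ₀'
  have hF0 : F ℓ₀ = 2 * ψ * (∑ k, lam k * ∑ i ∈ Finset.range K, expQuery n P w θ k (ℓ₀ * K + i))
      + K * (2 * σ ^ 2) := by
    simp only [hF, expNoise, Finset.sum_add_distrib, Finset.sum_const, Finset.card_range,
      nsmul_eq_mul, ← Finset.mul_sum]
    rw [Finset.sum_comm]
    simp only [← Finset.mul_sum]
  have h1 : F ℓ₀ ≤ 2 * ψ * (∑ k, 10000000 * K * (lam k * w k ^ 2
      + Nb * feedback θ.β θ.δ θ.γ (lam k))) + K * (2 * σ ^ 2) := by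
    rw [hF0]
    have := mul_le_mul_of_nonneg_left (Finset.sum_le_sum fun k (_ : k ∈ Finset.univ) => hq k)
      (by positivity : 0 ≤ 2 * ψ)
    linarith
  rw [← Finset.mul_sum, Finset.sum_add_distrib, ← Finset.mul_sum] at h1
  have h2 : F ℓ₀ = K * Nb := by rw [hNbd, mul_div_cancel₀ _ hK.ne']
  -- The returned noise is at most `Nb / 2` and is absorbed by the left-hand side.
  have h3 := mul_le_mul_of_nonneg_left hθ.feedback_le hNb
  have h4 : K * Nb ≤ K * (20000000 * ψ * (∑ k, lam k * w k ^ 2) + 2 * σ ^ 2 + Nb * (1 / 2)) := by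
    rw [← h2]
    refine h1.trans ?_
    have := mul_le_mul_of_nonneg_left h3 hK.le
    linarith
  have h5 := le_of_mul_le_mul_left h4 hK
  linarith

/-- The mean squared error of every coordinate of the output. -/
lemma IsProblem.integral_sq_asgd_le (hP : IsProblem (diagonal lam) M T ψ σ P Q w) (hψ : 1 ≤ ψ)
    (hθ : StableParams θ n ψ lam) (j : Fin d) :
    ∫ z : Data n d, (asgd θ z j - w j) ^ 2 ∂(Measure.pi fun _ : Fin n => P)
      ≤ Real.exp (-(lyapRate θ.β θ.γ (lam j) * phaseLength n))
          * ((1 + lyapWeight θ.β θ.γ (lam j)) * w j ^ 2)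
        + (40000000 * ψ * (∑ k, lam k * w k ^ 2) + 4 * σ ^ 2)
          * (500006 / (lam j * phaseLength n) * satSq (θ.γ * lam j * phaseLength n)) := by
  obtain ⟨Nb, hNb, hNb', hsum⟩ := hP.exists_noise_bound hψ hθ
  have h1 := hP.integral_sq_iterate_le (n := n) θ (numPhases_mul_phaseLength_le n) j
  refine h1.trans (((hP.phaseRec hψ hθ j hNb hsum).final_le hθ.L_pos).trans
    (add_le_add le_rfl (mul_le_mul_of_nonneg_right hNb' ?_)))
  have := satSq_nonneg (θ.γ * lam j * phaseLength n)
  have := hθ.lam_pos j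
  positivity

/-- Evaluating at `S^{1/2} v` undoes the whitening, so that the smoothness conditions compare the
target matrix with multiples of `S^{1+r}`. -/
lemma quadForm_similarity (hlam : ∀ j, 0 < lam j) (Qx : Measure (Vec d)) (v : Vec d) :
    quadForm (similarity lam Qx) (fun i => lam i ^ (1 / 2 : ℝ) * v i)
      = quadForm (secondMoment Qx) v := by
  have e1 : diagPow lam (-(1 / 2)) *ᵥ (fun i => lam i ^ (1 / 2 : ℝ) * v i) = v := by
    funext i
    rw [diagPow, mulVec_diagonal, ← mul_assoc, ← Real.rpow_add (hlam i)]
    simp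
  have e2 : (fun i => lam i ^ (1 / 2 : ℝ) * v i) ᵥ* diagPow lam (-(1 / 2)) = v := by
    funext i
    rw [diagPow, vecMul_diagonal, mul_comm, ← mul_assoc, ← Real.rpow_add (hlam i)]
    simp
  rw [quadForm, similarity, ← mulVec_mulVec, e1, ← mulVec_mulVec, dotProduct_mulVec, e2, quadForm]

lemma quadForm_smul_diagPow (hlam : ∀ j, 0 < lam j) (C r : ℝ) (v : Vec d) :
    quadForm (C • diagPow lam r) (fun i => lam i ^ (1 / 2 : ℝ) * v i)
      = C * ∑ i, lam i ^ (1 + r) * v i ^ 2 := by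
  rw [diagPow, quadForm, smul_mulVec, dotProduct_smul, smul_eq_mul]
  congr 1
  rw [← quadForm, quadForm_diagonal]
  refine Finset.sum_congr rfl fun i _ => ?_
  have e : (lam i ^ (1 / 2 : ℝ)) ^ 2 = lam i := by
    rw [← Real.rpow_natCast, ← Real.rpow_mul (hlam i).le]; norm_num
  rw [mul_pow, e, ← mul_assoc, Real.rpow_add (hlam i), Real.rpow_one, mul_comm (lam i)]

lemma quadForm_secondMoment_le {r C : ℝ} (hlam : ∀ j, 0 < lam j) {Qx : Measure (Vec d)}
    (h : Loewner (similarity lam Qx) (C • diagPow lam r)) (v : Vec d) :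
    quadForm (secondMoment Qx) v ≤ C * ∑ i, lam i ^ (1 + r) * v i ^ 2 := by
  have h1 := h.quadForm_le (fun i => lam i ^ (1 / 2 : ℝ) * v i)
  rwa [quadForm_similarity hlam, quadForm_smul_diagPow hlam] at h1

lemma le_quadForm_secondMoment {r c : ℝ} (hlam : ∀ j, 0 < lam j) {Qx : Measure (Vec d)}
    (h : Loewner (c • diagPow lam r) (similarity lam Qx)) (v : Vec d) :
    c * ∑ i, lam i ^ (1 + r) * v i ^ 2 ≤ quadForm (secondMoment Qx) v := by
  have h1 := h.quadForm_le (fun i => lam i ^ (1 / 2 : ℝ) * v i)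
  rwa [quadForm_similarity hlam, quadForm_smul_diagPow hlam] at h1

/-- Bound of the worst-case risk by a bias and a variance term. -/
lemma asgdRisk_le {m : Fin d → ℝ} {r C Rb W : ℝ} {𝒬 : Set (Measure (Vec d))} (hψ : 1 ≤ ψ)
    (hC : 0 ≤ C) (hθ : StableParams θ n ψ lam)
    (h𝒬 : ∀ Qx ∈ 𝒬, Loewner (similarity lam Qx) (C • diagPow lam r))
    (hRb0 : 0 ≤ Rb) (hW0 : 0 ≤ W)
    (hRb : ∀ j, lam j ^ (1 + r) * (Real.exp (-(lyapRate θ.β θ.γ (lam j) * phaseLength n))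
      * (1 + lyapWeight θ.β θ.γ (lam j))) ≤ Rb * m j)
    (hW : ∀ j, lam j ≤ W * m j) :
    asgdRisk n (diagonal lam) (diagonal m) ψ σ 𝒬 θ
      ≤ ENNReal.ofReal (C * (Rb + (40000000 * ψ * W + 4 * σ ^ 2)
        * ∑ j, lam j ^ (1 + r) * (500006 / (lam j * phaseLength n)
          * satSq (θ.γ * lam j * phaseLength n)))) := by
  have hlam := hθ.lam_pos
  unfold asgdRisk worstRisk
  refine iSup₂_le fun Qx hQx => iSup₂_le fun P Q => iSup₂_le fun w hP => ?_
  have hprob := hP.prob_source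
  have hm : ∑ j, m j * w j ^ 2 ≤ 1 := by
    have := hP.mem_ellipsoid; rwa [quadForm_diagonal] at this
  have hWs : ∑ k, lam k * w k ^ 2 ≤ W := by
    calc ∑ k, lam k * w k ^ 2 ≤ ∑ k, W * (m k * w k ^ 2) := by
          refine Finset.sum_le_sum fun k _ => ?_
          rw [← mul_assoc]
          exact mul_le_mul_of_nonneg_right (hW k) (sq_nonneg _)
      _ ≤ W * 1 := by rw [← Finset.mul_sum]; gcongr
      _ = W := mul_one W
  have hint : ∀ j, Integrable (fun z : Data n d => (asgd θ z j - w j) ^ 2)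
      (Measure.pi fun _ : Fin n => P) := fun j =>
    (hP.memLp_iterate θ (numPhases_mul_phaseLength_le n) j).1.integrable_sq
  have h1 : ∀ z : Data n d, ∫⁻ v, ENNReal.ofReal (quadForm (secondMoment Qx) (v - w))
      ∂(Measure.dirac (asgd θ z))
      ≤ ENNReal.ofReal (C * ∑ j, lam j ^ (1 + r) * (asgd θ z j - w j) ^ 2) := fun z => by
    rw [lintegral_dirac]
    exact ENNReal.ofReal_le_ofReal (quadForm_secondMoment_le hlam (h𝒬 Qx hQx) _)
  refine (lintegral_mono h1).trans ?_
  rw [← ofReal_integral_eq_lintegral_ofReal]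
  rotate_left
  · exact (integrable_finsetSum _ fun j _ => (hint j).const_mul _).const_mul _
  · refine ae_of_all _ fun z => mul_nonneg hC (Finset.sum_nonneg fun j _ => ?_)
    exact mul_nonneg (Real.rpow_nonneg (hlam j).le _) (sq_nonneg _)
  refine ENNReal.ofReal_le_ofReal ?_
  rw [integral_const_mul, integral_finsetSum _ fun j _ => (hint j).const_mul _]
  refine mul_le_mul_of_nonneg_left ?_ hC
  simp only [integral_const_mul]
  set V : Fin d → ℝ := fun j => 500006 / (lam j * phaseLength n)
    * satSq (θ.γ * lam j * phaseLength n) with hV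
  have hV0 : ∀ j, 0 ≤ V j := fun j => by
    have := satSq_nonneg (θ.γ * lam j * phaseLength n)
    have := hlam j
    simp only [hV]; positivity
  calc ∑ j, lam j ^ (1 + r) * ∫ z : Data n d, (asgd θ z j - w j) ^ 2 ∂(Measure.pi fun _ => P)
      ≤ ∑ j, lam j ^ (1 + r) * (Real.exp (-(lyapRate θ.β θ.γ (lam j) * phaseLength n))
          * ((1 + lyapWeight θ.β θ.γ (lam j)) * w j ^ 2)
        + (40000000 * ψ * (∑ k, lam k * w k ^ 2) + 4 * σ ^ 2) * V j) := by
        refine Finset.sum_le_sum fun j _ => ?_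
        exact mul_le_mul_of_nonneg_left (hP.integral_sq_asgd_le hψ hθ j)
          (Real.rpow_nonneg (hlam j).le _)
    _ ≤ ∑ j, (Rb * (m j * w j ^ 2)
        + (40000000 * ψ * W + 4 * σ ^ 2) * (lam j ^ (1 + r) * V j)) := by
        refine Finset.sum_le_sum fun j _ => ?_
        have a1 := mul_le_mul_of_nonneg_right (hRb j) (sq_nonneg (w j))
        have a2 : 0 ≤ lam j ^ (1 + r) * V j := mul_nonneg (Real.rpow_nonneg (hlam j).le _) (hV0 j)
        have a3 : 40000000 * ψ * (∑ k, lam k * w k ^ 2) + 4 * σ ^ 2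
          ≤ 40000000 * ψ * W + 4 * σ ^ 2 := by gcongr
        have a4 := mul_le_mul_of_nonneg_right a3 a2
        linarith
    _ = Rb * (∑ j, m j * w j ^ 2)
        + (40000000 * ψ * W + 4 * σ ^ 2) * ∑ j, lam j ^ (1 + r) * V j := by
        rw [Finset.sum_add_distrib, ← Finset.mul_sum, ← Finset.mul_sum]
    _ ≤ _ := by
        have := mul_le_mul_of_nonneg_left hm hRb0
        linarith

end

end CovShift

namespace CovShift

/-! ### Sums of powers -/

/-- `log x ≤ x - 1` and `1 + y ≤ exp y`, applied to the power of `i / (i + 1)`. -/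
lemma rpow_neg_telescope {η : ℝ} (hη : 0 < η) {i : ℝ} (hi : 0 < i) :
    η * (i + 1) ^ (-1 - η) ≤ i ^ (-η) - (i + 1) ^ (-η) := by
  have h1 : (0 : ℝ) < i + 1 := by linarith
  have e1 : i = (i + 1) * (i / (i + 1)) := by field_simp
  have hx : 0 < i / (i + 1) := by positivity
  have e2 : i ^ (-η) = (i + 1) ^ (-η) * (i / (i + 1)) ^ (-η) := by
    conv_lhs => rw [e1]
    rw [Real.mul_rpow h1.le hx.le]
  have h2 : 1 + η / (i + 1) ≤ (i / (i + 1)) ^ (-η) := by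
    rw [Real.rpow_def_of_pos hx]
    have hlog : Real.log (i / (i + 1)) ≤ -(1 / (i + 1)) := by
      have := Real.log_le_sub_one_of_pos hx
      have e3 : i / (i + 1) - 1 = -(1 / (i + 1)) := by field_simp; ring
      linarith
    have h3 : η / (i + 1) ≤ Real.log (i / (i + 1)) * -η := by
      have := mul_le_mul_of_nonneg_right hlog hη.le
      have e4 : η / (i + 1) = 1 / (i + 1) * η := by ring
      linarith
    have := Real.add_one_le_exp (Real.log (i / (i + 1)) * -η)
    linarith
  have e5 : (i + 1) ^ (-1 - η) = (i + 1) ^ (-η) / (i + 1) := by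
    rw [show -1 - η = -η - 1 by ring, Real.rpow_sub_one h1.ne']
  rw [e2, e5]
  have h4 : 0 < (i + 1) ^ (-η) := Real.rpow_pos_of_pos h1 _
  have h5 := mul_le_mul_of_nonneg_left h2 h4.le
  have e6 : η * ((i + 1) ^ (-η) / (i + 1)) = (i + 1) ^ (-η) * (η / (i + 1)) := by ring
  rw [e6]; linarith

lemma sum_rpow_tail_le {η : ℝ} (hη : 0 < η) {N : ℕ} (hN : 0 < N) (d : ℕ) :
    ∑ i ∈ Finset.range d, (((N + i : ℕ) : ℝ) + 1) ^ (-1 - η) ≤ (N : ℝ) ^ (-η) / η := by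
  have key : η * ∑ i ∈ Finset.range d, (((N + i : ℕ) : ℝ) + 1) ^ (-1 - η)
      ≤ (N : ℝ) ^ (-η) - ((N + d : ℕ) : ℝ) ^ (-η) := by
    induction d with
    | zero => simp
    | succ d ih =>
      rw [Finset.sum_range_succ, mul_add]
      have h1 := rpow_neg_telescope hη (i := ((N + d : ℕ) : ℝ)) (by positivity)
      have e : ((N + (d + 1) : ℕ) : ℝ) = ((N + d : ℕ) : ℝ) + 1 := by push_cast; ring
      rw [e]; linarith
  rw [le_div_iff₀ hη, mul_comm]
  have : 0 ≤ ((N + d : ℕ) : ℝ) ^ (-η) := by positivity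
  linarith

lemma sum_rpow_le_of_one_lt {b : ℝ} (hb : 1 < b) (d : ℕ) :
    ∑ i ∈ Finset.range d, ((i : ℝ) + 1) ^ (-b) ≤ 1 + 1 / (b - 1) := by
  rcases Nat.eq_zero_or_pos d with rfl | hd
  · have : 0 < b - 1 := by linarith
    simp; positivity
  · obtain ⟨d, rfl⟩ : ∃ k, d = k + 1 := ⟨d - 1, by omega⟩
    rw [Finset.sum_range_succ', add_comm]
    have h := sum_rpow_tail_le (η := b - 1) (by linarith) one_pos d
    rw [show -1 - (b - 1) = -b by ring] at h
    refine add_le_add (by simp) ?_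
    refine le_trans (le_of_eq ?_) (h.trans (by simp))
    refine Finset.sum_congr rfl fun i _ => ?_
    push_cast; ring_nf

lemma rpow_telescope {p : ℝ} (hp : 0 < p) (hp1 : p ≤ 1) {i : ℝ} (hi : 0 ≤ i) :
    p * (i + 1) ^ (p - 1) ≤ (i + 1) ^ p - i ^ p := by
  have h1 : (0 : ℝ) < i + 1 := by linarith
  have hx : 0 ≤ i / (i + 1) := by positivity
  have e1 : i = (i + 1) * (i / (i + 1)) := by field_simp
  have e2 : i ^ p = (i + 1) ^ p * (i / (i + 1)) ^ p := by
    conv_lhs => rw [e1]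
    rw [Real.mul_rpow h1.le hx]
  have e3 : i / (i + 1) = 1 + -(1 / (i + 1)) := by field_simp; ring
  have h2 : (i / (i + 1)) ^ p ≤ 1 + p * -(1 / (i + 1)) := by
    rw [e3]
    refine rpow_one_add_le_one_add_mul_self ?_ hp.le hp1
    have : 0 ≤ i / (i + 1) := hx
    rw [e3] at this; linarith
  rw [e2, Real.rpow_sub_one h1.ne']
  have h4 : 0 < (i + 1) ^ p := Real.rpow_pos_of_pos h1 _
  have h5 := mul_le_mul_of_nonneg_left h2 h4.le
  have e6 : p * ((i + 1) ^ p / (i + 1)) = (i + 1) ^ p * (p * (1 / (i + 1))) := by ring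
  rw [e6]; linarith

/-- For `p > 1` Bernoulli's inequality has the wrong direction. The sum is telescoped with the
exponent `min p 1`, and the missing power is bounded by its value at `N`. -/
lemma sum_rpow_head_le {p : ℝ} (hp : 0 < p) (N : ℕ) :
    ∑ i ∈ Finset.range N, ((i : ℝ) + 1) ^ (p - 1) ≤ (N : ℝ) ^ p / min p 1 := by
  have hp' : 0 < min p 1 := lt_min hp one_pos
  have key : ∀ n : ℕ, min p 1 * ∑ i ∈ Finset.range n, ((i : ℝ) + 1) ^ (min p 1 - 1)
      ≤ (n : ℝ) ^ (min p 1) := by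
    intro n
    induction n with
    | zero => simp [Real.zero_rpow hp'.ne']
    | succ n ih =>
      rw [Finset.sum_range_succ, mul_add]
      have h1 := rpow_telescope hp' (min_le_right p 1) (i := (n : ℝ)) (by positivity)
      push_cast; linarith
  rw [le_div_iff₀ hp', mul_comm]
  rcases Nat.eq_zero_or_pos N with rfl | hN
  · simp [Real.zero_rpow hp.ne']
  have hN' : (0 : ℝ) < N := by exact_mod_cast hN
  calc min p 1 * ∑ i ∈ Finset.range N, ((i : ℝ) + 1) ^ (p - 1)
      ≤ min p 1 * ∑ i ∈ Finset.range N, (N : ℝ) ^ (p - min p 1) * ((i : ℝ) + 1) ^ (min p 1 - 1) := by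
        gcongr with i hi
        have hi' : (i : ℝ) + 1 ≤ N := by exact_mod_cast Finset.mem_range.1 hi
        rw [show p - 1 = (p - min p 1) + (min p 1 - 1) by ring, Real.rpow_add (by positivity)]
        gcongr
        linarith [min_le_left p 1]
    _ = (N : ℝ) ^ (p - min p 1) * (min p 1 * ∑ i ∈ Finset.range N, ((i : ℝ) + 1) ^ (min p 1 - 1)) := by
        rw [← Finset.mul_sum]; ring
    _ ≤ (N : ℝ) ^ (p - min p 1) * (N : ℝ) ^ (min p 1) := by gcongr; exact key N
    _ = (N : ℝ) ^ p := by rw [← Real.rpow_add hN']; ring_nf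

lemma sum_inv_le (N : ℕ) : ∑ i ∈ Finset.range N, ((i : ℝ) + 1)⁻¹ ≤ 1 + Real.log N := by
  have := harmonic_le_one_add_log N
  rw [harmonic] at this
  push_cast at this
  exact this

/-- The effective dimension: a sum of truncated powers, split at `N`. -/
lemma sum_truncated_le {a r : ℝ} (ha : 0 < a) (hr : 1 / a - 2 < r) {Γ : ℝ} (hΓ : 1 ≤ Γ) (d : ℕ) :
    ∑ i ∈ Finset.range d, ((i : ℝ) + 1) ^ (-(a * r)) * satSq (Γ * ((i : ℝ) + 1) ^ (-a))
      ≤ ∑ i ∈ Finset.range ⌊Γ ^ (1 / a)⌋₊, ((i : ℝ) + 1) ^ (-(a * r))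
        + 2 ^ (a * (2 + r) - 1) / (a * (2 + r) - 1) * Γ ^ (1 / a - r) := by
  -- The cut is where `Γ i^{-a}` crosses one. Before it the saturation is bounded by one, after it
  -- by a square, whose sum converges because `r > 1/a - 2`.
  set k := Γ ^ (1 / a) with hk
  have hk1 : 1 ≤ k := Real.one_le_rpow hΓ (by positivity)
  set N := ⌊k⌋₊ with hN
  have hN1 : 1 ≤ N := Nat.le_floor (by simpa using hk1)
  have hN0 : (0 : ℝ) < N := by exact_mod_cast hN1
  set η := a * (2 + r) - 1 with hη
  have hη0 : 0 < η := by
    have h2 : a * (1 / a - 2) < a * r := mul_lt_mul_of_pos_left hr ha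
    have h3 : a * (1 / a - 2) = 1 - 2 * a := by field_simp
    rw [hη]; linarith
  have hterm : ∀ i : ℕ, 0 ≤ ((i : ℝ) + 1) ^ (-(a * r)) * satSq (Γ * ((i : ℝ) + 1) ^ (-a)) := fun i =>
    mul_nonneg (by positivity) (satSq_nonneg _)
  calc ∑ i ∈ Finset.range d, ((i : ℝ) + 1) ^ (-(a * r)) * satSq (Γ * ((i : ℝ) + 1) ^ (-a))
      ≤ ∑ i ∈ Finset.range (N + d), ((i : ℝ) + 1) ^ (-(a * r)) * satSq (Γ * ((i : ℝ) + 1) ^ (-a)) :=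
        Finset.sum_le_sum_of_subset_of_nonneg (Finset.range_mono (by omega)) fun i _ _ => hterm i
    _ = ∑ i ∈ Finset.range N, ((i : ℝ) + 1) ^ (-(a * r)) * satSq (Γ * ((i : ℝ) + 1) ^ (-a))
        + ∑ i ∈ Finset.range d, (((N + i : ℕ) : ℝ) + 1) ^ (-(a * r))
          * satSq (Γ * (((N + i : ℕ) : ℝ) + 1) ^ (-a)) := Finset.sum_range_add _ _ _
    _ ≤ ∑ i ∈ Finset.range N, ((i : ℝ) + 1) ^ (-(a * r))
        + ∑ i ∈ Finset.range d, Γ ^ 2 * (((N + i : ℕ) : ℝ) + 1) ^ (-1 - η) := by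
        refine add_le_add (Finset.sum_le_sum fun i _ => ?_) (Finset.sum_le_sum fun i _ => ?_)
        · exact mul_le_of_le_one_right (by positivity) (satSq_le_one _)
        · have h0 : (0 : ℝ) < ((N + i : ℕ) : ℝ) + 1 := by positivity
          have e : (((N + i : ℕ) : ℝ) + 1) ^ (-1 - η)
              = (((N + i : ℕ) : ℝ) + 1) ^ (-(a * r)) * ((((N + i : ℕ) : ℝ) + 1) ^ (-a)) ^ 2 := by
            rw [← Real.rpow_natCast, ← Real.rpow_mul h0.le, ← Real.rpow_add h0]
            congr 1; rw [hη]; push_cast; ring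
          rw [e]
          have := mul_le_mul_of_nonneg_left (satSq_le_sq (Γ * (((N + i : ℕ) : ℝ) + 1) ^ (-a)))
            (by positivity : 0 ≤ (((N + i : ℕ) : ℝ) + 1) ^ (-(a * r)))
          rw [mul_pow] at this
          linarith
    _ ≤ ∑ i ∈ Finset.range N, ((i : ℝ) + 1) ^ (-(a * r)) + Γ ^ 2 * ((N : ℝ) ^ (-η) / η) := by
        rw [← Finset.mul_sum]
        gcongr
        exact sum_rpow_tail_le hη0 hN1 d
    _ ≤ _ := by
        refine add_le_add le_rfl ?_
        have h1 : k / 2 ≤ N := by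
          have h1 := Nat.lt_floor_add_one k
          have h2 : (1 : ℝ) ≤ N := by exact_mod_cast hN1
          rw [← hN] at h1; linarith
        have h2 : (N : ℝ) ^ (-η) ≤ (k / 2) ^ (-η) :=
          Real.rpow_le_rpow_of_nonpos (by positivity) h1 (by linarith)
        have h3 : (k / 2) ^ (-η) = 2 ^ η * k ^ (-η) := by
          have hk0 : 0 ≤ k := by linarith
          rw [Real.div_rpow hk0 (by norm_num), Real.rpow_neg (x := 2) (by norm_num) η,
            div_inv_eq_mul, mul_comm]
        have hΓ0 : 0 < Γ := by linarith
        have h4 : Γ ^ 2 * k ^ (-η) = Γ ^ (1 / a - r) := by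
          rw [hk, ← Real.rpow_mul hΓ0.le, ← Real.rpow_natCast, ← Real.rpow_add hΓ0]
          congr 1; rw [hη]; push_cast; field_simp; ring
        calc Γ ^ 2 * ((N : ℝ) ^ (-η) / η) ≤ Γ ^ 2 * ((2 ^ η * k ^ (-η)) / η) := by
              rw [← h3]; gcongr
          _ = 2 ^ η / η * (Γ ^ 2 * k ^ (-η)) := by ring
          _ = _ := by rw [h4]

/-! ### Power-law spectra -/

namespace PowerLaw

variable {d : ℕ} {a s B : ℝ} {lam m : Fin d → ℝ}

lemma lam_pos (h : PowerLaw a s B lam m) (hB : 1 ≤ B) (i : Fin d) : 0 < lam i :=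
  lt_of_lt_of_le (by positivity) (h.lam_lower i)

lemma m_pos (h : PowerLaw a s B lam m) (hB : 1 ≤ B) (i : Fin d) : 0 < m i := by
  have := Real.rpow_pos_of_pos (h.lam_pos hB i) (1 - s)
  exact lt_of_lt_of_le (by positivity) (h.m_lower i)

lemma lam_le (h : PowerLaw a s B lam m) (hB : 1 ≤ B) (ha : 0 ≤ a) (i : Fin d) : lam i ≤ B := by
  refine (h.lam_upper i).trans (mul_le_of_le_one_right (by linarith) ?_)
  exact Real.rpow_le_one_of_one_le_of_nonpos (by
    have : (0 : ℝ) ≤ ((i : ℕ) : ℝ) := by positivity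
    linarith) (by linarith)

/-- The exponent `|p|` appears because for negative `p` the lower bound of the eigenvalue, with the
constant `B⁻¹`, is the relevant one. -/
lemma rpow_lam_le (h : PowerLaw a s B lam m) (hB : 1 ≤ B) (p : ℝ) (i : Fin d) :
    lam i ^ p ≤ B ^ |p| * (((i : ℕ) : ℝ) + 1) ^ (-(a * p)) := by
  have h0 : (0 : ℝ) < ((i : ℕ) : ℝ) + 1 := by positivity
  have hx : 0 < (((i : ℕ) : ℝ) + 1) ^ (-a) := by positivity
  have hB0 : 0 < B := by linarith
  have e : (((i : ℕ) : ℝ) + 1) ^ (-(a * p)) = ((((i : ℕ) : ℝ) + 1) ^ (-a)) ^ p := by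
    rw [← Real.rpow_mul h0.le]; ring_nf
  rw [e]
  rcases le_total 0 p with hp | hp
  · rw [abs_of_nonneg hp, ← Real.mul_rpow hB0.le hx.le]
    exact Real.rpow_le_rpow (h.lam_pos hB i).le (h.lam_upper i) hp
  · rw [abs_of_nonpos hp]
    refine (Real.rpow_le_rpow_of_nonpos (by positivity) (h.lam_lower i) hp).trans (le_of_eq ?_)
    rw [Real.mul_rpow (by positivity) hx.le, Real.inv_rpow hB0.le, ← Real.rpow_neg hB0.le]

lemma sum_rpow_lam_le (h : PowerLaw a s B lam m) (hB : 1 ≤ B) {p : ℝ} (hp : 1 < a * p) :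
    ∑ i, lam i ^ p ≤ B ^ |p| * (1 + 1 / (a * p - 1)) := by
  calc ∑ i, lam i ^ p ≤ ∑ i : Fin d, B ^ |p| * (((i : ℕ) : ℝ) + 1) ^ (-(a * p)) :=
        Finset.sum_le_sum fun i _ => h.rpow_lam_le hB p i
    _ = B ^ |p| * ∑ i ∈ Finset.range d, ((i : ℝ) + 1) ^ (-(a * p)) := by
        rw [← Finset.mul_sum, Fin.sum_univ_eq_sum_range fun i : ℕ => ((i : ℝ) + 1) ^ (-(a * p))]
    _ ≤ _ := by
        gcongr
        exact sum_rpow_le_of_one_lt hp d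

lemma _root_.CovShift.satSq_mono {x y : ℝ} (hx : 0 ≤ x) (h : x ≤ y) : satSq x ≤ satSq y := by
  have h2 : x ^ 2 ≤ y ^ 2 := pow_le_pow_left₀ hx h 2
  unfold satSq
  rw [div_le_div_iff₀ (by positivity) (by positivity)]
  linarith

lemma _root_.CovShift.satSq_mul_le {c : ℝ} (hc : 1 ≤ c) (x : ℝ) :
    satSq (c * x) ≤ c ^ 2 * satSq x := by
  have h2 : 1 ≤ c ^ 2 := one_le_pow₀ hc
  unfold satSq
  rw [← mul_div_assoc, mul_pow]
  gcongr
  exact le_mul_of_one_le_left (sq_nonneg x) h2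

lemma sum_variance_le (h : PowerLaw a s B lam m) (hB : 1 ≤ B) (r : ℝ) {Γ : ℝ} (hΓ : 0 ≤ Γ) :
    ∑ j, lam j ^ r * satSq (Γ * lam j) ≤ B ^ |r| * B ^ 2
      * ∑ i ∈ Finset.range d, ((i : ℝ) + 1) ^ (-(a * r)) * satSq (Γ * ((i : ℝ) + 1) ^ (-a)) := by
  rw [← Fin.sum_univ_eq_sum_range
    fun i : ℕ => ((i : ℝ) + 1) ^ (-(a * r)) * satSq (Γ * ((i : ℝ) + 1) ^ (-a)), Finset.mul_sum]
  refine Finset.sum_le_sum fun j _ => ?_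
  have h1 := h.rpow_lam_le hB r j
  have h2 : satSq (Γ * lam j) ≤ B ^ 2 * satSq (Γ * (((j : ℕ) : ℝ) + 1) ^ (-a)) := by
    refine (satSq_mono (mul_nonneg hΓ (h.lam_pos hB j).le)
      (mul_le_mul_of_nonneg_left (h.lam_upper j) hΓ)).trans ?_
    rw [show Γ * (B * (((j : ℕ) : ℝ) + 1) ^ (-a)) = B * (Γ * (((j : ℕ) : ℝ) + 1) ^ (-a)) by ring]
    exact satSq_mul_le hB _
  have hB0 : 0 < B := by linarith
  calc lam j ^ r * satSq (Γ * lam j)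
      ≤ (B ^ |r| * (((j : ℕ) : ℝ) + 1) ^ (-(a * r)))
        * (B ^ 2 * satSq (Γ * (((j : ℕ) : ℝ) + 1) ^ (-a))) :=
        mul_le_mul h1 h2 (satSq_nonneg _) (by positivity)
    _ = _ := by ring

/-- Here the powers are summable without truncation, so `Γ` plays no role. -/
lemma sum_variance_le_of_gt (h : PowerLaw a s B lam m) (hB : 1 ≤ B) {r : ℝ} (ha : 0 < a)
    (hr : 1 / a < r) {Γ : ℝ} :
    ∑ j, lam j ^ r * satSq (Γ * lam j) ≤ B ^ |r| * (1 + 1 / (a * r - 1)) := by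
  refine le_trans (Finset.sum_le_sum fun j _ => ?_) (h.sum_rpow_lam_le hB (p := r) ?_)
  · exact mul_le_of_le_one_right (Real.rpow_nonneg (h.lam_pos hB j).le _) (satSq_le_one _)
  · rw [div_lt_iff₀ ha] at hr; linarith

lemma sum_variance_le_of_eq (h : PowerLaw a s B lam m) (hB : 1 ≤ B) {r : ℝ} (ha : 0 < a)
    (hr : r = 1 / a) {Γ : ℝ} (hΓ : 1 ≤ Γ) :
    ∑ j, lam j ^ r * satSq (Γ * lam j) ≤ B ^ |r| * B ^ 2
      * (1 + 1 / a * Real.log Γ + 2 ^ (a * (2 + r) - 1) / (a * (2 + r) - 1)) := by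
  have hB0 : 0 < B := by linarith
  refine (h.sum_variance_le hB r (by linarith)).trans ?_
  gcongr
  refine (sum_truncated_le ha (r := r) (by rw [hr]; linarith) hΓ d).trans ?_
  refine add_le_add ?_ (le_of_eq (by rw [hr, sub_self, Real.rpow_zero, mul_one]))
  have e : -(a * r) = -1 := by rw [hr]; field_simp
  simp only [e, Real.rpow_neg_one]
  refine (sum_inv_le _).trans ?_
  rw [← Real.log_rpow (by linarith)]
  have hk : 1 ≤ Γ ^ (1 / a) := Real.one_le_rpow hΓ (by positivity)
  have hf : 1 ≤ ⌊Γ ^ (1 / a)⌋₊ := Nat.le_floor (by simpa using hk)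
  gcongr
  exact Nat.floor_le (by linarith)

lemma sum_variance_le_of_lt (h : PowerLaw a s B lam m) (hB : 1 ≤ B) {r : ℝ} (ha : 0 < a)
    (hr : r < 1 / a) (hr2 : 1 / a - 2 < r) {Γ : ℝ} (hΓ : 1 ≤ Γ) :
    ∑ j, lam j ^ r * satSq (Γ * lam j) ≤ B ^ |r| * B ^ 2
      * (1 / min (1 - a * r) 1 + 2 ^ (a * (2 + r) - 1) / (a * (2 + r) - 1)) * Γ ^ (1 / a - r) := by
  have hB0 : 0 < B := by linarith
  have hΓ0 : 0 < Γ := by linarith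
  refine (h.sum_variance_le hB r (by linarith)).trans ?_
  rw [mul_assoc (B ^ |r| * B ^ 2)]
  gcongr
  refine (sum_truncated_le ha hr2 hΓ d).trans ?_
  rw [add_mul]
  refine add_le_add ?_ le_rfl
  have hp : 0 < 1 - a * r := by rw [lt_div_iff₀ ha] at hr; linarith
  have h1 := sum_rpow_head_le hp ⌊Γ ^ (1 / a)⌋₊
  rw [show 1 - a * r - 1 = -(a * r) by ring] at h1
  refine h1.trans ?_
  have hk : 1 ≤ Γ ^ (1 / a) := Real.one_le_rpow hΓ (by positivity)
  have hf : (⌊Γ ^ (1 / a)⌋₊ : ℝ) ^ (1 - a * r) ≤ Γ ^ (1 / a - r) := by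
    calc (⌊Γ ^ (1 / a)⌋₊ : ℝ) ^ (1 - a * r) ≤ (Γ ^ (1 / a)) ^ (1 - a * r) := by
          gcongr; exact Nat.floor_le (by linarith)
      _ = _ := by
          rw [← Real.rpow_mul hΓ0.le]; congr 1; field_simp
  have : 0 < min (1 - a * r) 1 := lt_min hp one_pos
  rw [div_eq_mul_one_div, mul_comm]
  gcongr

end PowerLaw

end CovShift

namespace CovShift

open Filter

/-! ### The parameters and their asymptotics -/

/-- The exponent of the effective step size in the effective sample size. -/
noncomputable def stepExp (a s : ℝ) : ℝ := a / (s * a + 1)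

/-- The effective sample size `n / (ln n)³`. -/
noncomputable def effSize (n : ℕ) : ℝ := n / Real.log n ^ 3

/-- The product of the step size `γ` and the phase length. -/
noncomputable def totalStep (a s : ℝ) (n : ℕ) : ℝ := effSize n ^ stepExp a s

/-- The parameters of accelerated SGD. -/
noncomputable def sgdParams (a s ε δ₀ : ℝ) (n : ℕ) : Params :=
  if 2 ≤ n then
    { α := 1 / (1 + (n : ℝ) ^ (ε - 1))
      β := (n : ℝ) ^ (ε - 1)
      -- This makes `γ K` equal to the value that balances bias and variance.
      γ := totalStep a s n / phaseLength n
      -- Outside the vanilla region `γ` may tend to infinity, and the cap keeps the term `δ l` of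
      -- the feedback small.
      δ := if 1 - 1 / a ≤ s then totalStep a s n / phaseLength n
        else min (totalStep a s n / phaseLength n) δ₀ }
  -- Any admissible values serve here, as all estimates concern large `n`.
  else { α := 1, β := 1, δ := 1, γ := 1 }

lemma numPhases_pos {n : ℕ} (hn : 2 ≤ n) : 0 < numPhases n := Nat.log_pos (by norm_num) hn

lemma phaseLength_pos {n : ℕ} (hn : 2 ≤ n) : 0 < phaseLength n :=
  Nat.div_pos (Nat.log_le_self 2 n) (numPhases_pos hn)

lemma effSize_pos {n : ℕ} (hn : 2 ≤ n) : 0 < effSize n := by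
  have : (1 : ℝ) < n := by exact_mod_cast hn
  have := Real.log_pos this
  unfold effSize; positivity

lemma totalStep_pos {a s : ℝ} {n : ℕ} (hn : 2 ≤ n) : 0 < totalStep a s n :=
  Real.rpow_pos_of_pos (effSize_pos hn) _

lemma sgdParams_admissible {a s ε δ₀ : ℝ} (hε : ε ≤ 1) (hδ₀ : 0 < δ₀) (n : ℕ) :
    (sgdParams a s ε δ₀ n).Admissible := by
  unfold sgdParams
  split_ifs with hn hs
  all_goals simp only [Params.Admissible]
  · have h1 : (1 : ℝ) ≤ n := by exact_mod_cast (by omega : 1 ≤ n)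
    have h2 : (n : ℝ) ^ (ε - 1) ≤ 1 := Real.rpow_le_one_of_one_le_of_nonpos h1 (by linarith)
    have h3 : 0 < (n : ℝ) ^ (ε - 1) := Real.rpow_pos_of_pos (by linarith) _
    have h4 := totalStep_pos (a := a) (s := s) hn
    have h5 : (0 : ℝ) < phaseLength n := by exact_mod_cast phaseLength_pos hn
    refine ⟨by positivity, ?_, h3.le, h2, by positivity, le_rfl⟩
    rw [div_le_one (by positivity)]; linarith
  · have h1 : (1 : ℝ) ≤ n := by exact_mod_cast (by omega : 1 ≤ n)
    have h2 : (n : ℝ) ^ (ε - 1) ≤ 1 := Real.rpow_le_one_of_one_le_of_nonpos h1 (by linarith)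
    have h3 : 0 < (n : ℝ) ^ (ε - 1) := Real.rpow_pos_of_pos (by linarith) _
    have h4 := totalStep_pos (a := a) (s := s) hn
    have h5 : (0 : ℝ) < phaseLength n := by exact_mod_cast phaseLength_pos hn
    refine ⟨by positivity, ?_, h3.le, h2, lt_min (by positivity) hδ₀, min_le_left _ _⟩
    rw [div_le_one (by positivity)]; linarith
  · norm_num

lemma sgdParams_vanilla {a s ε δ₀ : ℝ} (hs : 1 - 1 / a ≤ s) (n : ℕ) :
    (sgdParams a s ε δ₀ n).Vanilla := by
  unfold sgdParams Params.Vanilla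
  split_ifs <;> rfl

lemma eventually_log_pow_le (k : ℕ) (D : ℝ) {c : ℝ} (hc : 0 < c) :
    ∀ᶠ n : ℕ in atTop, D * Real.log n ^ k ≤ (n : ℝ) ^ c := by
  have h := (isLittleO_log_rpow_rpow_atTop (k : ℝ) hc).comp_tendsto tendsto_natCast_atTop_atTop
  have h2 := h.bound (c := 1 / (|D| + 1)) (by positivity)
  filter_upwards [h2, eventually_ge_atTop 1] with n hn hn1
  simp only [Function.comp_apply, Real.rpow_natCast] at hn
  have h1 : (1 : ℝ) ≤ n := by exact_mod_cast hn1
  have hlog : 0 ≤ Real.log n ^ k := pow_nonneg (Real.log_nonneg h1) k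
  rw [Real.norm_of_nonneg hlog, Real.norm_of_nonneg (by positivity),
    div_mul_eq_mul_div, one_mul, le_div_iff₀ (by positivity)] at hn
  have := le_abs_self D
  nlinarith

lemma eventually_log_ge (D : ℝ) : ∀ᶠ n : ℕ in atTop, D ≤ Real.log n :=
  (Real.tendsto_log_atTop.comp tendsto_natCast_atTop_atTop).eventually_ge_atTop D

/-- Elementary facts on the phases for large sample sizes. -/
structure LargePhases (n : ℕ) : Prop where
  two_le : 2 ≤ n
  log_ge : 4 ≤ Real.log n
  L_le : (numPhases n : ℝ) ≤ n
  K_le : (phaseLength n : ℝ) ≤ 2 * n / Real.log n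
  K_ge : n / (4 * Real.log n) ≤ phaseLength n
  four_pow : (n : ℝ) ^ 2 / 16 ≤ 4 ^ (numPhases n - 1)
  eff_ge : 1 ≤ effSize n
  eff_le : effSize n ≤ n

lemma eventually_largePhases : ∀ᶠ n : ℕ in atTop, LargePhases n := by
  filter_upwards [eventually_ge_atTop 2, eventually_log_ge 4,
    eventually_log_pow_le 1 4 one_pos, eventually_log_pow_le 3 1 one_pos] with n hn hlog h1 h3
  rw [Real.rpow_one, pow_one] at h1
  rw [Real.rpow_one, one_mul] at h3
  have hn0 : (0 : ℝ) < n := by positivity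
  have hLpos := numPhases_pos hn
  have hl2 : 1 / 2 ≤ Real.log 2 := by linarith [Real.log_two_gt_d9]
  have hl2' : Real.log 2 ≤ 1 := by linarith [Real.log_two_lt_d9]
  have hlt : (n : ℝ) < 2 ^ (numPhases n + 1) := by
    exact_mod_cast Nat.lt_pow_succ_log_self (by norm_num : 1 < 2) n
  have hge : (2 : ℝ) ^ numPhases n ≤ n := by
    exact_mod_cast Nat.pow_log_le_self 2 (by omega)
  have hL1 : Real.log n < (numPhases n + 1 : ℝ) * Real.log 2 := by
    have := Real.log_lt_log hn0 hlt
    rwa [Real.log_pow, Nat.cast_add, Nat.cast_one] at this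
  have hL2 : (numPhases n : ℝ) * Real.log 2 ≤ Real.log n := by
    have := Real.log_le_log (by positivity) hge
    rwa [Real.log_pow] at this
  have hL0 : (0 : ℝ) < numPhases n := by exact_mod_cast hLpos
  have hLge : Real.log n / 2 ≤ numPhases n := by nlinarith
  have hLle : (numPhases n : ℝ) ≤ 2 * Real.log n := by nlinarith
  have hlog0 : 0 < Real.log n := by linarith
  have hK1 : (phaseLength n : ℝ) ≤ n / numPhases n := Nat.cast_div_le
  have hK2 : (n : ℝ) / numPhases n - 1 ≤ phaseLength n := by
    have := Nat.lt_div_mul_add (a := n) hLpos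
    have h : (n : ℝ) < phaseLength n * numPhases n + numPhases n := by
      unfold phaseLength; exact_mod_cast this
    rw [sub_le_iff_le_add, div_le_iff₀ hL0]; linarith
  refine ⟨hn, hlog, ?_, ?_, ?_, ?_, ?_, ?_⟩
  · exact_mod_cast Nat.log_le_self 2 n
  · refine hK1.trans ?_
    rw [div_le_div_iff₀ hL0 hlog0]; nlinarith
  · have h5 : (n : ℝ) / (2 * Real.log n) ≤ n / numPhases n := by gcongr
    have h6 : 1 ≤ (n : ℝ) / (4 * Real.log n) := by
      rw [le_div_iff₀ (by positivity)]; linarith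
    have h7 : (n : ℝ) / (2 * Real.log n) = n / (4 * Real.log n) + n / (4 * Real.log n) := by
      field_simp; norm_num
    linarith
  -- `2 ^ (L + 1) > n`, so the step sizes fall by a factor of order `n²` in total.
  · have h8 : (n : ℝ) ^ 2 ≤ (2 ^ (numPhases n + 1)) ^ 2 := by gcongr
    have h9 : ((2 : ℝ) ^ (numPhases n + 1)) ^ 2 = 16 * 4 ^ (numPhases n - 1) := by
      obtain ⟨k, hk⟩ : ∃ k, numPhases n = k + 1 := ⟨numPhases n - 1, by omega⟩
      rw [hk, Nat.add_sub_cancel, ← pow_mul, show (4 : ℝ) = 2 ^ 2 by norm_num, ← pow_mul,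
        show (16 : ℝ) = 2 ^ 4 by norm_num, ← pow_add]
      congr 1; ring
    rw [div_le_iff₀ (by norm_num)]; linarith
  · unfold effSize; rwa [le_div_iff₀ (by positivity), one_mul]
  · unfold effSize
    exact div_le_self hn0.le (one_le_pow₀ (by linarith))

lemma LargePhases.n_pos {n : ℕ} (h : LargePhases n) : (0 : ℝ) < n := by
  have := h.two_le; positivity

lemma LargePhases.K_pos {n : ℕ} (h : LargePhases n) : (0 : ℝ) < phaseLength n := by
  exact_mod_cast phaseLength_pos h.two_le

lemma LargePhases.inv_K_le {n : ℕ} (h : LargePhases n) :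
    1 / (phaseLength n : ℝ) ≤ 4 * Real.log n / n := by
  have h1 := h.K_ge
  have h2 := h.log_ge
  have h3 := h.n_pos
  rw [div_le_div_iff₀ h.K_pos h3]
  rw [div_le_iff₀ (by positivity)] at h1
  linarith

lemma LargePhases.step_le {n : ℕ} (h : LargePhases n) {a s : ℝ} (hq : 0 ≤ stepExp a s) :
    totalStep a s n / phaseLength n ≤ (n : ℝ) ^ (stepExp a s - 1) * (4 * Real.log n) := by
  have h2 := h.log_ge
  have h3 := h.n_pos
  have h4 := h.eff_ge
  have h1 : totalStep a s n ≤ (n : ℝ) ^ stepExp a s :=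
    Real.rpow_le_rpow (by linarith) h.eff_le hq
  calc totalStep a s n / phaseLength n = totalStep a s n * (1 / phaseLength n) := by ring
    _ ≤ (n : ℝ) ^ stepExp a s * (4 * Real.log n / n) :=
        mul_le_mul h1 h.inv_K_le (by positivity) (by positivity)
    _ = _ := by rw [Real.rpow_sub_one h3.ne']; ring

/-- What the upper bound needs of a large sample size. -/
structure LargeSample (a s ε ϑ η A D : ℝ) (n : ℕ) : Prop extends LargePhases n where
  D_le : D ≤ n
  step_le_n : totalStep a s n / phaseLength n ≤ n
  total_le : D * totalStep a s n ≤ (n : ℝ) ^ 2 / 16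
  -- The quantity `γ β ^ ϑ` that `feedback_min_le` produces.
  step_mul : totalStep a s n / phaseLength n * ((n : ℝ) ^ (ε - 1)) ^ ϑ ≤ η
  -- A phase thereby contracts fast coordinates by `n ^ (-A)`.
  warm : A * Real.log n ≤ (n : ℝ) ^ (ε - 1) * phaseLength n / 2

/-- Powers of `n` against logarithms. The decisive condition is that `γ β ^ ϑ` tends to zero: up to
a logarithm, its exponent is at most `stepExp a s - 1 - (1 - ε) ϑ`, which `hϑ` makes negative. -/
lemma eventually_largeSample {a s ε ϑ η A D : ℝ} (hq : 0 ≤ stepExp a s) (hq2 : stepExp a s < 2)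
    (hε : 0 < ε) (hη : 0 < η) (hϑ : stepExp a s - 1 < (1 - ε) * ϑ) :
    ∀ᶠ n : ℕ in atTop, LargeSample a s ε ϑ η A D n := by
  filter_upwards [eventually_largePhases, eventually_log_pow_le 0 D one_pos,
    eventually_log_pow_le 1 4 (by linarith : 0 < 2 - stepExp a s),
    eventually_log_pow_le 0 (16 * |D|) (by linarith : 0 < 2 - stepExp a s),
    eventually_log_pow_le 1 (4 / η) (by linarith : 0 < (1 - ε) * ϑ - (stepExp a s - 1)),
    eventually_log_pow_le 2 (8 * A) hε] with n hn h1 h2 h3 h4 h5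
  have hn0 := hn.n_pos
  have hlog := hn.log_ge
  have hlog0 : 0 < Real.log n := by linarith
  have hstep := hn.step_le hq
  rw [pow_zero, mul_one, Real.rpow_one] at h1
  rw [pow_one] at h2 h4
  rw [pow_zero, mul_one] at h3
  refine ⟨hn, h1, hstep.trans ?_, ?_, ?_, ?_⟩
  · calc (n : ℝ) ^ (stepExp a s - 1) * (4 * Real.log n)
        ≤ (n : ℝ) ^ (stepExp a s - 1) * (n : ℝ) ^ (2 - stepExp a s) := by gcongr
      _ = n := by
          rw [← Real.rpow_add hn0, show stepExp a s - 1 + (2 - stepExp a s) = 1 by ring,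
            Real.rpow_one]
  · have h6 : totalStep a s n ≤ (n : ℝ) ^ stepExp a s :=
      Real.rpow_le_rpow (by linarith [hn.eff_ge]) hn.eff_le hq
    have h7 : (n : ℝ) ^ stepExp a s * (n : ℝ) ^ (2 - stepExp a s) = (n : ℝ) ^ 2 := by
      rw [← Real.rpow_add hn0, show stepExp a s + (2 - stepExp a s) = ((2 : ℕ) : ℝ) by
        push_cast; ring, Real.rpow_natCast]
    have h8 := totalStep_pos (a := a) (s := s) hn.two_le
    have h9 := le_abs_self D
    have h10 : |D| * totalStep a s n ≤ |D| * (n : ℝ) ^ stepExp a s := by gcongr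
    have h11 : 0 < (n : ℝ) ^ stepExp a s := by positivity
    nlinarith
  · calc totalStep a s n / phaseLength n * ((n : ℝ) ^ (ε - 1)) ^ ϑ
        ≤ (n : ℝ) ^ (stepExp a s - 1) * (4 * Real.log n) * ((n : ℝ) ^ (ε - 1)) ^ ϑ := by gcongr
      _ = η * (n : ℝ) ^ (-((1 - ε) * ϑ - (stepExp a s - 1))) * (4 / η * Real.log n) := by
          rw [← Real.rpow_mul hn0.le, show -((1 - ε) * ϑ - (stepExp a s - 1))
            = (stepExp a s - 1) + (ε - 1) * ϑ by ring, Real.rpow_add hn0]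
          field_simp
      _ ≤ η * (n : ℝ) ^ (-((1 - ε) * ϑ - (stepExp a s - 1)))
          * (n : ℝ) ^ ((1 - ε) * ϑ - (stepExp a s - 1)) := by gcongr
      _ = η := by rw [mul_assoc, ← Real.rpow_add hn0, neg_add_cancel, Real.rpow_zero, mul_one]
  · have h6 : (n : ℝ) ^ (ε - 1) * (n / (4 * Real.log n)) ≤ (n : ℝ) ^ (ε - 1) * phaseLength n := by
      have := hn.K_ge
      gcongr
    have h7 : (n : ℝ) ^ (ε - 1) * (n / (4 * Real.log n)) = (n : ℝ) ^ ε / (4 * Real.log n) := by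
      rw [Real.rpow_sub_one hn0.ne']; field_simp
    rw [h7, div_le_iff₀ (by positivity)] at h6
    have h8 : (8 * A * Real.log n) * Real.log n ≤ 4 * ((n : ℝ) ^ (ε - 1) * phaseLength n)
      * Real.log n := by nlinarith
    have := le_of_mul_le_mul_right h8 hlog0
    linarith

/-- In the vanilla regime the step size tends to zero. -/
lemma eventually_step_le {a s η : ℝ} (hq : stepExp a s ≤ 1) (hη : 0 < η) :
    ∀ᶠ n : ℕ in atTop, totalStep a s n / phaseLength n ≤ η := by
  filter_upwards [eventually_largePhases, eventually_log_ge (4 / η)] with n hn h1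
  have hn0 := hn.n_pos
  have hlog := hn.log_ge
  have hlog0 : 0 < Real.log n := by linarith
  have h2 : totalStep a s n ≤ effSize n := by
    have := Real.rpow_le_rpow_of_exponent_le hn.eff_ge hq
    rwa [Real.rpow_one] at this
  have h3 : 0 < effSize n := effSize_pos hn.two_le
  calc totalStep a s n / phaseLength n = totalStep a s n * (1 / phaseLength n) := by ring
    _ ≤ effSize n * (4 * Real.log n / n) :=
        mul_le_mul h2 hn.inv_K_le (by positivity) h3.le
    _ = 4 / Real.log n ^ 2 := by unfold effSize; field_simp
    _ ≤ η := by
        rw [div_le_iff₀ hη] at h1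
        rw [div_le_iff₀ (by positivity)]
        nlinarith

end CovShift

/-! ### Stability and bias for the chosen parameters -/

namespace CovShift

open Filter

/-- The inequality `y / (2 p) ≤ exp (y / (2 p))`, raised to the power `p`. -/
lemma rpow_mul_exp_neg_le {p y : ℝ} (hp : 0 < p) (hy : 0 ≤ y) :
    y ^ p * Real.exp (-(y / 2)) ≤ (2 * p) ^ p := by
  have h1 : y ≤ 2 * p * Real.exp (y / (2 * p)) := by
    have := Real.add_one_le_exp (y / (2 * p))
    have h2 : y = 2 * p * (y / (2 * p)) := by field_simp
    calc y = 2 * p * (y / (2 * p)) := h2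
      _ ≤ _ := by gcongr; linarith
  have h2 : y ^ p ≤ (2 * p) ^ p * Real.exp (y / 2) := by
    refine (Real.rpow_le_rpow hy h1 hp.le).trans (le_of_eq ?_)
    rw [Real.mul_rpow (by positivity) (Real.exp_pos _).le, ← Real.exp_mul]
    congr 2; field_simp
  rw [Real.exp_neg, ← div_eq_mul_inv, div_le_iff₀ (Real.exp_pos _)]
  exact h2

lemma rpow_le_max_one {y ϑ : ℝ} (hy : 0 ≤ y) (h0 : 0 ≤ ϑ) (h1 : ϑ ≤ 1) : y ^ ϑ ≤ max 1 y := by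
  rcases le_total y 1 with h | h
  · exact (Real.rpow_le_one hy h h0).trans (le_max_left _ _)
  · exact (Real.rpow_le_self_of_one_le h h1).trans (le_max_right _ _)

lemma feedback_le_two_mul {β δ γ l : ℝ} (hδ : 0 ≤ δ) (hδγ : δ ≤ γ) (hl : 0 ≤ l) :
    feedback β δ γ l ≤ 2 * γ * l := by
  have h1 : γ * l / max 1 (δ * l / β) ≤ γ * l :=
    div_le_self (mul_nonneg (hδ.trans hδγ) hl) (le_max_left _ _)
  have h2 : δ * l ≤ γ * l := by gcongr
  unfold feedback; linarith

/-- The gain of acceleration. As `max 1 y ≥ y ^ ϑ`, the factor `β ^ ϑ` can compensate a large `γ`,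
at the price of `l ^ (1 - ϑ)` in place of `l`; for a power-law spectrum this stays summable as long
as `ϑ < 1 - 1/a`. -/
lemma feedback_min_le {β γ δ₀ l ϑ : ℝ} (hβ : 0 < β) (hγ : 0 < γ) (hδ₀ : 0 < δ₀) (hl : 0 < l)
    (h0 : 0 ≤ ϑ) (h1 : ϑ ≤ 1) :
    feedback β (min γ δ₀) γ l ≤ γ * β ^ ϑ * δ₀ ^ (-ϑ) * l ^ (1 - ϑ) + 2 * δ₀ * l := by
  rcases le_total γ δ₀ with h | h
  · rw [min_eq_left h]
    refine (feedback_le_two_mul hγ.le le_rfl hl.le).trans ?_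
    have : 0 ≤ γ * β ^ ϑ * δ₀ ^ (-ϑ) * l ^ (1 - ϑ) := by positivity
    have : 2 * γ * l ≤ 2 * δ₀ * l := by gcongr
    linarith
  · rw [min_eq_right h]
    unfold feedback
    have h2 := rpow_le_max_one (y := δ₀ * l / β) (by positivity) h0 h1
    have h3 : 0 < (δ₀ * l / β) ^ ϑ := by positivity
    have h4 : γ * l / max 1 (δ₀ * l / β) ≤ γ * l / (δ₀ * l / β) ^ ϑ := by gcongr
    have h5 : γ * l / (δ₀ * l / β) ^ ϑ = γ * β ^ ϑ * δ₀ ^ (-ϑ) * l ^ (1 - ϑ) := by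
      rw [Real.div_rpow (by positivity) hβ.le, Real.mul_rpow hδ₀.le hl.le, Real.rpow_neg hδ₀.le,
        Real.rpow_sub hl, Real.rpow_one]
      field_simp
    have h6 : 0 < δ₀ * l := by positivity
    linarith

section

variable {a s ε ϑ η A D δ₀ B ψ : ℝ} {n d : ℕ} {lam m : Fin d → ℝ}

lemma sgdParams_β (hn : 2 ≤ n) : (sgdParams a s ε δ₀ n).β = (n : ℝ) ^ (ε - 1) := by
  simp [sgdParams, hn]

lemma sgdParams_α (hn : 2 ≤ n) :
    (sgdParams a s ε δ₀ n).α = 1 / (1 + (sgdParams a s ε δ₀ n).β) := by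
  simp [sgdParams, hn]

lemma sgdParams_γ (hn : 2 ≤ n) :
    (sgdParams a s ε δ₀ n).γ = totalStep a s n / phaseLength n := by
  simp [sgdParams, hn]

lemma LargeSample.exp_le (h : LargeSample a s ε ϑ η A D n) :
    Real.exp (-((n : ℝ) ^ (ε - 1) * phaseLength n / 2)) ≤ (n : ℝ) ^ (-A) := by
  rw [Real.rpow_def_of_pos h.n_pos (-A)]
  refine Real.exp_le_exp.2 ?_
  have := h.warm
  linarith

lemma LargeSample.n_ge (h : LargeSample a s ε ϑ η A D n) : (5 : ℝ) ≤ n := by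
  have h1 := h.log_ge
  have h2 := Real.add_one_le_exp (Real.log n)
  rw [Real.exp_log h.n_pos] at h2
  linarith

lemma LargeSample.K_le_n (h : LargeSample a s ε ϑ η A D n) : (phaseLength n : ℝ) ≤ n := by
  refine h.K_le.trans ?_
  have h1 := h.log_ge
  have := h.n_pos
  rw [div_le_iff₀ (by linarith)]
  nlinarith

lemma LargeSample.ratio_le (h : LargeSample a s ε ϑ η A D n) (hε : 0 ≤ ε) {l : ℝ} (hl : 0 ≤ l)
    (hl' : l ≤ n) :
    totalStep a s n / phaseLength n * l / (n : ℝ) ^ (ε - 1) ≤ (n : ℝ) ^ 3 := by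
  have hn := h.n_pos
  have h1 : (n : ℝ)⁻¹ ≤ (n : ℝ) ^ (ε - 1) := by
    rw [← Real.rpow_neg_one]
    exact Real.rpow_le_rpow_of_exponent_le (by linarith [h.n_ge]) (by linarith)
  have h2 : totalStep a s n / phaseLength n * l ≤ n * n := mul_le_mul h.step_le_n hl' hl hn.le
  rw [div_le_iff₀ (by positivity)]
  calc totalStep a s n / phaseLength n * l ≤ n * n := h2
    _ = (n : ℝ) ^ 3 * (n : ℝ)⁻¹ := by field_simp
    _ ≤ _ := by gcongr

lemma LargeSample.stableParams (h : LargeSample a s ε ϑ η A D n) (hp : PowerLaw a s B lam m)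
    (ha : 0 ≤ a) (hB : 1 ≤ B) (hε : 0 < ε) (hε1 : ε < 1) (hϑ1 : ϑ ≤ 1) (hA : 11 ≤ A)
    (hD : B ≤ D) (hη : η * B ≤ 1) (hδ₀ : 0 < δ₀)
    (hfb : 2 * ψ * 10000000 * ∑ j, feedback (sgdParams a s ε δ₀ n).β (sgdParams a s ε δ₀ n).δ
      (sgdParams a s ε δ₀ n).γ (lam j) ≤ 1 / 2) :
    StableParams (sgdParams a s ε δ₀ n) n ψ lam := by
  have hn2 := h.two_le
  have hn := h.n_pos
  have hn5 := h.n_ge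
  have hadm := sgdParams_admissible (a := a) (s := s) hε1.le hδ₀ n
  have hβ0 : (0 : ℝ) < (n : ℝ) ^ (ε - 1) := by positivity
  have hβ1 : (n : ℝ) ^ (ε - 1) ≤ 1 := by have := hadm.2.2.2.1; rwa [sgdParams_β hn2] at this
  have hK := h.K_pos
  have hΓ := totalStep_pos (a := a) (s := s) hn2
  have hlam := hp.lam_pos hB
  have hlamB := hp.lam_le hB ha
  have hγ0 : 0 < totalStep a s n / phaseLength n := by positivity
  have hδγ := hadm.2.2.2.2.2
  rw [sgdParams_γ hn2] at hδγ
  refine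
    { lam_pos := hlam
      β_pos := by rwa [sgdParams_β hn2]
      β_le := hadm.2.2.2.1
      α_eq := sgdParams_α hn2
      δ_pos := hadm.2.2.2.2.1
      δ_le := hadm.2.2.2.2.2
      K_pos := phaseLength_pos hn2
      L_pos := numPhases_pos hn2
      curv := fun j => ?_
      warm := ?_
      small₁ := fun j => ?_
      small₂ := fun j => ?_
      last := fun j => ?_
      feedback_le := hfb }
  · rw [sgdParams_β hn2, sgdParams_γ hn2]
    -- As `β ≤ 1` and `ϑ ≤ 1`, the smallness of `γ β ^ ϑ` covers `γ β`.
    have h1 : (n : ℝ) ^ (ε - 1) ≤ ((n : ℝ) ^ (ε - 1)) ^ ϑ := by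
      have := Real.rpow_le_rpow_of_exponent_ge hβ0 hβ1 hϑ1
      rwa [Real.rpow_one] at this
    calc (n : ℝ) ^ (ε - 1) * (totalStep a s n / phaseLength n) * lam j
        ≤ ((n : ℝ) ^ (ε - 1)) ^ ϑ * (totalStep a s n / phaseLength n) * B := by
          have := (hlam j).le; have := hlamB j; gcongr
      _ ≤ η * B := by
          rw [mul_comm (((n : ℝ) ^ (ε - 1)) ^ ϑ)]; have := h.step_mul; gcongr
      _ ≤ 1 := hη
  · rw [sgdParams_β hn2]
    have := h.warm; have := h.log_ge
    nlinarith
  · rw [sgdParams_β hn2, sgdParams_γ hn2]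
    have hln : lam j ≤ n := (hlamB j).trans (hD.trans h.D_le)
    have hr := h.ratio_le hε.le (hlam j).le hln
    have hn3 : (1 : ℝ) ≤ (n : ℝ) ^ 3 := one_le_pow₀ (by linarith)
    have hw : lyapWeight ((n : ℝ) ^ (ε - 1)) (totalStep a s n / phaseLength n) (lam j)
        ≤ (n : ℝ) ^ 3 := max_le hn3 hr
    have hδ0 := hadm.2.2.2.2.1
    have hγn := h.step_le_n
    have hnoise : lyapNoise ((n : ℝ) ^ (ε - 1)) (sgdParams a s ε δ₀ n).δ
        (totalStep a s n / phaseLength n) (lam j) ≤ (n : ℝ) ^ 6 := by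
      unfold lyapNoise
      calc (totalStep a s n / phaseLength n) ^ 2
          + lyapWeight ((n : ℝ) ^ (ε - 1)) (totalStep a s n / phaseLength n) (lam j)
            * (sgdParams a s ε δ₀ n).δ ^ 2 ≤ (n : ℝ) ^ 2 + (n : ℝ) ^ 3 * (n : ℝ) ^ 2 := by
            have := hδγ.trans hγn
            gcongr
        _ ≤ (n : ℝ) ^ 6 := by
            have : (n : ℝ) ^ 6 = n * (n ^ 3 * n ^ 2) := by ring
            have h5 : (n : ℝ) ^ 2 ≤ n ^ 3 * n ^ 2 := le_mul_of_one_le_left (by positivity) hn3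
            nlinarith [mul_le_mul_of_nonneg_right hn5 (by positivity : 0 ≤ (n : ℝ) ^ 3 * n ^ 2)]
    -- The number of phases, the squared phase length, the squared eigenvalue and the noise
    -- contribute `1 + 2 + 2 + 6 = 11` powers of `n`.
    have hexp : Real.exp (-((n : ℝ) ^ (ε - 1) * phaseLength n / 2)) ≤ ((n : ℝ) ^ 11)⁻¹ := by
      refine h.exp_le.trans ?_
      rw [← Real.rpow_natCast, ← Real.rpow_neg hn.le]
      exact Real.rpow_le_rpow_of_exponent_le (by linarith) (by push_cast; linarith)
    calc (numPhases n : ℝ) * phaseLength n ^ 2 * lam j ^ 2 * lyapNoise ((n : ℝ) ^ (ε - 1))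
          (sgdParams a s ε δ₀ n).δ (totalStep a s n / phaseLength n) (lam j)
          * Real.exp (-((n : ℝ) ^ (ε - 1) * phaseLength n / 2))
        ≤ (n : ℝ) * n ^ 2 * n ^ 2 * n ^ 6 * ((n : ℝ) ^ 11)⁻¹ := by
          have := h.L_le; have := h.K_le_n; have := (hlam j).le
          have := lyapNoise_nonneg ((n : ℝ) ^ (ε - 1))
            (sgdParams a s ε δ₀ n).δ (totalStep a s n / phaseLength n) (lam j)
          gcongr
      _ = 1 := by field_simp
  · rw [sgdParams_β hn2, sgdParams_γ hn2]
    have hln : lam j ≤ n := (hlamB j).trans (hD.trans h.D_le)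
    have hr := h.ratio_le hε.le (hlam j).le hln
    have hexp : Real.exp (-((n : ℝ) ^ (ε - 1) * phaseLength n / 2)) ≤ ((n : ℝ) ^ 3)⁻¹ := by
      refine h.exp_le.trans ?_
      rw [← Real.rpow_natCast, ← Real.rpow_neg hn.le]
      exact Real.rpow_le_rpow_of_exponent_le (by linarith) (by push_cast; linarith)
    calc _ ≤ (n : ℝ) ^ 3 * ((n : ℝ) ^ 3)⁻¹ := by gcongr
      _ = 1 := by field_simp
  · rw [sgdParams_γ hn2]
    have e : totalStep a s n / phaseLength n * lam j * phaseLength n = lam j * totalStep a s n := by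
      field_simp
    rw [e]
    refine le_trans ?_ (h.total_le.trans h.four_pow)
    have := (hlamB j).trans hD
    gcongr

/-- Dividing by `m ≍ λ^{1-s}` leaves the weight `λ^{r+s}`. For slow coordinates it is multiplied by
`exp (-Γ λ / 2)`, and the product is at most a multiple of `Γ^{-(r+s)}`, the critical range being `λ
≍ 1/Γ`. For fast coordinates the factor `n ^ (-A)` decides. -/
lemma LargeSample.bias_le (h : LargeSample a s ε ϑ η A D n) (hp : PowerLaw a s B lam m)
    (ha : 0 ≤ a) (hB : 1 ≤ B) (hε : 0 < ε) (hD : B ≤ D) {r : ℝ} (hrs : 0 < r + s)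
    (hA : 3 * (r + s) + 4 ≤ A) (j : Fin d) :
    lam j ^ (1 + r) * (Real.exp (-(lyapRate (sgdParams a s ε δ₀ n).β (sgdParams a s ε δ₀ n).γ
      (lam j) * phaseLength n)) * (1 + lyapWeight (sgdParams a s ε δ₀ n).β
      (sgdParams a s ε δ₀ n).γ (lam j)))
      ≤ B * (1 + 2 * (2 * (r + s)) ^ (r + s)) * totalStep a s n ^ (-(r + s)) * m j := by
  have hn2 := h.two_le
  have hn := h.n_pos
  have hn5 := h.n_ge
  have hβ0 : (0 : ℝ) < (n : ℝ) ^ (ε - 1) := by positivity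
  have hK := h.K_pos
  have hΓ := totalStep_pos (a := a) (s := s) hn2
  have hl := hp.lam_pos hB j
  have hln : lam j ≤ n := (hp.lam_le hB ha j).trans (hD.trans h.D_le)
  have hB0 : 0 < B := by linarith
  rw [sgdParams_β hn2, sgdParams_γ hn2]
  set γ := totalStep a s n / phaseLength n with hγ
  set β := (n : ℝ) ^ (ε - 1) with hβ
  set p := r + s with hpd
  have hC : 0 < (2 * p) ^ p := by positivity
  have hmain : lam j ^ p * (Real.exp (-(lyapRate β γ (lam j) * phaseLength n))
      * (1 + lyapWeight β γ (lam j)))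
      ≤ (1 + 2 * (2 * p) ^ p) * totalStep a s n ^ (-p) := by
    have hΓp : 0 < totalStep a s n ^ (-p) := by positivity
    rcases le_total (γ * lam j) β with hc | hc
    · rw [lyapWeight_eq_one hβ0 hc, lyapRate, min_eq_right hc]
      set y := totalStep a s n * lam j with hy
      have e1 : γ * lam j / 2 * phaseLength n = y / 2 := by rw [hγ, hy]; field_simp
      have e2 : lam j ^ p = totalStep a s n ^ (-p) * y ^ p := by
        rw [hy, Real.mul_rpow hΓ.le hl.le, ← mul_assoc, ← Real.rpow_add hΓ, neg_add_cancel,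
          Real.rpow_zero, one_mul]
      rw [e1, e2]
      have := rpow_mul_exp_neg_le hrs (by positivity : 0 ≤ y)
      have h2 := mul_le_mul_of_nonneg_left this hΓp.le
      nlinarith
    · rw [lyapWeight_eq hβ0 hc, lyapRate, min_eq_left hc]
      have e1 : β / 2 * phaseLength n = β * phaseLength n / 2 := by ring
      rw [e1]
      have hr := h.ratio_le hε.le hl.le hln
      rw [← hγ, ← hβ] at hr
      have hexp := h.exp_le
      rw [← hβ] at hexp
      have h1 : lam j ^ p ≤ (n : ℝ) ^ p := Real.rpow_le_rpow hl.le hln hrs.le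
      have hn3 : (1 : ℝ) ≤ (n : ℝ) ^ 3 := one_le_pow₀ (by linarith)
      have h2 : 1 + γ * lam j / β ≤ (n : ℝ) ^ 4 := by
        have : (n : ℝ) ^ 4 = n * n ^ 3 := by ring
        nlinarith
      have h3 : totalStep a s n ≤ (n : ℝ) ^ 2 := by
        have := h.total_le
        nlinarith [hB.trans hD]
      have h4 : (n : ℝ) ^ (-(2 * p)) ≤ totalStep a s n ^ (-p) := by
        have := Real.rpow_le_rpow_of_nonpos hΓ h3 (by linarith : -p ≤ 0)
        rwa [← Real.rpow_natCast, ← Real.rpow_mul hn.le,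
          show ((2 : ℕ) : ℝ) * -p = -(2 * p) by push_cast; ring] at this
      -- `A` pays `p` for the eigenvalue, `4` for the weight, and `2 p` for the comparison with `Γ ^
      -- (-p)`, as `Γ ≤ n²`.
      have h5 : (n : ℝ) ^ p * ((n : ℝ) ^ (-A) * (n : ℝ) ^ 4) ≤ (n : ℝ) ^ (-(2 * p)) := by
        rw [← Real.rpow_natCast (n : ℝ) 4, ← Real.rpow_add hn, ← Real.rpow_add hn]
        exact Real.rpow_le_rpow_of_exponent_le (by linarith) (by push_cast; linarith)
      have h6 : lam j ^ p * (Real.exp (-(β * phaseLength n / 2)) * (1 + γ * lam j / β))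
          ≤ (n : ℝ) ^ p * ((n : ℝ) ^ (-A) * (n : ℝ) ^ 4) := by
        have : 0 < γ * lam j / β := by positivity
        gcongr
      nlinarith [h6.trans (h5.trans h4), mul_pos hC hΓp]
  have hm : lam j ^ (1 - s) ≤ B * m j := by
    have := h.n_pos
    have h1 := hp.m_lower j
    rwa [inv_mul_le_iff₀ hB0] at h1
  have e : lam j ^ (1 + r) = lam j ^ (1 - s) * lam j ^ p := by
    rw [← Real.rpow_add hl]; congr 1; rw [hpd]; ring
  rw [e, mul_assoc]
  refine (mul_le_mul hm hmain ?_ (mul_nonneg hB0.le (hp.m_pos hB j).le)).trans (le_of_eq (by ring))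
  have := one_le_lyapWeight β γ (lam j)
  positivity

end

end CovShift

/-! ### The rates of bias and variance, and the choice of the exponents -/

namespace CovShift

open Filter

section

variable {a s r : ℝ}

lemma pos_of_threshold_lt (ha : 1 < a) (hs : (a - 1) ^ 2 / (a * (2 * a - 1)) < s) : 0 < s := by
  have : 0 < 2 * a - 1 := by linarith
  exact lt_of_le_of_lt (by positivity) hs

lemma stepExp_pos (ha : 1 < a) (hs : 0 < s) : 0 < stepExp a s := by
  unfold stepExp; positivity

/-- After clearing denominators this is the assumption on `s`. It leaves room for an interpolation
exponent `ϑ` between `stepExp a s - 1` and `1 - 1/a`. -/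
lemma stepExp_lt (ha : 1 < a) (hs : (a - 1) ^ 2 / (a * (2 * a - 1)) < s) :
    stepExp a s < 2 - 1 / a := by
  have hs0 := pos_of_threshold_lt ha hs
  have h1 : 0 < 2 * a - 1 := by linarith
  have ha0 : 0 < a := by linarith
  rw [div_lt_iff₀ (by positivity)] at hs
  have : 2 - 1 / a = (2 * a - 1) / a := by field_simp
  rw [this, stepExp, div_lt_div_iff₀ (by positivity) ha0]
  nlinarith

/-- In the vanilla region the balanced `Γ` grows no faster than `n`, hence can be reached without
large steps. -/
lemma stepExp_le_one (ha : 1 < a) (hs : 1 - 1 / a ≤ s) : stepExp a s ≤ 1 := by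
  have ha0 : 0 < a := by linarith
  have h1 : 0 < s := lt_of_lt_of_le (by rw [sub_pos, div_lt_one ha0]; exact ha) hs
  have h2 : (1 - 1 / a) * a ≤ s * a := by gcongr
  have h3 : (1 - 1 / a) * a = a - 1 := by field_simp
  rw [stepExp, div_le_one (by positivity)]
  linarith

lemma rateExp_eq : rateExp a s r = stepExp a s * (r + s) := by
  unfold rateExp stepExp; ring

/-- The balance: `Γ^{1/a-r}` divided by the effective sample size is again its power `-rateExp a s
r`, like the bias. -/
lemma one_sub_rateExp (ha : 1 < a) (hs : 0 < s) :
    1 - rateExp a s r = stepExp a s * (1 / a - r) := by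
  unfold rateExp stepExp; field_simp; ring

lemma totalStep_rpow_neg {n : ℕ} (hn : 2 ≤ n) :
    totalStep a s n ^ (-(r + s)) = effSize n ^ (-rateExp a s r) := by
  rw [totalStep, ← Real.rpow_mul (effSize_pos hn).le, rateExp_eq]; congr 1; ring

lemma effSize_rpow_neg {n : ℕ} (hn : 2 ≤ n) (ρ : ℝ) :
    effSize n ^ (-ρ) = (1 / (n : ℝ)) ^ ρ * Real.log n ^ (3 * ρ) := by
  have h0 : (0 : ℝ) < n := by positivity
  have h1 : 0 < Real.log n := Real.log_pos (by exact_mod_cast hn)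
  rw [Real.rpow_neg (effSize_pos hn).le, ← Real.inv_rpow (effSize_pos hn).le,
    show (effSize n)⁻¹ = 1 / (n : ℝ) * Real.log n ^ 3 by unfold effSize; field_simp,
    Real.mul_rpow (by positivity) (by positivity), ← Real.rpow_natCast (Real.log n) 3,
    ← Real.rpow_mul h1.le]
  norm_num

lemma effSize_rpow_neg_one (n : ℕ) : effSize n ^ (-1 : ℝ) = Real.log n ^ 3 / n := by
  rw [Real.rpow_neg_one]; unfold effSize; rw [inv_div]

lemma sgdRate_pos {n : ℕ} (hn : 2 ≤ n) : 0 < sgdRate a s r n := by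
  have h0 : (0 : ℝ) < n := by positivity
  have h1 : 0 < Real.log n := Real.log_pos (by exact_mod_cast hn)
  unfold sgdRate
  split_ifs <;> positivity

/-- For `r ≤ 1/a` the rate is the bias itself. For `r > 1/a` the exponent exceeds one, and the bias
is smaller than `ln n / n` in spite of the logarithms in the effective sample size. -/
lemma eventually_bias_rate (ha : 1 < a) (hs : 0 < s) :
    ∀ᶠ n : ℕ in atTop, totalStep a s n ^ (-(r + s)) ≤ sgdRate a s r n := by
  have h1 := one_sub_rateExp (r := r) ha hs
  have hq := stepExp_pos ha hs
  by_cases hr : 1 / a < r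
  · have hρ : 0 < rateExp a s r - 1 := by nlinarith
    filter_upwards [eventually_largePhases, eventually_log_pow_le 3 1 (by norm_num : (0:ℝ) < 1 / 2),
      eventually_log_pow_le 2 1 (by linarith : 0 < (rateExp a s r - 1) / 2)] with n hn h3 h2
    rw [totalStep_rpow_neg hn.two_le, sgdRate, if_pos hr]
    have hn0 := hn.n_pos
    have hlog := hn.log_ge
    have hE := effSize_pos hn.two_le
    have hge : (n : ℝ) ^ (1 / 2 : ℝ) ≤ effSize n := by
      rw [effSize, le_div_iff₀ (by positivity)]
      calc (n : ℝ) ^ (1 / 2 : ℝ) * Real.log n ^ 3 ≤ (n : ℝ) ^ (1 / 2 : ℝ) * (n : ℝ) ^ (1 / 2 : ℝ) := by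
            gcongr; linarith
        _ = n := by rw [← Real.rpow_add hn0]; norm_num
    have hlog2 : Real.log n ^ 2 ≤ effSize n ^ (rateExp a s r - 1) := by
      calc Real.log n ^ 2 ≤ (n : ℝ) ^ ((rateExp a s r - 1) / 2) := by linarith
        _ = ((n : ℝ) ^ (1 / 2 : ℝ)) ^ (rateExp a s r - 1) := by
            rw [← Real.rpow_mul hn0.le]; congr 1; ring
        _ ≤ _ := Real.rpow_le_rpow (by positivity) hge hρ.le
    have e : effSize n ^ (-rateExp a s r)
        = Real.log n ^ 3 / n / effSize n ^ (rateExp a s r - 1) := by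
      rw [← effSize_rpow_neg_one, ← Real.rpow_sub hE]; congr 1; ring
    rw [e, div_le_iff₀ (by positivity)]
    calc Real.log n ^ 3 / n = Real.log n / n * Real.log n ^ 2 := by ring
      _ ≤ _ := by gcongr
  · filter_upwards [eventually_ge_atTop 2] with n hn
    rw [totalStep_rpow_neg hn, sgdRate, if_neg hr]
    split_ifs with hr2
    · have : rateExp a s r = 1 := by
        have h2 : 1 / a - r = 0 := by rw [hr2, sub_self]
        rw [h2, mul_zero] at h1; linarith
      rw [this, effSize_rpow_neg_one]
    · rw [effSize_rpow_neg hn]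

/-- The factor `1/K` brings one logarithm. For `r > 1/a` it is the one in the rate; for `r = 1/a`
the sum adds a second one, still below `(ln n)³`; for `r < 1/a` it is covered by the cube in the
effective sample size. -/
lemma exists_variance_rate (ha : 1 < a) (hs : 0 < s) (hr : 1 / a - 2 < r) {B : ℝ} (hB : 1 ≤ B) :
    ∃ V, 0 ≤ V ∧ ∀ᶠ n : ℕ in atTop, ∀ (d : ℕ) (lam m : Fin d → ℝ), PowerLaw a s B lam m →
      1 / (phaseLength n : ℝ) * ∑ j, lam j ^ r * satSq (totalStep a s n * lam j)
        ≤ V * sgdRate a s r n := by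
  have hρ := one_sub_rateExp (r := r) ha hs
  have hq := stepExp_pos ha hs
  have ha0 : 0 < a := by linarith
  have hB0 : 0 < B := by linarith
  have hsat : ∀ {n d : ℕ} {lam : Fin d → ℝ}, (∀ j, 0 < lam j) →
      0 ≤ ∑ j, lam j ^ r * satSq (totalStep a s n * lam j) := fun hl =>
    Finset.sum_nonneg fun j _ => mul_nonneg (Real.rpow_nonneg (hl j).le _) (satSq_nonneg _)
  have ha2 : 0 < a * (2 + r) - 1 := by
    rw [div_sub' ha0.ne', div_lt_iff₀ ha0] at hr; nlinarith
  rcases lt_trichotomy (1 / a) r with hc | hc | hc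
  · have har : 0 < a * r - 1 := by rw [div_lt_iff₀ ha0] at hc; linarith
    refine ⟨4 * (B ^ |r| * (1 + 1 / (a * r - 1))), by positivity, ?_⟩
    filter_upwards [eventually_largePhases] with n hn d lam m hp
    rw [sgdRate, if_pos hc]
    calc _ ≤ 4 * Real.log n / n * (B ^ |r| * (1 + 1 / (a * r - 1))) :=
          mul_le_mul hn.inv_K_le (hp.sum_variance_le_of_gt hB ha0 hc) (hsat (hp.lam_pos hB))
            (by have := hn.log_ge; positivity)
      _ = _ := by ring
  · set c₀ := 1 + 2 ^ (a * (2 + r) - 1) / (a * (2 + r) - 1) with hc₀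
    have hc₀0 : 0 < c₀ := by positivity
    refine ⟨4 * (B ^ |r| * B ^ 2) * (c₀ + stepExp a s / a), by positivity, ?_⟩
    filter_upwards [eventually_largePhases] with n hn d lam m hp
    have hlog := hn.log_ge
    have hn0 := hn.n_pos
    rw [sgdRate, if_neg hc.not_lt, if_pos hc.symm]
    have hΓ : 1 ≤ totalStep a s n := Real.one_le_rpow hn.eff_ge hq.le
    have hlogΓ : Real.log (totalStep a s n) ≤ stepExp a s * Real.log n := by
      rw [totalStep, Real.log_rpow (effSize_pos hn.two_le)]
      exact mul_le_mul_of_nonneg_left (Real.log_le_log (effSize_pos hn.two_le) hn.eff_le) hq.le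
    have h1 : 1 + 1 / a * Real.log (totalStep a s n) + 2 ^ (a * (2 + r) - 1) / (a * (2 + r) - 1)
        ≤ (c₀ + stepExp a s / a) * Real.log n := by
      have h2 : 1 / a * Real.log (totalStep a s n) ≤ stepExp a s / a * Real.log n := by
        calc _ ≤ 1 / a * (stepExp a s * Real.log n) := by gcongr
          _ = _ := by ring
      nlinarith
    calc _ ≤ 4 * Real.log n / n * (B ^ |r| * B ^ 2 * ((c₀ + stepExp a s / a) * Real.log n)) := by
          refine mul_le_mul hn.inv_K_le ((hp.sum_variance_le_of_eq hB ha0 hc.symm hΓ).trans ?_)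
            (hsat (hp.lam_pos hB)) (by positivity)
          gcongr
      _ = 4 * (B ^ |r| * B ^ 2) * (c₀ + stepExp a s / a) * (Real.log n ^ 2 / n) := by ring
      _ ≤ _ := by
          gcongr
          · linarith
          · norm_num
  · have har : 0 < 1 - a * r := by rw [lt_div_iff₀ ha0] at hc; linarith
    have hmin : 0 < min (1 - a * r) 1 := lt_min har one_pos
    set c₀ := 1 / min (1 - a * r) 1 + 2 ^ (a * (2 + r) - 1) / (a * (2 + r) - 1) with hc₀
    have hc₀0 : 0 < c₀ := by positivity
    refine ⟨4 * (B ^ |r| * B ^ 2 * c₀), by positivity, ?_⟩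
    filter_upwards [eventually_largePhases] with n hn d lam m hp
    have hlog := hn.log_ge
    have hn0 := hn.n_pos
    have hE := effSize_pos hn.two_le
    rw [sgdRate, if_neg hc.not_gt, if_neg hc.ne, ← effSize_rpow_neg hn.two_le]
    have hΓ : 1 ≤ totalStep a s n := Real.one_le_rpow hn.eff_ge hq.le
    have e : totalStep a s n ^ (1 / a - r) = effSize n ^ (1 - rateExp a s r) := by
      rw [totalStep, ← Real.rpow_mul hE.le, hρ]
    have h1 : 1 / (phaseLength n : ℝ) ≤ 4 * effSize n ^ (-1 : ℝ) := by
      refine hn.inv_K_le.trans ?_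
      rw [effSize_rpow_neg_one, mul_div_assoc]
      gcongr
      exact le_self_pow₀ (by linarith) (by norm_num)
    calc _ ≤ 4 * effSize n ^ (-1 : ℝ)
          * (B ^ |r| * B ^ 2 * c₀ * effSize n ^ (1 - rateExp a s r)) := by
          refine mul_le_mul h1 ?_ (hsat (hp.lam_pos hB)) (by positivity)
          rw [← e]; exact hp.sum_variance_le_of_lt hB ha0 hc hr hΓ
      _ = 4 * (B ^ |r| * B ^ 2 * c₀) * (effSize n ^ (-1 : ℝ) * effSize n ^ (1 - rateExp a s r)) := by
          ring
      _ = _ := by rw [← Real.rpow_add hE]; congr 2; ring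

/-- The upper bound for given parameters whose feedback is eventually small. -/
lemma upper_bound_of_feedback (ha : 1 < a) (hs : 0 < s) (hr : max (1 / a - 2) (-s) < r)
    {ψ B C c ε ϑ η δ₀ : ℝ} (hψ : 1 ≤ ψ) (hB : 1 ≤ B) (hC : 0 < C)
    (hq2 : stepExp a s < 2) (hε : 0 < ε) (hε1 : ε < 1) (hϑ1 : ϑ ≤ 1)
    (hη : 0 < η) (hηB : η * B ≤ 1) (hδ₀ : 0 < δ₀) (hϑ : stepExp a s - 1 < (1 - ε) * ϑ)
    (hfb : ∀ᶠ n : ℕ in atTop, LargeSample a s ε ϑ η (3 * (r + s) + 11) B n →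
      ∀ (d : ℕ) (lam m : Fin d → ℝ), PowerLaw a s B lam m →
      2 * ψ * 10000000 * ∑ j, feedback (sgdParams a s ε δ₀ n).β (sgdParams a s ε δ₀ n).δ
        (sgdParams a s ε δ₀ n).γ (lam j) ≤ 1 / 2) :
    ∃ K₁ > 0, ∀ᶠ n : ℕ in atTop, ∀ (d : ℕ) (lam m : Fin d → ℝ) (𝒬 : Set (Measure (Vec d))),
      PowerLaw a s B lam m → IsSmoothClass r C c lam 𝒬 → ∀ σ : ℝ, 0 ≤ σ →
        asgdRisk n (diagonal lam) (diagonal m) ψ σ 𝒬 (sgdParams a s ε δ₀ n)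
          ≤ ENNReal.ofReal (K₁ * (1 + σ ^ 2) * sgdRate a s r n) := by
  have hrs : 0 < r + s := by linarith [lt_of_le_of_lt (le_max_right _ _) hr]
  have hr2 := lt_of_le_of_lt (le_max_left _ _) hr
  have hB0 : 0 < B := by linarith
  obtain ⟨V, hV, hvar⟩ := exists_variance_rate ha hs hr2 hB
  set b₀ := B * (1 + 2 * (2 * (r + s)) ^ (r + s)) with hb₀
  have hb₀0 : 0 < b₀ := by positivity
  set v₀ := (40000000 * ψ * B ^ (1 + s) + 4) * (500006 * V) with hv₀
  have hv₀0 : 0 ≤ v₀ := by positivity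
  refine ⟨C * (b₀ + v₀), by positivity, ?_⟩
  filter_upwards [eventually_largeSample (A := 3 * (r + s) + 11) (D := B)
    (stepExp_pos ha hs).le hq2 hε hη hϑ, hfb, hvar, eventually_bias_rate (r := r) ha hs]
    with n hn hfbn hvarn hbias d lam m 𝒬 hp h𝒬 σ hσ
  have hn2 := hn.two_le
  have hstab := hn.stableParams hp (by linarith) hB hε hε1 hϑ1 (by linarith) le_rfl hηB hδ₀
    (hfbn hn d lam m hp)
  have hΓ := totalStep_pos (a := a) (s := s) hn2
  have hrate := sgdRate_pos (a := a) (s := s) (r := r) hn2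
  have hlam := hp.lam_pos hB
  have hK := hn.K_pos
  refine (asgdRisk_le (σ := σ) (W := B ^ (1 + s)) hψ hC.le hstab h𝒬.upper
    (Rb := b₀ * totalStep a s n ^ (-(r + s))) (by positivity) (by positivity)
    (fun j => hn.bias_le hp (by linarith) hB hε le_rfl hrs (by linarith) j) fun j => ?_).trans
    (ENNReal.ofReal_le_ofReal ?_)
  · have h1 := hp.m_lower j
    rw [inv_mul_le_iff₀ hB0] at h1
    have h2 : lam j ^ s ≤ B ^ s := Real.rpow_le_rpow (hlam j).le (hp.lam_le hB (by linarith) j) hs.le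
    have hm := hp.m_pos hB j
    calc lam j = lam j ^ (1 - s) * lam j ^ s := by
          rw [← Real.rpow_add (hlam j)]; simp
      _ ≤ (B * m j) * B ^ s := by
          have := Real.rpow_nonneg (hlam j).le s
          gcongr
      _ = B ^ (1 + s) * m j := by rw [Real.rpow_add hB0, Real.rpow_one]; ring
  · have e : ∑ j, lam j ^ (1 + r) * (500006 / (lam j * phaseLength n)
        * satSq ((sgdParams a s ε δ₀ n).γ * lam j * phaseLength n))
        = 500006 * (1 / (phaseLength n : ℝ)
          * ∑ j, lam j ^ r * satSq (totalStep a s n * lam j)) := by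
      rw [Finset.mul_sum, Finset.mul_sum]
      refine Finset.sum_congr rfl fun j _ => ?_
      have hl := hlam j
      rw [sgdParams_γ hn2, show totalStep a s n / phaseLength n * lam j * phaseLength n
        = totalStep a s n * lam j by field_simp, Real.rpow_add hl, Real.rpow_one]
      field_simp
    rw [e]
    have h1 := hvarn d lam m hp
    have h2 : 0 ≤ σ ^ 2 := sq_nonneg σ
    have h3 : (40000000 * ψ * B ^ (1 + s) + 4 * σ ^ 2) * (500006 * (1 / (phaseLength n : ℝ)
          * ∑ j, lam j ^ r * satSq (totalStep a s n * lam j)))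
        ≤ v₀ * (1 + σ ^ 2) * sgdRate a s r n := by
      calc _ ≤ (40000000 * ψ * B ^ (1 + s) + 4 * σ ^ 2) * (500006 * (V * sgdRate a s r n)) := by
            gcongr
        _ ≤ ((40000000 * ψ * B ^ (1 + s) + 4) * (1 + σ ^ 2)) * (500006 * (V * sgdRate a s r n)) := by
            gcongr
            have : 0 ≤ 40000000 * ψ * B ^ (1 + s) * σ ^ 2 := by positivity
            nlinarith
        _ = _ := by rw [hv₀]; ring
    calc C * (b₀ * totalStep a s n ^ (-(r + s)) + _) ≤ C * (b₀ * sgdRate a s r n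
          + v₀ * (1 + σ ^ 2) * sgdRate a s r n) := by gcongr
      _ ≤ C * (b₀ * (1 + σ ^ 2) * sgdRate a s r n + v₀ * (1 + σ ^ 2) * sgdRate a s r n) := by
          gcongr
          nlinarith
      _ = _ := by ring

/-- The exponents of the momentum parameter and of the interpolation in the feedback bound. -/
lemma exists_exponents (ha : 1 < a) (hs : (a - 1) ^ 2 / (a * (2 * a - 1)) < s) :
    ∃ ε ϑ : ℝ, 0 < ε ∧ ε < 1 ∧ 0 < ϑ ∧ ϑ < 1 - 1 / a ∧ stepExp a s - 1 < (1 - ε) * ϑ := by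
  have hq := stepExp_lt ha hs
  have ha0 : 0 < a := by linarith
  have h1 : 0 < 1 - 1 / a := by rw [sub_pos, div_lt_one ha0]; exact ha
  -- `ϑ` is the midpoint of `t` and `1 - 1/a`, and `ε` is such that `(1 - ε) ϑ = (3 t + (1 - 1/a)) /
  -- 4`, which still exceeds `t`.
  set t := max (stepExp a s - 1) 0 with ht
  have ht0 : 0 ≤ t := le_max_right _ _
  have ht1 : t < 1 - 1 / a := max_lt (by linarith) h1
  have hle : stepExp a s - 1 ≤ t := le_max_left _ _
  have hϑ : 0 < t + (1 - 1 / a) := by linarith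
  refine ⟨((1 - 1 / a) - t) / (2 * (t + (1 - 1 / a))), (t + (1 - 1 / a)) / 2, ?_, ?_, by linarith,
    by linarith, ?_⟩
  · have : 0 < (1 - 1 / a) - t := by linarith
    positivity
  · rw [div_lt_one (by linarith)]; linarith
  · have e : (1 - ((1 - 1 / a) - t) / (2 * (t + (1 - 1 / a)))) * ((t + (1 - 1 / a)) / 2)
        = (3 * t + (1 - 1 / a)) / 4 := by
      generalize 1 - 1 / a = x at *
      field_simp; ring
    rw [e]; linarith

/-- The risk of SGD is bounded by the rate, for suitable parameters. -/
theorem exists_params_upper_bound (ha : 1 < a) (hs : (a - 1) ^ 2 / (a * (2 * a - 1)) < s)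
    (hr : max (1 / a - 2) (-s) < r) {ψ B C c : ℝ} (hψ : 1 ≤ ψ) (hB : 1 ≤ B) (hC : 0 < C) :
    ∃ ε δ₀ ϑ η : ℝ, 0 < ε ∧ ε < 1 ∧ 0 < δ₀ ∧ ϑ ≤ 1 ∧ 0 < η ∧ η * B ≤ 1 ∧
      stepExp a s - 1 < (1 - ε) * ϑ ∧
      ∃ K₁ > 0, ∀ᶠ n : ℕ in atTop, ∀ (d : ℕ) (lam m : Fin d → ℝ) (𝒬 : Set (Measure (Vec d))),
      PowerLaw a s B lam m → IsSmoothClass r C c lam 𝒬 → ∀ σ : ℝ, 0 ≤ σ →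
        asgdRisk n (diagonal lam) (diagonal m) ψ σ 𝒬 (sgdParams a s ε δ₀ n)
          ≤ ENNReal.ofReal (K₁ * (1 + σ ^ 2) * sgdRate a s r n) := by
  obtain ⟨ε, ϑ, hε, hε1, hϑ0, hϑ1, hεϑ⟩ := exists_exponents ha hs
  have hs0 := pos_of_threshold_lt ha hs
  have ha0 : 0 < a := by linarith
  have hB0 : 0 < B := by linarith
  have hψ0 : 0 < ψ := by linarith
  have hq := stepExp_lt ha hs
  have hainv : 0 < 1 / a := by positivity
  -- The total feedback that `StableParams` tolerates: `2 ψ · 10⁷ · η₀ = 1/4 · 2`.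
  set η₀ := 1 / (40000000 * ψ) with hη₀
  have hη₀0 : 0 < η₀ := by positivity
  set Z := 1 + 1 / (a - 1) with hZ
  have hZ0 : 0 < Z := by have : 0 < a - 1 := by linarith
                         positivity
  -- As `∑ λ ≤ B Z`, the capped step uses up half of `η₀`; the other half is left for the
  -- interpolated term and fixes `η`.
  set δ₀ := η₀ / (4 * B * Z) with hδ₀
  have hδ₀0 : 0 < δ₀ := by positivity
  have hb : 1 < a * (1 - ϑ) := by
    have : a * ϑ < a * (1 - 1 / a) := by gcongr
    have h2 : a * (1 - 1 / a) = a - 1 := by field_simp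
    linarith
  set Y := B ^ |1 - ϑ| * (1 + 1 / (a * (1 - ϑ) - 1)) with hY
  have hY0 : 0 < Y := by
    have : 0 < a * (1 - ϑ) - 1 := by linarith
    positivity
  set η := min (1 / B) (η₀ / (2 * (δ₀ ^ (-ϑ) * Y))) with hη
  have hη0 : 0 < η := by positivity
  have hηB : η * B ≤ 1 := by
    have := min_le_left (1 / B) (η₀ / (2 * (δ₀ ^ (-ϑ) * Y)))
    rwa [← hη, le_div_iff₀ hB0] at this
  have hηY : η * (δ₀ ^ (-ϑ) * Y) ≤ η₀ / 2 := by
    have := min_le_right (1 / B) (η₀ / (2 * (δ₀ ^ (-ϑ) * Y)))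
    rw [← hη, le_div_iff₀ (by positivity)] at this
    linarith
  refine ⟨ε, δ₀, ϑ, η, hε, hε1, hδ₀0, by linarith, hη0, hηB, hεϑ,
    upper_bound_of_feedback ha hs0 hr hψ hB hC (by linarith) hε hε1 (by linarith)
    hη0 hηB hδ₀0 hεϑ ?_⟩
  have hsum1 : ∀ (d : ℕ) (lam m : Fin d → ℝ), PowerLaw a s B lam m → ∑ j, lam j ≤ B * Z := by
    intro d lam m hp
    have := hp.sum_rpow_lam_le hB (p := 1) (by linarith)
    simpa [hZ] using this
  have hfin : ∀ {x : ℝ}, x ≤ η₀ → 2 * ψ * 10000000 * x ≤ 1 / 2 := fun {x} hx => by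
    rw [hη₀, le_div_iff₀ (by positivity)] at hx; linarith
  by_cases hv : 1 - 1 / a ≤ s
  -- Without acceleration `γ → 0`, and the feedback is at most `2 γ ∑ λ`.
  · filter_upwards [eventually_step_le (stepExp_le_one ha hv)
      (by positivity : 0 < η₀ / (2 * B * Z))] with n hγ hn d lam m hp
    refine hfin ?_
    have hn2 := hn.two_le
    have hadm := sgdParams_admissible (a := a) (s := s) hε1.le hδ₀0 n
    rw [← sgdParams_γ (ε := ε) (δ₀ := δ₀) hn2] at hγ
    have hγ0 : 0 ≤ (sgdParams a s ε δ₀ n).γ := hadm.2.2.2.2.1.le.trans hadm.2.2.2.2.2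
    have hlam := hp.lam_pos hB
    calc _ ≤ ∑ j, 2 * (sgdParams a s ε δ₀ n).γ * lam j := Finset.sum_le_sum fun j _ =>
          feedback_le_two_mul hadm.2.2.2.2.1.le hadm.2.2.2.2.2 (hlam j).le
      _ = 2 * (sgdParams a s ε δ₀ n).γ * ∑ j, lam j := by rw [Finset.mul_sum]
      _ ≤ 2 * (η₀ / (2 * B * Z)) * (B * Z) := by
          have := hsum1 d lam m hp
          have : 0 ≤ ∑ j, lam j := Finset.sum_nonneg fun j _ => (hlam j).le
          gcongr
      _ = η₀ := by field_simp
  · refine Eventually.of_forall fun n hn d lam m hp => hfin ?_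
    have hn2 := hn.two_le
    have hlam := hp.lam_pos hB
    have hn0 := hn.n_pos
    have hβ0 : (0 : ℝ) < (n : ℝ) ^ (ε - 1) := by positivity
    have hγ0 : 0 < totalStep a s n / phaseLength n :=
      div_pos (totalStep_pos hn2) hn.K_pos
    have hδ : (sgdParams a s ε δ₀ n).δ = min (totalStep a s n / phaseLength n) δ₀ := by
      rw [sgdParams, if_pos hn2, if_neg hv]
    rw [sgdParams_β hn2, sgdParams_γ hn2, hδ]
    calc _ ≤ ∑ j, (totalStep a s n / phaseLength n * ((n : ℝ) ^ (ε - 1)) ^ ϑ * δ₀ ^ (-ϑ)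
            * lam j ^ (1 - ϑ) + 2 * δ₀ * lam j) := Finset.sum_le_sum fun j _ =>
          feedback_min_le hβ0 hγ0 hδ₀0 (hlam j) hϑ0.le (by linarith)
      _ = totalStep a s n / phaseLength n * ((n : ℝ) ^ (ε - 1)) ^ ϑ * δ₀ ^ (-ϑ)
            * ∑ j, lam j ^ (1 - ϑ) + 2 * δ₀ * ∑ j, lam j := by
          rw [Finset.sum_add_distrib, Finset.mul_sum, Finset.mul_sum]
      _ ≤ η * δ₀ ^ (-ϑ) * Y + 2 * δ₀ * (B * Z) := by
          have h1 := hsum1 d lam m hp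
          have h2 := hp.sum_rpow_lam_le hB hb
          have h3 := hn.step_mul
          have h4 : 0 ≤ ∑ j, lam j ^ (1 - ϑ) :=
            Finset.sum_nonneg fun j _ => Real.rpow_nonneg (hlam j).le _
          gcongr
      _ ≤ η₀ / 2 + η₀ / 2 := by
          refine add_le_add (by rwa [mul_assoc]) (le_of_eq ?_)
          rw [hδ₀]; field_simp; norm_num
      _ = η₀ := by ring

end

end CovShift

namespace CovShift

open scoped NNReal

/-! ### Averages over signs -/

/-- The vector with entries `± √lam_i`. -/
noncomputable def signVec {d : ℕ} (lam : Fin d → ℝ) (η : Fin d → Bool) : Vec d :=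
  fun i => (if η i then 1 else -1) * √(lam i)

lemma sum_signs_succ {d : ℕ} (F : (Fin (d + 1) → Bool) → ℝ) :
    ∑ η, F η = ∑ η : Fin d → Bool, (F (Fin.cons true η) + F (Fin.cons false η)) := by
  rw [← (Fin.consEquiv fun _ => Bool).sum_comp, Fintype.sum_prod_type, Fintype.sum_bool,
    ← Finset.sum_add_distrib]
  rfl

lemma signVec_cons {d : ℕ} (lam : Fin (d + 1) → ℝ) (b : Bool) (η : Fin d → Bool) (u : Vec (d + 1)) :
    signVec lam (Fin.cons b η) ⬝ᵥ u = (if b then 1 else -1) * (√(lam 0) * u 0)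
      + signVec (Fin.tail lam) η ⬝ᵥ Fin.tail u := by
  simp [dotProduct, Fin.sum_univ_succ, signVec, Fin.tail]

lemma signVec_sq {d : ℕ} {lam : Fin d → ℝ} (hl : ∀ i, 0 ≤ lam i) (η : Fin d → Bool) (i : Fin d) :
    signVec lam η i ^ 2 = lam i := by
  unfold signVec
  split_ifs <;> simp [Real.sq_sqrt (hl i)]

lemma sum_signVec_mul {d : ℕ} {lam : Fin d → ℝ} (hl : ∀ i, 0 ≤ lam i) (b v : Vec d) :
    ∑ η, (signVec lam η ⬝ᵥ b) * (signVec lam η ⬝ᵥ v) = 2 ^ d * ∑ i, lam i * (b i * v i) := by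
  induction d with
  | zero => simp [dotProduct]
  | succ d ih =>
    have h := ih (lam := Fin.tail lam) (fun i => hl i.succ) (Fin.tail b) (Fin.tail v)
    have h0 := Real.sq_sqrt (hl 0)
    have e : ∀ η : Fin d → Bool,
        (signVec lam (Fin.cons true η) ⬝ᵥ b) * (signVec lam (Fin.cons true η) ⬝ᵥ v)
          + (signVec lam (Fin.cons false η) ⬝ᵥ b) * (signVec lam (Fin.cons false η) ⬝ᵥ v)
        = 2 * ((signVec (Fin.tail lam) η ⬝ᵥ Fin.tail b) * (signVec (Fin.tail lam) η ⬝ᵥ Fin.tail v))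
          + 2 * (lam 0 * (b 0 * v 0)) := by
      intro η
      simp only [signVec_cons, if_true, Bool.false_eq_true, if_false]
      linear_combination 2 * b 0 * v 0 * h0
    rw [sum_signs_succ, Finset.sum_congr rfl fun η _ => e η, Finset.sum_add_distrib,
      ← Finset.mul_sum, h, Finset.sum_const, Fin.sum_univ_succ]
    simp [Fin.tail]
    ring

/-- The fourth moments of a vector of independent signs are dominated by those of a Gaussian one. -/
lemma sum_signVec_sq_mul_sq_le {d : ℕ} {lam : Fin d → ℝ} (hl : ∀ i, 0 ≤ lam i) (b v : Vec d) :
    ∑ η, (signVec lam η ⬝ᵥ b) ^ 2 * (signVec lam η ⬝ᵥ v) ^ 2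
      ≤ 2 ^ d * (3 * (∑ i, lam i * b i ^ 2) * ∑ i, lam i * v i ^ 2) := by
  induction d with
  | zero => simp [dotProduct]
  | succ d ih =>
    have hl' : ∀ i, 0 ≤ Fin.tail lam i := fun i => hl i.succ
    have h := ih hl' (Fin.tail b) (Fin.tail v)
    have hb := sum_signVec_mul hl' (Fin.tail b) (Fin.tail b)
    have hv := sum_signVec_mul hl' (Fin.tail v) (Fin.tail v)
    set X := fun η => signVec (Fin.tail lam) η ⬝ᵥ Fin.tail b with hX
    set Y := fun η => signVec (Fin.tail lam) η ⬝ᵥ Fin.tail v with hY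
    set SB := ∑ i, Fin.tail lam i * Fin.tail b i ^ 2 with hSB
    set SV := ∑ i, Fin.tail lam i * Fin.tail v i ^ 2 with hSV
    simp only [← sq] at hb hv
    have e : ∀ η : Fin d → Bool,
        (signVec lam (Fin.cons true η) ⬝ᵥ b) ^ 2 * (signVec lam (Fin.cons true η) ⬝ᵥ v) ^ 2
          + (signVec lam (Fin.cons false η) ⬝ᵥ b) ^ 2 * (signVec lam (Fin.cons false η) ⬝ᵥ v) ^ 2
        ≤ 2 * (X η ^ 2 * Y η ^ 2) + 6 * (lam 0 * v 0 ^ 2) * X η ^ 2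
          + 6 * (lam 0 * b 0 ^ 2) * Y η ^ 2 + 2 * (lam 0 * b 0 ^ 2) * (lam 0 * v 0 ^ 2) := by
      intro η
      simp only [signVec_cons, if_true, Bool.false_eq_true, if_false]
      have e1 : lam 0 * v 0 ^ 2 = (√(lam 0) * v 0) ^ 2 := by rw [mul_pow, Real.sq_sqrt (hl 0)]
      have e2 : lam 0 * b 0 ^ 2 = (√(lam 0) * b 0) ^ 2 := by rw [mul_pow, Real.sq_sqrt (hl 0)]
      rw [e1, e2]
      change (1 * (√(lam 0) * b 0) + X η) ^ 2 * (1 * (√(lam 0) * v 0) + Y η) ^ 2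
        + (-1 * (√(lam 0) * b 0) + X η) ^ 2 * (-1 * (√(lam 0) * v 0) + Y η) ^ 2 ≤ _
      -- Adding both signs leaves a single term of indefinite sign, eight times the product of the
      -- four quantities, which this square controls.
      nlinarith [sq_nonneg ((√(lam 0) * v 0) * X η - (√(lam 0) * b 0) * Y η)]
    rw [sum_signs_succ]
    refine (Finset.sum_le_sum fun η _ => e η).trans ?_
    rw [Finset.sum_add_distrib, Finset.sum_add_distrib, Finset.sum_add_distrib, ← Finset.mul_sum,
      ← Finset.mul_sum, ← Finset.mul_sum, hb, hv, Fin.sum_univ_succ, Fin.sum_univ_succ]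
    change _ ≤ 2 ^ (d + 1) * (3 * (lam 0 * b 0 ^ 2 + SB) * (lam 0 * v 0 ^ 2 + SV))
    have h1 : ∑ i, X i ^ 2 * Y i ^ 2 ≤ 2 ^ d * (3 * SB * SV) := h
    have h2 : 0 ≤ lam 0 * b 0 ^ 2 := mul_nonneg (hl 0) (sq_nonneg _)
    have h3 : 0 ≤ lam 0 * v 0 ^ 2 := mul_nonneg (hl 0) (sq_nonneg _)
    have hd : (0 : ℝ) < 2 ^ d := by positivity
    rw [← hSB, ← hSV]
    generalize lam 0 * b 0 ^ 2 = p at *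
    generalize lam 0 * v 0 ^ 2 = q at *
    simp only [Finset.sum_const, Finset.card_univ, Fintype.card_fun, Fintype.card_bool,
      Fintype.card_fin, nsmul_eq_mul, Nat.cast_pow, Nat.cast_ofNat]
    rw [pow_succ]
    nlinarith [mul_nonneg (mul_nonneg h2 h3) hd.le]

/-! ### The Rademacher design with Gaussian noise -/

section Gaussian

variable (μ c : ℝ) (v : ℝ≥0)

lemma integrable_sq_sub_gaussianReal : Integrable (fun y => (y - c) ^ 2) (gaussianReal μ v) :=
  ((memLp_id_gaussianReal' 2 (by simp)).sub (memLp_const c)).integrable_sq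

lemma integral_sq_sub_gaussianReal :
    ∫ y, (y - c) ^ 2 ∂(gaussianReal μ v) = v + (μ - c) ^ 2 := by
  have hid : MemLp (fun y : ℝ => y) 2 (gaussianReal μ v) := memLp_id_gaussianReal' 2 (by simp)
  have hI : Integrable (fun y : ℝ => y) (gaussianReal μ v) := hid.integrable (by simp)
  have hsub : Integrable (fun y : ℝ => y - μ) (gaussianReal μ v) := hI.sub (integrable_const _)
  have hvar : ∫ y, (y - μ) ^ 2 ∂(gaussianReal μ v) = v := by
    have := variance_fun_id_gaussianReal (μ := μ) (v := v)
    rw [variance_eq_integral aemeasurable_id', integral_id_gaussianReal] at this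
    exact this
  have e : ∀ y : ℝ, (y - c) ^ 2 = (y - μ) ^ 2 + (2 * (μ - c) * (y - μ) + (μ - c) ^ 2) :=
    fun y => by ring
  have hlin : Integrable (fun y : ℝ => 2 * (μ - c) * (y - μ) + (μ - c) ^ 2) (gaussianReal μ v) :=
    (hsub.const_mul _).add (integrable_const _)
  rw [integral_congr_ae (ae_of_all _ e), integral_add (integrable_sq_sub_gaussianReal μ μ v) hlin, integral_add (hsub.const_mul _)
    (integrable_const _), integral_const_mul, integral_sub hI (integrable_const _), hvar,
    integral_id_gaussianReal]
  simp

end Gaussian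

/-- The law of `(x, ⟨w, x⟩ + noise)` for `x` with independent entries `± √lam_i` and Gaussian noise
of variance `v`. -/
noncomputable def signModel {d : ℕ} (lam : Fin d → ℝ) (v : ℝ≥0) (w : Vec d) : Measure (Sample d) :=
  ((2 : ℝ≥0∞) ^ d)⁻¹ • ∑ η, (gaussianReal (w ⬝ᵥ signVec lam η) v).map fun y => (signVec lam η, y)

section SignModel

variable {d : ℕ} {lam : Fin d → ℝ} {v : ℝ≥0} {w : Vec d}

lemma lintegral_signModel {f : Sample d → ℝ≥0∞} (hf : Measurable f) :
    ∫⁻ z, f z ∂(signModel lam v w) = ((2 : ℝ≥0∞) ^ d)⁻¹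
      * ∑ η, ∫⁻ y, f (signVec lam η, y) ∂(gaussianReal (w ⬝ᵥ signVec lam η) v) := by
  rw [signModel, lintegral_smul_measure, lintegral_finsetSum_measure, smul_eq_mul]
  congr 1
  exact Finset.sum_congr rfl fun η _ => lintegral_map hf (by fun_prop)

instance : IsProbabilityMeasure (signModel lam v w) := by
  refine ⟨?_⟩
  rw [← setLIntegral_one, setLIntegral_univ, lintegral_signModel measurable_const]
  simp only [lintegral_const, measure_univ, Finset.sum_const, Finset.card_univ,
    Fintype.card_fun, Fintype.card_bool, Fintype.card_fin, nsmul_eq_mul, Nat.cast_pow,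
    Nat.cast_ofNat, mul_one]
  exact ENNReal.inv_mul_cancel (by simp) (by simp)

lemma integrable_signModel {f : Sample d → ℝ} (hf : Measurable f)
    (hi : ∀ η, Integrable (fun y => f (signVec lam η, y))
      (gaussianReal (w ⬝ᵥ signVec lam η) v)) : Integrable f (signModel lam v w) := by
  refine Integrable.smul_measure ?_ (by simp)
  rw [integrable_finsetSum_measure]
  exact fun η _ => (integrable_map_measure hf.aestronglyMeasurable (by fun_prop)).2 (hi η)

lemma integral_signModel {f : Sample d → ℝ} (hf : Measurable f)
    (hi : ∀ η, Integrable (fun y => f (signVec lam η, y))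
      (gaussianReal (w ⬝ᵥ signVec lam η) v)) :
    ∫ z, f z ∂(signModel lam v w) = ((2 : ℝ) ^ d)⁻¹
      * ∑ η, ∫ y, f (signVec lam η, y) ∂(gaussianReal (w ⬝ᵥ signVec lam η) v) := by
  rw [signModel, integral_smul_measure, integral_finsetSum_measure]
  · congr 1
    · simp
    · exact Finset.sum_congr rfl fun η _ => integral_map (by fun_prop) hf.aestronglyMeasurable
  · exact fun η _ => (integrable_map_measure hf.aestronglyMeasurable (by fun_prop)).2 (hi η)

lemma integral_signModel_fst {f : Vec d → ℝ} (hf : Measurable f) :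
    ∫ z, f z.1 ∂(signModel lam v w) = ((2 : ℝ) ^ d)⁻¹ * ∑ η, f (signVec lam η) := by
  rw [integral_signModel (f := fun z => f z.1) (hf.comp measurable_fst)
    fun η => integrable_const (f (signVec lam η))]
  simp

lemma measurable_sq_residual (u : Vec d) :
    Measurable fun z : Sample d => (z.2 - u ⬝ᵥ z.1) ^ 2 :=
  (measurable_snd.sub (measurable_sample_dot' u)).pow_const 2

/-- Moments involving a squared residual. -/
lemma integral_sq_residual_mul_signModel (u : Vec d) {f : Vec d → ℝ} (hf : Measurable f) :
    Integrable (fun z : Sample d => (z.2 - u ⬝ᵥ z.1) ^ 2 * f z.1) (signModel lam v w) ∧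
    ∫ z, (z.2 - u ⬝ᵥ z.1) ^ 2 * f z.1 ∂(signModel lam v w) = ((2 : ℝ) ^ d)⁻¹
      * ∑ η, (v + (signVec lam η ⬝ᵥ (w - u)) ^ 2) * f (signVec lam η) := by
  have hm : Measurable fun z : Sample d => (z.2 - u ⬝ᵥ z.1) ^ 2 * f z.1 :=
    (measurable_sq_residual u).mul (hf.comp measurable_fst)
  have hi : ∀ η, Integrable (fun y => (y - u ⬝ᵥ signVec lam η) ^ 2 * f (signVec lam η))
      (gaussianReal (w ⬝ᵥ signVec lam η) v) := fun η =>
    (integrable_sq_sub_gaussianReal _ _ _).mul_const _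
  refine ⟨integrable_signModel hm hi, ?_⟩
  rw [integral_signModel hm hi]
  congr 1
  refine Finset.sum_congr rfl fun η _ => ?_
  change ∫ y, (y - u ⬝ᵥ signVec lam η) ^ 2 * f (signVec lam η) ∂_ = _
  rw [integral_mul_const, integral_sq_sub_gaussianReal, dotProduct_sub,
    dotProduct_comm _ w, dotProduct_comm _ u]

lemma sqRisk_signModel (hl : ∀ i, 0 ≤ lam i) (u : Vec d) :
    sqRisk (signModel lam v w) u = (1 / 2) * (v + ∑ i, lam i * (w i - u i) ^ 2) := by
  have h := (integral_sq_residual_mul_signModel (lam := lam) (v := v) (w := w) u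
    (f := fun _ => 1) measurable_const).2
  have h2 := sum_signVec_mul hl (w - u) (w - u)
  simp only [mul_one, ← sq, Pi.sub_apply] at h h2
  rw [sqRisk, h, Finset.sum_add_distrib, h2]
  simp only [Finset.sum_const, Finset.card_univ, Fintype.card_fun, Fintype.card_bool,
    Fintype.card_fin, nsmul_eq_mul, Nat.cast_pow, Nat.cast_ofNat]
  field_simp

lemma sum_signVec_apply_mul (hl : ∀ i, 0 ≤ lam i) (i j : Fin d) :
    ((2 : ℝ) ^ d)⁻¹ * ∑ η, signVec lam η i * signVec lam η j = diagonal lam i j := by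
  have h := sum_signVec_mul hl (Pi.single i 1) (Pi.single j 1)
  simp only [dotProduct_single, mul_one] at h
  rw [h, ← mul_assoc, inv_mul_cancel₀ (by positivity), one_mul, diagonal_apply]
  rcases eq_or_ne i j with rfl | hij
  · rw [Finset.sum_eq_single i] <;> simp +contextual
  · rw [if_neg hij]
    refine Finset.sum_eq_zero fun k _ => ?_
    simp only [Pi.single_apply]
    split_ifs with h1 h2 <;> simp_all

/-- Both sides are linear in `A`, so a decomposition into rank-one matrices reduces the claim to
mixed fourth moments. The assumption `ψ ≥ 3` enters here. -/
lemma fourthMoment_signModel_le (hl : ∀ i, 0 ≤ lam i) {ψ : ℝ} (hψ : 3 ≤ ψ)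
    {A : Matrix (Fin d) (Fin d) ℝ} (hA : A.PosSemidef) :
    Loewner (fourthMoment (signModel lam v w) A) ((ψ * (diagonal lam * A).trace) • diagonal lam) := by
  have hq : Measurable fun x : Vec d => quadForm A x := by
    simp only [quadForm, dotProduct, mulVec]
    fun_prop
  have hent : ∀ i j, fourthMoment (signModel lam v w) A i j = ((2 : ℝ) ^ d)⁻¹
      * ∑ η, quadForm A (signVec lam η) * (signVec lam η i * signVec lam η j) := fun i j =>
    integral_signModel_fst (f := fun x => quadForm A x * (x i * x j))
      (hq.mul ((measurable_pi_apply i).mul (measurable_pi_apply j)))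
  refine PosSemidef.of_dotProduct_mulVec_nonneg ?_ fun x => ?_
  · ext i j
    simp only [conjTranspose_apply, Matrix.sub_apply, Matrix.smul_apply, star_trivial, hent, diagonal_apply]
    congr 1
    · rcases eq_or_ne i j with rfl | h
      · rfl
      · simp [h, h.symm]
    · simp only [mul_comm (signVec lam _ i)]
  · obtain ⟨k, b, rfl⟩ := posSemidef_iff_eq_sum_vecMulVec.1 hA
    simp only [star_trivial] at *
    have hqf : ∀ y : Vec d, quadForm (∑ i, vecMulVec (b i) (b i)) y = ∑ i, (y ⬝ᵥ b i) ^ 2 := by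
      intro y
      rw [quadForm, sum_mulVec, dotProduct_sum]
      exact Finset.sum_congr rfl fun i _ => quadForm_vecMulVec (b i) y
    have htr : (diagonal lam * ∑ i, vecMulVec (b i) (b i)).trace
        = ∑ i, ∑ j, lam j * b i j ^ 2 := by
      rw [Matrix.mul_sum, trace_sum]
      refine Finset.sum_congr rfl fun i _ => ?_
      simp [trace, diagonal_mul, vecMulVec_apply, sq]
    have h4 : x ⬝ᵥ (fourthMoment (signModel lam v w) (∑ i, vecMulVec (b i) (b i)) *ᵥ x)
        = ((2 : ℝ) ^ d)⁻¹ * ∑ η, (∑ i, (signVec lam η ⬝ᵥ b i) ^ 2) * (signVec lam η ⬝ᵥ x) ^ 2 := by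
      have e : fourthMoment (signModel lam v w) (∑ i, vecMulVec (b i) (b i))
          = ∑ η, (((2 : ℝ) ^ d)⁻¹ * ∑ i, (signVec lam η ⬝ᵥ b i) ^ 2)
            • vecMulVec (signVec lam η) (signVec lam η) := by
        ext i j
        rw [hent, Matrix.sum_apply, Finset.mul_sum]
        refine Finset.sum_congr rfl fun η _ => ?_
        rw [hqf, Matrix.smul_apply, vecMulVec_apply, smul_eq_mul, mul_assoc]
      rw [e, sum_mulVec, dotProduct_sum, Finset.mul_sum]
      refine Finset.sum_congr rfl fun η _ => ?_
      have := quadForm_vecMulVec (signVec lam η) x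
      rw [quadForm] at this
      rw [smul_mulVec, dotProduct_smul, this, smul_eq_mul, dotProduct_comm x, mul_assoc]
    have hS : x ⬝ᵥ (diagonal lam *ᵥ x) = ∑ j, lam j * x j ^ 2 := quadForm_diagonal lam x
    rw [sub_mulVec, dotProduct_sub, smul_mulVec, dotProduct_smul, hS, htr, h4, sub_nonneg,
      smul_eq_mul]
    have hS0 : 0 ≤ ∑ j, lam j * x j ^ 2 := Finset.sum_nonneg fun j _ =>
      mul_nonneg (hl j) (sq_nonneg _)
    have hb0 : ∀ i, 0 ≤ ∑ j, lam j * b i j ^ 2 := fun i => Finset.sum_nonneg fun j _ =>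
      mul_nonneg (hl j) (sq_nonneg _)
    have h5 : ∑ η, (∑ i, (signVec lam η ⬝ᵥ b i) ^ 2) * (signVec lam η ⬝ᵥ x) ^ 2
        ≤ 2 ^ d * (3 * (∑ i, ∑ j, lam j * b i j ^ 2) * ∑ j, lam j * x j ^ 2) := by
      simp only [Finset.sum_mul]
      rw [Finset.sum_comm]
      refine (Finset.sum_le_sum fun i _ => sum_signVec_sq_mul_sq_le hl (b i) x).trans (le_of_eq ?_)
      rw [← Finset.mul_sum, Finset.mul_sum (a := 3), Finset.sum_mul]
    have h6 := Finset.sum_nonneg fun i (_ : i ∈ Finset.univ) => hb0 i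
    rw [inv_mul_le_iff₀ (by positivity)]
    refine h5.trans ?_
    gcongr

lemma ae_signModel {p : Sample d → Prop} (hp : MeasurableSet {z | p z})
    (h : ∀ η y, p (signVec lam η, y)) : ∀ᵐ z ∂(signModel lam v w), p z := by
  rw [ae_iff, ← lintegral_indicator_one (by simpa [Set.compl_ofPred] using hp.compl),
    lintegral_signModel (measurable_one.indicator (by simpa [Set.compl_ofPred] using hp.compl))]
  simp [h]

/-- The Rademacher design is a problem instance. -/
lemma isProblem_signModel (hl : ∀ i, 0 ≤ lam i) {ψ σ : ℝ} (hψ : 3 ≤ ψ)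
    {M : Matrix (Fin d) (Fin d) ℝ} (hw : quadForm M w ≤ 1) {Qx : Measure (Vec d)}
    (hQ : IsProbabilityMeasure Qx) (hQ2 : ∀ i, MemLp (fun x : Vec d => x i) 2 Qx) :
    IsProblem (diagonal lam) M (secondMoment Qx) ψ σ (signModel lam (σ ^ 2).toNNReal w)
      (Qx.map fun x => (x, w ⬝ᵥ x)) w := by
  have hσ : (((σ ^ 2).toNNReal : ℝ≥0) : ℝ) = σ ^ 2 := Real.coe_toNNReal _ (sq_nonneg σ)
  have hdot : Measurable fun x : Vec d => w ⬝ᵥ x := by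
    simp only [dotProduct]; fun_prop
  have hmap : Measurable fun x : Vec d => (x, w ⬝ᵥ x) := measurable_id.prodMk hdot
  have hx : ∀ i, MemLp (fun z : Sample d => z.1 i) 4 (signModel lam (σ ^ 2).toNNReal w) := fun i =>
    MemLp.of_bound (measurable_sample_x i).aestronglyMeasurable (√(lam i))
      (ae_signModel (measurableSet_le (measurable_sample_x i).norm measurable_const) fun η y => by
        simp only [signVec, norm_mul, Real.norm_eq_abs, abs_of_nonneg (Real.sqrt_nonneg _)]
        split_ifs <;> simp)
  have hnoise := fun i j => (integral_sq_residual_mul_signModel (lam := lam)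
    (v := (σ ^ 2).toNNReal) (w := w) w (f := fun x => x i * x j)
    ((measurable_pi_apply i).mul (measurable_pi_apply j)))
  refine
    { prob_source := inferInstance
      prob_target := Measure.isProbabilityMeasure_map hmap.aemeasurable
      source_x := hx
      source_y := ?_
      target_x := fun i => ?_
      target_y := ?_
      source_cov := ?_
      target_cov := ?_
      source_min := fun u => ?_
      target_min := fun u => ?_
      mem_ellipsoid := hw
      fourth_moment := fun A hA => fourthMoment_signModel_le hl hψ hA
      noise_integrable := fun i => by simpa only [sq (_ : ℝ)] using (hnoise i i).1
      noise := ?_ }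
  · rw [memLp_two_iff_integrable_sq measurable_snd.aestronglyMeasurable]
    have := (integral_sq_residual_mul_signModel (lam := lam) (v := (σ ^ 2).toNNReal) (w := w) 0
      (f := fun _ => 1) measurable_const).1
    simpa using this
  · exact (memLp_map_measure_iff (measurable_sample_x i).aestronglyMeasurable hmap.aemeasurable).2
      (hQ2 i)
  · refine (memLp_map_measure_iff measurable_snd.aestronglyMeasurable hmap.aemeasurable).2 ?_
    simp only [Function.comp_def, dotProduct]
    exact memLp_finsetSum _ fun i _ => (hQ2 i).const_mul _
  · ext i j
    rw [secondMoment, of_apply, Measure.fst, integral_map measurable_fst.aemeasurable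
      (by fun_prop), integral_signModel_fst (f := fun x => x i * x j) (by fun_prop),
      sum_signVec_apply_mul hl]
  · rw [Measure.fst, Measure.map_map measurable_fst hmap]
    simp [Function.comp_def]
  · rw [sqRisk_signModel hl, sqRisk_signModel hl]
    have : 0 ≤ ∑ i, lam i * (w i - u i) ^ 2 := Finset.sum_nonneg fun i _ =>
      mul_nonneg (hl i) (sq_nonneg _)
    simp only [sub_self]
    norm_num
    linarith
  -- The target responses carry no noise, so `w` attains risk zero.
  · have h0 : sqRisk (Qx.map fun x => (x, w ⬝ᵥ x)) w = 0 := by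
      rw [sqRisk, integral_map hmap.aemeasurable (measurable_sq_residual w).aestronglyMeasurable]
      simp
    rw [h0, sqRisk]
    have : 0 ≤ ∫ z, (z.2 - u ⬝ᵥ z.1) ^ 2 ∂(Qx.map fun x => (x, w ⬝ᵥ x)) :=
      integral_nonneg fun z => sq_nonneg _
    positivity
  · have : σ ^ 2 • diagonal lam - noiseMatrix (signModel lam (σ ^ 2).toNNReal w) w = 0 := by
      ext i j
      rw [Matrix.sub_apply, Matrix.smul_apply, noiseMatrix, of_apply, (hnoise i j).2, Matrix.zero_apply, sub_eq_zero,
        ← sum_signVec_apply_mul hl i j, hσ, smul_eq_mul]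
      simp only [sub_self, dotProduct_zero]
      norm_num
      rw [← Finset.mul_sum]; ring
    rw [Loewner, this]
    exact PosSemidef.zero

end SignModel

end CovShift

namespace CovShift

open scoped NNReal

/-! ### Le Cam's two point method -/

lemma pi_withDensity {ι X : Type*} [Fintype ι] [MeasurableSpace X] (μ : Measure X)
    [IsProbabilityMeasure μ] {L : X → ℝ≥0∞} (hL : Measurable L)
    [IsProbabilityMeasure (μ.withDensity L)] :
    Measure.pi (fun _ : ι => μ.withDensity L)
      = (Measure.pi fun _ : ι => μ).withDensity fun z => ∏ i, L (z i) := by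
  refine Measure.pi_eq fun S hS => ?_
  rw [withDensity_apply _ (MeasurableSet.univ_pi hS),
    ← lintegral_indicator (MeasurableSet.univ_pi hS)]
  have e : ∀ z : ι → X, (Set.univ.pi S).indicator (fun z => ∏ i, L (z i)) z
      = ∏ i, (S i).indicator L (z i) := by
    intro z
    by_cases h : z ∈ Set.univ.pi S
    · rw [Set.indicator_of_mem h]
      exact Finset.prod_congr rfl fun i _ => by rw [Set.indicator_of_mem (h i trivial)]
    · rw [Set.indicator_of_notMem h]
      simp only [Set.mem_univ_pi, not_forall] at h
      obtain ⟨i, hi⟩ := h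
      exact (Finset.prod_eq_zero (Finset.mem_univ i) (Set.indicator_of_notMem hi _)).symm
  simp only [e]
  have hm : ∀ i, Measurable ((S i).indicator L) := fun i => hL.indicator (hS i)
  rw [lintegral_prod_eq_prod_lintegral_of_indepFun Finset.univ
    (fun i (z : ι → X) => (S i).indicator L (z i)) (iIndepFun_pi fun i => (hm i).aemeasurable)
    fun i => (hm i).comp (measurable_pi_apply i)]
  refine Finset.prod_congr rfl fun i _ => ?_
  rw [(measurePreserving_eval (fun _ : ι => μ) i).lintegral_comp (hm i),
    lintegral_indicator (hS i), withDensity_apply _ (hS i)]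

/-- For `D ≥ 1` this is `(D - 2)² ≥ 0`. It turns a bound for the second moment of a density into a
lower bound for the integral of `min 1 D`. -/
lemma le_min_one_add_sq (D : ℝ≥0∞) : D ≤ min 1 D + D ^ 2 / 4 := by
  rcases le_total D 1 with h | h
  · rw [min_eq_right h]; exact le_self_add
  · rw [min_eq_left h]
    rcases eq_or_ne D ∞ with rfl | hD
    · simp [ENNReal.top_div_of_ne_top]
    · lift D to ℝ≥0 using hD
      have h4 : ((D : ℝ≥0∞) ^ 2 / 4) = ((D ^ 2 / 4 : ℝ≥0) : ℝ≥0∞) := by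
        rw [ENNReal.coe_div (by norm_num)]; simp
      rw [h4]
      norm_cast
      rw [← NNReal.coe_le_coe]
      push_cast
      nlinarith [sq_nonneg ((D : ℝ) - 2)]

/-- A density with second moment at most `2` satisfies `∫ min 1 D ≥ 1/2`. The two laws overlap so
much that losses with sum at least `2 c` everywhere cannot both be small on average. -/
lemma two_point_bound {X : Type*} [MeasurableSpace X] {μ : Measure X} {D : X → ℝ≥0∞}
    (hD : Measurable D) (hprob : IsProbabilityMeasure (μ.withDensity D))
    (hD2 : ∫⁻ z, D z ^ 2 ∂μ ≤ 2) {F G : X → ℝ≥0∞} (hF : Measurable F)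
    {c : ℝ≥0∞} (hFG : ∀ z, 2 * c ≤ F z + G z) :
    c ≤ ∫⁻ z, F z ∂(μ.withDensity D) + ∫⁻ z, G z ∂μ := by
  have h1 : ∫⁻ z, D z ∂μ = 1 := by
    rw [← setLIntegral_univ, ← withDensity_apply _ MeasurableSet.univ, measure_univ]
  have hmin : 1 ≤ ∫⁻ z, min 1 (D z) ∂μ + 2 / 4 := by
    calc (1 : ℝ≥0∞) = ∫⁻ z, D z ∂μ := h1.symm
      _ ≤ ∫⁻ z, (min 1 (D z) + D z ^ 2 / 4) ∂μ := lintegral_mono fun z => le_min_one_add_sq _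
      _ = ∫⁻ z, min 1 (D z) ∂μ + (∫⁻ z, D z ^ 2 ∂μ) / 4 := by
          rw [lintegral_add_left (measurable_const.min hD)]
          simp only [div_eq_mul_inv]
          rw [lintegral_mul_const _ (hD.pow_const 2)]
      _ ≤ _ := by gcongr
  have hhalf : (1 : ℝ≥0∞) / 2 ≤ ∫⁻ z, min 1 (D z) ∂μ := by
    have e : (2 : ℝ≥0∞) / 4 = 1 / 2 := by
      rw [ENNReal.div_eq_div_iff] <;> norm_num
    rw [e, ← tsub_le_iff_right, one_div, ENNReal.one_sub_inv_two] at hmin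
    rwa [one_div]
  rw [lintegral_withDensity_eq_lintegral_mul _ hD hF, ← lintegral_add_left (hD.mul hF)]
  calc c = 1 / 2 * (2 * c) := by
        rw [← mul_assoc]; simp [ENNReal.inv_mul_cancel]
    _ ≤ (∫⁻ z, min 1 (D z) ∂μ) * (2 * c) := by gcongr
    _ = ∫⁻ z, min 1 (D z) * (2 * c) ∂μ := (lintegral_mul_const _ (measurable_const.min hD)).symm
    _ ≤ ∫⁻ z, ((D * F) z + G z) ∂μ := by
        refine lintegral_mono fun z => ?_
        calc min 1 (D z) * (2 * c) ≤ min 1 (D z) * (F z + G z) := by gcongr; exact hFG z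
          _ = min 1 (D z) * F z + min 1 (D z) * G z := mul_add _ _ _
          _ ≤ D z * F z + 1 * G z := by
              gcongr
              · exact min_le_right _ _
              · exact min_le_left _ _
          _ = _ := by rw [one_mul, Pi.mul_apply]

/-! ### Likelihood ratios of the Rademacher design -/

section Likelihood

variable {d : ℕ} {lam : Fin d → ℝ} {v : ℝ≥0}

/-- The likelihood ratio of the models with regressors `w` and `w'`. -/
noncomputable def likelihoodRatio (v : ℝ≥0) (w w' : Vec d) (z : Sample d) : ℝ≥0∞ :=
  ENNReal.ofReal (Real.exp (((w - w') ⬝ᵥ z.1 * (z.2 - w' ⬝ᵥ z.1)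
    - ((w - w') ⬝ᵥ z.1) ^ 2 / 2) / v))

lemma measurable_likelihoodRatio (w w' : Vec d) : Measurable (likelihoodRatio v w w') := by
  have h1 := measurable_sample_dot' (d := d) (w - w')
  have h2 := measurable_sample_dot' (d := d) w'
  unfold likelihoodRatio
  exact ENNReal.measurable_ofReal.comp (Real.measurable_exp.comp
    (((h1.mul (measurable_snd.sub h2)).sub ((h1.pow_const 2).div_const 2)).div_const _))

lemma gaussianPDF_eq_mul (hv : v ≠ 0) (μ μ' y : ℝ) :
    gaussianPDF μ v y = gaussianPDF μ' v y
      * ENNReal.ofReal (Real.exp (((μ - μ') * (y - μ') - (μ - μ') ^ 2 / 2) / v)) := by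
  have hv0 : (v : ℝ) ≠ 0 := by simpa using hv
  rw [gaussianPDF, gaussianPDF, ← ENNReal.ofReal_mul (gaussianPDFReal_nonneg _ _ _),
    gaussianPDFReal, gaussianPDFReal, mul_assoc (√(2 * Real.pi * v))⁻¹, ← Real.exp_add]
  congr 3
  field_simp; ring

lemma signModel_eq_withDensity (hv : v ≠ 0) (w w' : Vec d) :
    signModel lam v w = (signModel lam v w').withDensity (likelihoodRatio v w w') := by
  have hL := measurable_likelihoodRatio (v := v) w w'
  ext S hS
  rw [withDensity_apply _ hS, ← lintegral_indicator hS, ← lintegral_indicator_one hS,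
    lintegral_signModel (measurable_one.indicator hS), lintegral_signModel (hL.indicator hS)]
  congr 1
  refine Finset.sum_congr rfl fun η _ => ?_
  have hy : Measurable fun y : ℝ => (signVec lam η, y) := by fun_prop
  rw [gaussianReal_of_var_ne_zero _ hv, gaussianReal_of_var_ne_zero _ hv,
    lintegral_withDensity_eq_lintegral_mul _ (measurable_gaussianPDF _ _)
      (g := fun y => S.indicator 1 (signVec lam η, y)) ((measurable_one.indicator hS).comp hy),
    lintegral_withDensity_eq_lintegral_mul _ (measurable_gaussianPDF _ _)
      (g := fun y => S.indicator (likelihoodRatio v w w') (signVec lam η, y))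
      ((hL.indicator hS).comp hy)]
  refine lintegral_congr fun y => ?_
  simp only [Pi.mul_apply]
  by_cases h : (signVec lam η, y) ∈ S
  · rw [Set.indicator_of_mem h, Set.indicator_of_mem h, gaussianPDF_eq_mul hv _ (w' ⬝ᵥ signVec lam η),
      likelihoodRatio, sub_dotProduct]
    simp
  · rw [Set.indicator_of_notMem h, Set.indicator_of_notMem h]; simp

/-- Squaring doubles the shift: apart from an explicit factor the result is again a likelihood ratio
and integrates to one. In the sign design this factor is almost surely constant if `w - w'` has a
single nonzero entry. -/
lemma likelihoodRatio_sq (hv : v ≠ 0) (w w' : Vec d) (z : Sample d) :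
    likelihoodRatio v w w' z ^ 2 = ENNReal.ofReal (Real.exp (((w - w') ⬝ᵥ z.1) ^ 2 / v))
      * likelihoodRatio v (w + (w - w')) w' z := by
  have hv0 : (v : ℝ) ≠ 0 := by simpa using hv
  rw [likelihoodRatio, likelihoodRatio, ← ENNReal.ofReal_pow (Real.exp_pos _).le,
    ← ENNReal.ofReal_mul (Real.exp_pos _).le, ← Real.exp_add, ← Real.exp_nat_mul]
  have e : w + (w - w') - w' = (2 : ℝ) • (w - w') := by module
  rw [e, smul_dotProduct, smul_eq_mul]
  congr 2
  push_cast
  field_simp; ring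

/-- Two models whose regressors differ in one coordinate cannot be told apart. -/
lemma lintegral_prod_likelihoodRatio_sq_le {n : ℕ} (hl : ∀ i, 0 ≤ lam i) (hv : v ≠ 0) {w w' : Vec d}
    {j : Fin d} {t : ℝ} (hw : w - w' = Pi.single j t) (ht : n * (t ^ 2 * lam j) ≤ v * Real.log 2) :
    ∫⁻ z : Data n d, (∏ i, likelihoodRatio v w w' (z i)) ^ 2
      ∂(Measure.pi fun _ => signModel lam v w') ≤ 2 := by
  have hv0 : (0 : ℝ) < v := by
    have : (v : ℝ) ≠ 0 := by simpa using hv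
    exact lt_of_le_of_ne v.coe_nonneg this.symm
  have hx : ∀ᵐ z ∂(signModel lam v w'), ((w - w') ⬝ᵥ z.1) ^ 2 = t ^ 2 * lam j := by
    refine ae_signModel (measurableSet_eq_fun ((measurable_sample_dot' _).pow_const 2)
      measurable_const) fun η y => ?_
    rw [hw, single_dotProduct, mul_pow, signVec_sq hl]
  have hpi : ∀ᵐ z ∂(Measure.pi fun _ : Fin n => signModel lam v w'),
      ∀ i, ((w - w') ⬝ᵥ (z i).1) ^ 2 = t ^ 2 * lam j :=
    Filter.eventually_all.2 fun i =>
      (Measure.tendsto_eval_ae_ae (μ := fun _ : Fin n => signModel lam v w') (i := i)).eventually hx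
  have hprob : ∫⁻ z : Data n d, ∏ i, likelihoodRatio v (w + (w - w')) w' (z i)
      ∂(Measure.pi fun _ => signModel lam v w') = 1 := by
    have h : IsProbabilityMeasure ((signModel lam v w').withDensity
        (likelihoodRatio v (w + (w - w')) w')) := by
      rw [← signModel_eq_withDensity hv]; infer_instance
    rw [← setLIntegral_univ, ← withDensity_apply _ MeasurableSet.univ,
      ← pi_withDensity _ (measurable_likelihoodRatio _ _), measure_univ]
  calc _ = ∫⁻ z : Data n d, ENNReal.ofReal (Real.exp (n * (t ^ 2 * lam j) / v))
        * ∏ i, likelihoodRatio v (w + (w - w')) w' (z i)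
        ∂(Measure.pi fun _ => signModel lam v w') := by
        refine lintegral_congr_ae (hpi.mono fun z hz => ?_)
        simp only
        rw [← Finset.prod_pow, Finset.prod_congr rfl fun i _ => likelihoodRatio_sq hv w w' (z i),
          Finset.prod_mul_distrib, Finset.prod_congr rfl fun i _ => by rw [hz i],
          Finset.prod_const, Finset.card_univ, Fintype.card_fin,
          ← ENNReal.ofReal_pow (Real.exp_pos _).le, ← Real.exp_nat_mul, ← mul_div_assoc]
    _ = ENNReal.ofReal (Real.exp (n * (t ^ 2 * lam j) / v)) := by
        have hm : Measurable fun z : Data n d => ∏ i, likelihoodRatio v (w + (w - w')) w' (z i) :=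
          Finset.measurable_prod _ fun i _ =>
            (measurable_likelihoodRatio (w + (w - w')) w').comp (measurable_pi_apply i)
        rw [lintegral_const_mul _ hm, hprob, mul_one]
    _ ≤ ENNReal.ofReal 2 := by
        refine ENNReal.ofReal_le_ofReal ?_
        rw [← Real.exp_log (by norm_num : (0 : ℝ) < 2)]
        refine Real.exp_le_exp.2 ?_
        rw [div_le_iff₀ hv0]; simpa [mul_comm] using ht
    _ = 2 := by simp

/-- The risk of a randomized estimator in the coordinate `j`. -/
noncomputable def coordRisk {n : ℕ} (lam : Fin d → ℝ) (v : ℝ≥0) (κ : Kernel (Data n d) (Vec d))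
    (j : Fin d) (w : Vec d) : ℝ≥0∞ :=
  ∫⁻ z, ∫⁻ u, ENNReal.ofReal ((u j - w j) ^ 2) ∂(κ z) ∂(Measure.pi fun _ => signModel lam v w)

/-- The two regressors are `2 t` apart in coordinate `j`, so the squared losses of any guess add up
to at least `2 t²`, and the two-point bound applies. -/
lemma le_coordRisk_add {n : ℕ} (hl : ∀ i, 0 ≤ lam i) (hv : v ≠ 0) (κ : Kernel (Data n d) (Vec d))
    [IsMarkovKernel κ] {w w' : Vec d} {j : Fin d} {t : ℝ} (hw : w - w' = Pi.single j (2 * t))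
    (ht : n * ((2 * t) ^ 2 * lam j) ≤ v * Real.log 2) :
    ENNReal.ofReal (t ^ 2) ≤ coordRisk lam v κ j w + coordRisk lam v κ j w' := by
  have hD2 := lintegral_prod_likelihoodRatio_sq_le (n := n) hl hv hw ht
  have hm : ∀ c : ℝ, Measurable fun u : Vec d => ENNReal.ofReal ((u j - c) ^ 2) := fun c =>
    ENNReal.measurable_ofReal.comp (((measurable_pi_apply (X := fun _ : Fin d => ℝ) j).sub_const c).pow_const 2)
  have hL := measurable_likelihoodRatio (v := v) w w'
  have hprob1 : IsProbabilityMeasure ((signModel lam v w').withDensity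
      (likelihoodRatio v w w')) := by
    rw [← signModel_eq_withDensity hv]; infer_instance
  have e : (Measure.pi fun _ : Fin n => signModel lam v w)
      = (Measure.pi fun _ : Fin n => signModel lam v w').withDensity
        fun z => ∏ i, likelihoodRatio v w w' (z i) := by
    rw [← pi_withDensity _ hL, ← signModel_eq_withDensity hv]
  have hprob : IsProbabilityMeasure ((Measure.pi fun _ : Fin n => signModel lam v w').withDensity
      fun z => ∏ i, likelihoodRatio v w w' (z i)) := by
    rw [← e]; infer_instance
  rw [coordRisk, coordRisk, e]
  refine two_point_bound (Finset.measurable_prod _ fun i _ => hL.comp (measurable_pi_apply i))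
    hprob hD2 (hm _).lintegral_kernel fun z => ?_
  rw [← lintegral_add_left (hm _)]
  calc 2 * ENNReal.ofReal (t ^ 2) = ∫⁻ _, 2 * ENNReal.ofReal (t ^ 2) ∂(κ z) := by simp
    _ ≤ _ := by
        refine lintegral_mono fun u => ?_
        rw [← ENNReal.ofReal_add (sq_nonneg _) (sq_nonneg _), ← ENNReal.ofReal_ofNat,
          ← ENNReal.ofReal_mul (by norm_num)]
        refine ENNReal.ofReal_le_ofReal ?_
        have := congrFun hw j
        rw [Pi.sub_apply, Pi.single_eq_same] at this
        have h2 : 2 * t ^ 2 = ((u j - w' j) - (u j - w j)) ^ 2 / 2 := by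
          rw [show (u j - w' j) - (u j - w j) = 2 * t by linarith]; ring
        rw [h2]
        nlinarith [sq_nonneg ((u j - w j) + (u j - w' j))]

end Likelihood

end CovShift

namespace CovShift

open scoped NNReal

/-! ### The minimax lower bound -/

section Minimax

variable {d : ℕ} {lam : Fin d → ℝ} {v : ℝ≥0}

/-- The regressor with entries `± h_i`. -/
def signedVec (h : Vec d) (ξ : Fin d → Bool) : Vec d := fun i => if ξ i then h i else -h i

lemma signedVec_sq (h : Vec d) (ξ : Fin d → Bool) (i : Fin d) : signedVec h ξ i ^ 2 = h i ^ 2 := by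
  unfold signedVec; split_ifs <;> ring

lemma sum_signs_flip (j : Fin d) (F : (Fin d → Bool) → ℝ≥0∞) :
    ∑ ξ, F (Function.update ξ j (!ξ j)) = ∑ ξ, F ξ := by
  have hinv : Function.Involutive fun ξ : Fin d → Bool => Function.update ξ j (!ξ j) := by
    intro ξ; simp
  exact (Equiv.sum_comp hinv.toPerm F)

lemma le_coordRisk_flip {n : ℕ} (hl : ∀ i, 0 ≤ lam i) (hv : v ≠ 0) (κ : Kernel (Data n d) (Vec d))
    [IsMarkovKernel κ] {h : Vec d} {j : Fin d} (hh : n * (4 * h j ^ 2 * lam j) ≤ v * Real.log 2)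
    (ξ : Fin d → Bool) :
    ENNReal.ofReal (h j ^ 2) ≤ coordRisk lam v κ j (signedVec h ξ)
      + coordRisk lam v κ j (signedVec h (Function.update ξ j (!ξ j))) := by
  have e : signedVec h ξ - signedVec h (Function.update ξ j (!ξ j))
      = Pi.single j (2 * (if ξ j then h j else -h j)) := by
    ext i
    rcases eq_or_ne i j with rfl | hij
    · simp only [signedVec, Pi.sub_apply, Function.update_self, Pi.single_eq_same]
      cases ξ i <;> simp <;> ring
    · simp [signedVec, hij]
  have e2 : (if ξ j then h j else -h j) ^ 2 = h j ^ 2 := signedVec_sq h ξ j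
  rw [← e2]
  refine le_coordRisk_add hl hv κ e ?_
  rw [mul_pow, e2]
  norm_num
  exact hh

/-- Flipping the sign `j` permutes the vertices, so summing the two-point bounds over all of them
counts each vertex twice. -/
lemma le_sum_coordRisk {n : ℕ} (hl : ∀ i, 0 ≤ lam i) (hv : v ≠ 0) (κ : Kernel (Data n d) (Vec d))
    [IsMarkovKernel κ] {h : Vec d} {j : Fin d} (hh : n * (4 * h j ^ 2 * lam j) ≤ v * Real.log 2) :
    (2 : ℝ≥0∞) ^ d * ENNReal.ofReal (h j ^ 2)
      ≤ 2 * ∑ ξ, coordRisk lam v κ j (signedVec h ξ) := by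
  have h1 := Finset.sum_le_sum fun (ξ : Fin d → Bool) (_ : ξ ∈ Finset.univ) =>
    le_coordRisk_flip hl hv κ hh ξ
  rw [Finset.sum_add_distrib, sum_signs_flip j fun ξ => coordRisk lam v κ j (signedVec h ξ),
    ← two_mul] at h1
  simpa using h1

/-- The lower smoothness bound replaces the target matrix by a diagonal one, which splits the risk
into coordinates. -/
lemma sum_coordRisk_le_worstRisk {n : ℕ} {m : Fin d → ℝ} {ψ σ r c : ℝ} (hψ : 3 ≤ ψ)
    (hl : ∀ i, 0 < lam i) (hc : 0 ≤ c) {𝒬 : Set (Measure (Vec d))} {Q₀ : Measure (Vec d)}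
    (hQ₀ : Q₀ ∈ 𝒬) (hQ : IsProbabilityMeasure Q₀) (hQ2 : ∀ i, MemLp (fun x : Vec d => x i) 2 Q₀)
    (hlow : Loewner (c • diagPow lam r) (similarity lam Q₀)) {w : Vec d}
    (hw : ∑ i, m i * w i ^ 2 ≤ 1) (κ : Kernel (Data n d) (Vec d)) :
    ∑ j, ENNReal.ofReal (c * lam j ^ (1 + r)) * coordRisk lam (σ ^ 2).toNNReal κ j w
      ≤ worstRisk (diagonal lam) (diagonal m) ψ σ 𝒬 fun z => κ z := by
  have hP := isProblem_signModel (σ := σ) (M := diagonal m) (fun i => (hl i).le) hψ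
    (by rwa [quadForm_diagonal]) hQ hQ2
  have hm : ∀ j, Measurable fun u : Vec d => ENNReal.ofReal ((u j - w j) ^ 2) := fun j =>
    ENNReal.measurable_ofReal.comp
      (((measurable_pi_apply (X := fun _ : Fin d => ℝ) j).sub_const _).pow_const 2)
  have hck : ∀ j, 0 ≤ c * lam j ^ (1 + r) := fun j =>
    mul_nonneg hc (Real.rpow_nonneg (hl j).le _)
  calc _ = ∫⁻ z, ∫⁻ u, ∑ j, ENNReal.ofReal (c * lam j ^ (1 + r))
        * ENNReal.ofReal ((u j - w j) ^ 2) ∂(κ z)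
        ∂(Measure.pi fun _ : Fin n => signModel lam (σ ^ 2).toNNReal w) := by
        simp only [coordRisk]
        rw [Finset.sum_congr rfl fun j _ => (lintegral_const_mul _ (hm j).lintegral_kernel).symm,
          ← lintegral_finsetSum _ fun j _ => (hm j).lintegral_kernel.const_mul _]
        refine lintegral_congr fun z => ?_
        rw [lintegral_finsetSum _ fun j _ => (hm j).const_mul _]
        exact Finset.sum_congr rfl fun j _ => (lintegral_const_mul _ (hm j)).symm
    _ ≤ ∫⁻ z, ∫⁻ u, ENNReal.ofReal (quadForm (secondMoment Q₀) (u - w)) ∂(κ z)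
        ∂(Measure.pi fun _ : Fin n => signModel lam (σ ^ 2).toNNReal w) := by
        refine lintegral_mono fun z => lintegral_mono fun u => ?_
        simp only [← ENNReal.ofReal_mul (hck _)]
        rw [← ENNReal.ofReal_sum_of_nonneg fun j _ => mul_nonneg (hck j) (sq_nonneg _)]
        refine ENNReal.ofReal_le_ofReal ?_
        refine le_trans (le_of_eq ?_) (le_quadForm_secondMoment hl hlow (u - w))
        rw [Finset.mul_sum]
        exact Finset.sum_congr rfl fun j _ => by rw [Pi.sub_apply]; ring
    _ ≤ _ := by
        unfold worstRisk
        exact le_iSup₂_of_le Q₀ hQ₀ <| le_iSup₂_of_le _ _ <| le_iSup₂_of_le w hP le_rfl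

/-- Assouad's argument: the worst case dominates the average over the vertices `± h`, which lie in
the ellipsoid together with `h` because only squares enter. On average, each coordinate costs at
least half of `h_j²`. -/
lemma le_minimaxRisk {n : ℕ} {m : Fin d → ℝ} {ψ σ r C c : ℝ} (hψ : 3 ≤ ψ) (hσ : 0 < σ)
    (hl : ∀ i, 0 < lam i) (hc : 0 ≤ c) {𝒬 : Set (Measure (Vec d))}
    (h𝒬 : IsSmoothClass r C c lam 𝒬) {h : Vec d} (hw : ∑ i, m i * h i ^ 2 ≤ 1)
    (hh : ∀ j, n * (4 * h j ^ 2 * lam j) ≤ σ ^ 2 * Real.log 2) :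
    ENNReal.ofReal (c / 2 * ∑ j, lam j ^ (1 + r) * h j ^ 2)
      ≤ minimaxRisk n (diagonal lam) (diagonal m) ψ σ 𝒬 := by
  obtain ⟨Q₀, hQ₀, hlow⟩ := h𝒬.lower
  unfold minimaxRisk
  refine le_iInf₂ fun κ hκ => ?_
  have hσ2 : (((σ ^ 2).toNNReal : ℝ≥0) : ℝ) = σ ^ 2 := Real.coe_toNNReal _ (sq_nonneg σ)
  have hv : (σ ^ 2).toNNReal ≠ 0 := by
    rw [← NNReal.coe_ne_zero, hσ2]; positivity
  have hck : ∀ j, 0 ≤ c * lam j ^ (1 + r) := fun j =>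
    mul_nonneg hc (Real.rpow_nonneg (hl j).le _)
  set R := worstRisk (diagonal lam) (diagonal m) ψ σ 𝒬 fun z => κ z with hR
  have h1 : ∑ ξ : Fin d → Bool, ∑ j, ENNReal.ofReal (c * lam j ^ (1 + r))
      * coordRisk lam (σ ^ 2).toNNReal κ j (signedVec h ξ) ≤ 2 ^ d * R := by
    refine (Finset.sum_le_card_nsmul _ _ R fun ξ _ => sum_coordRisk_le_worstRisk hψ hl hc hQ₀
      (h𝒬.prob _ hQ₀) (h𝒬.sq_integrable _ hQ₀) hlow (by simpa only [signedVec_sq] using hw)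
      κ).trans (le_of_eq ?_)
    simp
  have h2 : (2 : ℝ≥0∞) ^ d * ∑ j, ENNReal.ofReal (c * lam j ^ (1 + r)) * ENNReal.ofReal (h j ^ 2)
      ≤ 2 ^ d * (2 * R) := by
    calc _ = ∑ j, ENNReal.ofReal (c * lam j ^ (1 + r)) * (2 ^ d * ENNReal.ofReal (h j ^ 2)) := by
          rw [Finset.mul_sum]; exact Finset.sum_congr rfl fun j _ => by ring
      _ ≤ ∑ j, ENNReal.ofReal (c * lam j ^ (1 + r))
          * (2 * ∑ ξ, coordRisk lam (σ ^ 2).toNNReal κ j (signedVec h ξ)) := by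
          refine Finset.sum_le_sum fun j _ => ?_
          exact mul_le_mul_right (le_sum_coordRisk (fun i => (hl i).le) hv κ
            (by rw [hσ2]; exact hh j)) _
      _ = 2 * ∑ ξ : Fin d → Bool, ∑ j, ENNReal.ofReal (c * lam j ^ (1 + r))
          * coordRisk lam (σ ^ 2).toNNReal κ j (signedVec h ξ) := by
          rw [Finset.sum_comm, Finset.mul_sum]
          refine Finset.sum_congr rfl fun j _ => ?_
          rw [← Finset.mul_sum]; ring
      _ ≤ 2 * (2 ^ d * R) := by gcongr
      _ = _ := by ring
  have h3 := (ENNReal.mul_le_mul_iff_right (by positivity) (by finiteness)).1 h2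
  have e : ∑ j, ENNReal.ofReal (c * lam j ^ (1 + r)) * ENNReal.ofReal (h j ^ 2)
      = ENNReal.ofReal 2 * ENNReal.ofReal (c / 2 * ∑ j, lam j ^ (1 + r) * h j ^ 2) := by
    rw [← ENNReal.ofReal_mul (by norm_num), ← mul_assoc, Finset.mul_sum,
      ENNReal.ofReal_sum_of_nonneg fun j _ => ?_]
    · refine Finset.sum_congr rfl fun j _ => ?_
      rw [← ENNReal.ofReal_mul (hck j)]
      congr 1; ring
    · have := mul_nonneg (hck j) (sq_nonneg (h j))
      linarith
  rw [e, ENNReal.ofReal_ofNat] at h3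
  exact (ENNReal.mul_le_mul_iff_right (by norm_num) (by norm_num)).1 h3

end Minimax

section Rates

variable {d : ℕ} {a s B : ℝ} {lam m : Fin d → ℝ}

lemma PowerLaw.le_rpow_lam (h : PowerLaw a s B lam m) (hB : 1 ≤ B) (p : ℝ) (i : Fin d) :
    (B ^ |p|)⁻¹ * (((i : ℕ) : ℝ) + 1) ^ (-(a * p)) ≤ lam i ^ p := by
  have h1 := h.rpow_lam_le hB (-p) i
  have h0 : (0 : ℝ) < ((i : ℕ) : ℝ) + 1 := by positivity
  have hl := h.lam_pos hB i
  have hB0 : 0 < B := by linarith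
  rw [abs_neg, Real.rpow_neg hl.le, show -(a * -p) = a * p by ring] at h1
  rw [Real.rpow_neg h0.le, ← mul_inv]
  exact inv_le_of_inv_le₀ (by positivity) h1

lemma sum_fin_ite_lt {k : ℕ} (hk : k ≤ d) (f : ℕ → ℝ) :
    ∑ i : Fin d, (if (i : ℕ) < k then f i else 0) = ∑ i ∈ Finset.range k, f i := by
  rw [Fin.sum_univ_eq_sum_range fun i => if i < k then f i else 0, ← Finset.sum_filter]
  congr 1
  ext i; simp; omega

/-- Entries with `h_i² ≍ 1 / (n λ_i)` are still undetectable. Used in the first `k` coordinates they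
give `∑ m_i h_i² ≲ k^{sa+1} / n`, and the ellipsoid limits `k`. -/
lemma minimaxRisk_ge_sum {n : ℕ} {ψ σ r C c : ℝ} (ha : 0 ≤ a) (hs : 0 ≤ s) (hB : 1 ≤ B) (hψ : 3 ≤ ψ)
    (hσ : 0 < σ) (hc : 0 ≤ c) (hn : 0 < n) (hp : PowerLaw a s B lam m)
    {𝒬 : Set (Measure (Vec d))} (h𝒬 : IsSmoothClass r C c lam 𝒬) {k : ℕ} (hk : k ≤ d)
    (hkn : (k : ℝ) ^ (s * a + 1) ≤ n) :
    ENNReal.ofReal (c / 2 * min (σ ^ 2 * Real.log 2 / 4) (B ^ (1 + s))⁻¹ * (B ^ |r|)⁻¹ / n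
      * ∑ i ∈ Finset.range k, ((i : ℝ) + 1) ^ (-(a * r)))
      ≤ minimaxRisk n (diagonal lam) (diagonal m) ψ σ 𝒬 := by
  have hB0 : 0 < B := by linarith
  have hl := hp.lam_pos hB
  have hn0 : (0 : ℝ) < n := by exact_mod_cast hn
  have hlog2 : 0 < Real.log 2 := Real.log_pos (by norm_num)
  -- The first entry keeps the signs undetectable, the second keeps the vertices inside the
  -- ellipsoid.
  set t := min (σ ^ 2 * Real.log 2 / 4) (B ^ (1 + s))⁻¹ with ht
  have ht0 : 0 < t := by positivity
  have ht1 : t ≤ σ ^ 2 * Real.log 2 / 4 := min_le_left _ _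
  have ht2 : t * B ^ (1 + s) ≤ 1 := by
    have := min_le_right (σ ^ 2 * Real.log 2 / 4) (B ^ (1 + s))⁻¹
    rw [← ht] at this
    calc t * B ^ (1 + s) ≤ (B ^ (1 + s))⁻¹ * B ^ (1 + s) := by gcongr
      _ = 1 := inv_mul_cancel₀ (by positivity)
  set h : Vec d := fun i => if (i : ℕ) < k then √(t / (n * lam i)) else 0 with hh
  have hsq : ∀ i, h i ^ 2 = if (i : ℕ) < k then t / (n * lam i) else 0 := by
    intro i
    rw [hh]
    have := hl i
    simp only
    split_ifs
    · exact Real.sq_sqrt (by positivity)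
    · norm_num
  have hmem : ∑ i, m i * h i ^ 2 ≤ 1 := by
    calc ∑ i, m i * h i ^ 2
        ≤ ∑ i : Fin d, (if (i : ℕ) < k then t * B ^ (1 + s) / n * (k : ℝ) ^ (s * a) else 0) := by
          refine Finset.sum_le_sum fun i _ => ?_
          rw [hsq]
          split_ifs with hi
          · have h1 := hp.m_upper i
            have h2 := hp.rpow_lam_le hB (-s) i
            rw [abs_neg, abs_of_nonneg hs, show -(a * -s) = s * a by ring] at h2
            have h3 : (((i : ℕ) : ℝ) + 1) ^ (s * a) ≤ (k : ℝ) ^ (s * a) := by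
              refine Real.rpow_le_rpow (by positivity) ?_ (by positivity)
              exact_mod_cast hi
            have hli := hl i
            calc m i * (t / (n * lam i)) ≤ B * lam i ^ (1 - s) * (t / (n * lam i)) := by gcongr
              _ = B * (t / n) * lam i ^ (-s) := by
                  rw [Real.rpow_sub hli, Real.rpow_one, Real.rpow_neg hli.le]; field_simp
              _ ≤ B * (t / n) * (B ^ s * (k : ℝ) ^ (s * a)) := by
                  gcongr
                  exact h2.trans (by gcongr)
              _ = _ := by rw [Real.rpow_add hB0, Real.rpow_one]; ring
          · simp
      _ = k * (t * B ^ (1 + s) / n * (k : ℝ) ^ (s * a)) := by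
          rw [sum_fin_ite_lt hk fun _ => t * B ^ (1 + s) / n * (k : ℝ) ^ (s * a)]
          simp
      _ = t * B ^ (1 + s) * ((k : ℝ) ^ (s * a + 1) / n) := by
          rcases Nat.eq_zero_or_pos k with rfl | hk0
          · have : (0 : ℝ) ^ (s * a + 1) = 0 := Real.zero_rpow (by positivity)
            simp [this]
          · have hk1 : (0 : ℝ) < k := by exact_mod_cast hk0
            rw [Real.rpow_add hk1 (s * a) 1, Real.rpow_one]; ring
      _ ≤ 1 * 1 := by
          gcongr
          rwa [div_le_one hn0]
      _ = 1 := one_mul 1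
  refine le_trans (ENNReal.ofReal_le_ofReal ?_) (le_minimaxRisk hψ hσ hl hc h𝒬 hmem fun j => ?_)
  · rw [← sum_fin_ite_lt hk fun i => ((i : ℝ) + 1) ^ (-(a * r)), mul_div_assoc,
      mul_assoc (c / 2), mul_assoc (c / 2)]
    refine mul_le_mul_of_nonneg_left ?_ (by positivity)
    rw [Finset.mul_sum]
    refine Finset.sum_le_sum fun i _ => ?_
    rw [hsq]
    split_ifs with hi
    · have h1 := hp.le_rpow_lam hB r i
      have hli := hl i
      rw [Real.rpow_add hli, Real.rpow_one]
      calc t * ((B ^ |r|)⁻¹ / n) * (((i : ℕ) : ℝ) + 1) ^ (-(a * r))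
          = t / n * ((B ^ |r|)⁻¹ * (((i : ℕ) : ℝ) + 1) ^ (-(a * r))) := by ring
        _ ≤ t / n * lam i ^ r := by gcongr
        _ = _ := by field_simp
    · simp
  · rw [hsq]
    have hli := hl j
    split_ifs
    · calc (n : ℝ) * (4 * (t / (n * lam j)) * lam j) = 4 * t := by field_simp
        _ ≤ _ := by linarith
    · simp; positivity

/-- The upper half of the range suffices: its terms are comparable to the last one, whatever the
sign of `b`. -/
lemma le_sum_rpow_range (b : ℝ) {k : ℕ} (hk : 0 < k) :
    (2 : ℝ) ^ (-(1 + |b|)) * (k : ℝ) ^ (1 - b) ≤ ∑ i ∈ Finset.range k, ((i : ℝ) + 1) ^ (-b) := by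
  have hk0 : (0 : ℝ) < k := by exact_mod_cast hk
  have hterm : ∀ i ∈ Finset.Ico (k / 2) k, (2 : ℝ) ^ (-|b|) * (k : ℝ) ^ (-b)
      ≤ ((i : ℝ) + 1) ^ (-b) := by
    intro i hi
    rw [Finset.mem_Ico] at hi
    have h1 : (i : ℝ) + 1 ≤ k := by exact_mod_cast hi.2
    have h2 : (k : ℝ) / 2 ≤ (i : ℝ) + 1 := by
      rw [div_le_iff₀ (by norm_num)]; norm_cast; omega
    rcases le_total 0 b with h0 | h0
    · rw [abs_of_nonneg h0]
      calc (2 : ℝ) ^ (-b) * (k : ℝ) ^ (-b) ≤ 1 * (k : ℝ) ^ (-b) := by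
            gcongr
            exact Real.rpow_le_one_of_one_le_of_nonpos (by norm_num) (by linarith)
        _ ≤ _ := by
            rw [one_mul]
            exact Real.rpow_le_rpow_of_nonpos (by positivity) h1 (by linarith)
    · rw [abs_of_nonpos h0, neg_neg, show (2 : ℝ) ^ b * (k : ℝ) ^ (-b) = ((k : ℝ) / 2) ^ (-b) by
        rw [Real.div_rpow hk0.le (by norm_num), Real.rpow_neg (by norm_num : (0 : ℝ) ≤ 2)]
        field_simp]
      exact Real.rpow_le_rpow (by positivity) h2 (by linarith)
  have hcard : (k : ℝ) / 2 ≤ ((Finset.Ico (k / 2) k).card : ℝ) := by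
    rw [Nat.card_Ico, div_le_iff₀ (by norm_num)]; norm_cast; omega
  calc (2 : ℝ) ^ (-(1 + |b|)) * (k : ℝ) ^ (1 - b)
      = (k : ℝ) / 2 * ((2 : ℝ) ^ (-|b|) * (k : ℝ) ^ (-b)) := by
        rw [neg_add, Real.rpow_add (by norm_num), sub_eq_add_neg, Real.rpow_add hk0, Real.rpow_one,
          Real.rpow_neg_one]
        ring
    _ ≤ ((Finset.Ico (k / 2) k).card : ℝ) * ((2 : ℝ) ^ (-|b|) * (k : ℝ) ^ (-b)) := by gcongr
    _ ≤ ∑ i ∈ Finset.Ico (k / 2) k, ((i : ℝ) + 1) ^ (-b) := by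
        rw [← nsmul_eq_mul]; exact Finset.card_nsmul_le_sum _ _ _ hterm
    _ ≤ _ := by
        refine Finset.sum_le_sum_of_subset_of_nonneg (fun i hi => ?_) fun i _ _ => by positivity
        rw [Finset.mem_Ico] at hi
        exact Finset.mem_range.2 hi.2

lemma log_le_sum_inv (k : ℕ) : Real.log (k + 1) ≤ ∑ i ∈ Finset.range k, ((i : ℝ) + 1)⁻¹ := by
  have h := log_add_one_le_harmonic k
  rw [harmonic] at h
  push_cast at h
  exact h

theorem exists_minimax_lower_bound {r ψ σ c : ℝ} (ha : 1 < a) (hs : 0 < s) (hB : 1 ≤ B) (hψ : 3 ≤ ψ)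
    (hσ : 0 < σ) (hc : 0 < c) :
    ∃ K₃ > 0, ∀ n : ℕ, 2 ≤ n → ∀ (C : ℝ) (d : ℕ) (lam m : Fin d → ℝ) (𝒬 : Set (Measure (Vec d))),
      (n : ℝ) ^ (1 / (s * a + 1)) ≤ d → PowerLaw a s B lam m → IsSmoothClass r C c lam 𝒬 →
        ENNReal.ofReal (K₃ * minimaxRate a s r n)
          ≤ minimaxRisk n (diagonal lam) (diagonal m) ψ σ 𝒬 := by
  have ha0 : 0 < a := by linarith
  have hB0 : 0 < B := by linarith
  have hlog2 : 0 < Real.log 2 := Real.log_pos (by norm_num)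
  have hsa : 0 < s * a + 1 := by positivity
  set c₁ := c / 2 * min (σ ^ 2 * Real.log 2 / 4) (B ^ (1 + s))⁻¹ * (B ^ |r|)⁻¹ with hc₁
  have hc₁0 : 0 < c₁ := by positivity
  -- The floor is the largest `k` that `minimaxRisk_ge_sum` allows, and the assumption on `d`
  -- provides that many coordinates.
  suffices hsum : ∃ c₂ > 0, ∀ n : ℕ, 2 ≤ n → c₂ * minimaxRate a s r n
      ≤ 1 / n * ∑ i ∈ Finset.range ⌊(n : ℝ) ^ (1 / (s * a + 1))⌋₊, ((i : ℝ) + 1) ^ (-(a * r)) by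
    obtain ⟨c₂, hc₂, hsum⟩ := hsum
    refine ⟨c₁ * c₂, by positivity, fun n hn C d lam m 𝒬 hd hp h𝒬 => ?_⟩
    have hn0 : (0 : ℝ) < n := by positivity
    have hk := Nat.floor_le (by positivity : 0 ≤ (n : ℝ) ^ (1 / (s * a + 1)))
    refine le_trans (ENNReal.ofReal_le_ofReal ?_) (minimaxRisk_ge_sum ha0.le hs.le hB hψ hσ hc.le
      (by omega) hp h𝒬 (k := ⌊(n : ℝ) ^ (1 / (s * a + 1))⌋₊) ?_ ?_)
    · calc c₁ * c₂ * minimaxRate a s r n = c₁ * (c₂ * minimaxRate a s r n) := by ring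
        _ ≤ c₁ * (1 / n * ∑ i ∈ Finset.range ⌊(n : ℝ) ^ (1 / (s * a + 1))⌋₊,
            ((i : ℝ) + 1) ^ (-(a * r))) := mul_le_mul_of_nonneg_left (hsum n hn) hc₁0.le
        _ = _ := by ring
    · exact_mod_cast hk.trans hd
    · refine (Real.rpow_le_rpow (by positivity) hk hsa.le).trans (le_of_eq ?_)
      rw [← Real.rpow_mul hn0.le, one_div, inv_mul_cancel₀ hsa.ne', Real.rpow_one]
  have hk1 : ∀ n : ℕ, 2 ≤ n → 1 ≤ ⌊(n : ℝ) ^ (1 / (s * a + 1))⌋₊ := fun n hn => by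
    refine Nat.le_floor ?_
    rw [Nat.cast_one]
    exact Real.one_le_rpow (by exact_mod_cast (by omega : 1 ≤ n)) (by positivity)
  rcases lt_trichotomy (1 / a) r with hr | hr | hr
  · refine ⟨1, one_pos, fun n hn => ?_⟩
    rw [minimaxRate, if_pos hr, one_mul]
    refine le_mul_of_one_le_right (by positivity) ?_
    have h0 : (0 : ℕ) ∈ Finset.range ⌊(n : ℝ) ^ (1 / (s * a + 1))⌋₊ :=
      Finset.mem_range.2 (hk1 n hn)
    refine le_trans (le_of_eq ?_) (Finset.single_le_sum (f := fun i : ℕ => ((i : ℝ) + 1) ^ (-(a * r)))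
      (fun i _ => by positivity) h0)
    simp
  · refine ⟨1 / (s * a + 1), by positivity, fun n hn => ?_⟩
    have hn0 : (0 : ℝ) < n := by positivity
    have e : -(a * r) = -1 := by rw [← hr]; field_simp
    rw [minimaxRate, if_neg hr.not_lt, if_pos hr.symm, e]
    simp only [Real.rpow_neg_one]
    have h1 := log_le_sum_inv ⌊(n : ℝ) ^ (1 / (s * a + 1))⌋₊
    have h2 : 1 / (s * a + 1) * Real.log n ≤ Real.log (⌊(n : ℝ) ^ (1 / (s * a + 1))⌋₊ + 1) := by
      rw [← Real.log_rpow hn0]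
      exact Real.log_le_log (by positivity) (Nat.lt_floor_add_one _).le
    calc 1 / (s * a + 1) * (Real.log n / n) = 1 / n * (1 / (s * a + 1) * Real.log n) := by ring
      _ ≤ _ := by gcongr; exact h2.trans h1
  · have har : a * r < 1 := by rwa [lt_div_iff₀ ha0, mul_comm] at hr
    refine ⟨(2 : ℝ) ^ (-(1 + |a * r|)) * (2 : ℝ) ^ (-(1 - a * r)), by positivity, fun n hn => ?_⟩
    have hn0 : (0 : ℝ) < n := by positivity
    rw [minimaxRate, if_neg hr.not_gt, if_neg hr.ne]
    have h1 := le_sum_rpow_range (a * r) (hk1 n hn)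
    set N := (n : ℝ) ^ (1 / (s * a + 1)) with hN
    have hN0 : 0 < N := by positivity
    have hhalf : N / 2 ≤ (⌊N⌋₊ : ℝ) := by
      have h2 := Nat.lt_floor_add_one N
      have h3 : (1 : ℝ) ≤ ⌊N⌋₊ := by exact_mod_cast hk1 n hn
      linarith
    have h4 : (2 : ℝ) ^ (-(1 - a * r)) * N ^ (1 - a * r) ≤ (⌊N⌋₊ : ℝ) ^ (1 - a * r) := by
      refine le_trans (le_of_eq ?_) (Real.rpow_le_rpow (by positivity) hhalf (by linarith))
      rw [Real.div_rpow hN0.le (by norm_num), Real.rpow_neg (by norm_num)]; ring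
    have h5 : (1 / (n : ℝ)) ^ rateExp a s r = 1 / n * N ^ (1 - a * r) := by
      have hρ := one_sub_rateExp (r := r) ha hs
      have e : stepExp a s * (1 / a - r) = 1 / (s * a + 1) * (1 - a * r) := by
        unfold stepExp; field_simp
      rw [hN, ← Real.rpow_mul hn0.le, ← e, ← hρ, one_div, Real.inv_rpow hn0.le, Real.rpow_sub hn0,
        Real.rpow_one]
      field_simp
    rw [h5]
    calc _ = 1 / (n : ℝ) * ((2 : ℝ) ^ (-(1 + |a * r|))
          * ((2 : ℝ) ^ (-(1 - a * r)) * N ^ (1 - a * r))) := by ring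
      _ ≤ 1 / (n : ℝ) * ((2 : ℝ) ^ (-(1 + |a * r|)) * (⌊N⌋₊ : ℝ) ^ (1 - a * r)) := by gcongr
      _ ≤ _ := by gcongr

end Rates

end CovShift

namespace CovShift

open scoped NNReal

/-! ### Lower bounds for the error of SGD -/

/-- The expected error of one coordinate after a step, given the error before the step. -/
def meanStep (α β δ γ l : ℝ) (e : ℝ × ℝ) : ℝ × ℝ :=
  ((1 - δ * l) * (α * e.1 + (1 - α) * e.2),
    (β - γ * l) * (α * e.1 + (1 - α) * e.2) + (1 - β) * e.2)

/-- The first component of the error after `k` mean steps, starting with the error `e` at time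
`t`. -/
noncomputable def response (θ : Params) (K : ℕ) (l : ℝ) : ℕ → ℕ → ℝ × ℝ → ℝ
  | 0, _, e => e.1
  | k + 1, t, e =>
    response θ K l k (t + 1) (meanStep θ.α θ.β (θ.δ / 4 ^ (t / K)) (θ.γ / 4 ^ (t / K)) l e)

section Response

variable {θ : Params} {K : ℕ} {l : ℝ}

/-- Linearity separates the response to the mean error from that to the centred gradient, which acts
along `(δ, γ)`. -/
lemma response_sub_mul (k t : ℕ) (e f : ℝ × ℝ) (x : ℝ) :
    response θ K l k t (e.1 - x * f.1, e.2 - x * f.2)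
      = response θ K l k t e - x * response θ K l k t f := by
  induction k generalizing t e f with
  | zero => rfl
  | succ k ih =>
    simp only [response]
    rw [← ih]
    congr 1
    simp only [meanStep, Prod.mk.injEq]
    constructor <;> ring

lemma continuous_response (k t : ℕ) : Continuous (response θ K l k t) := by
  induction k generalizing t with
  | zero => exact continuous_fst
  | succ k ih =>
    refine (ih (t + 1)).comp ?_
    unfold meanStep; fun_prop

end Response

section Gradient

variable {d n : ℕ} {lam : Fin d → ℝ} {v : ℝ≥0} {w : Vec d}

/-- The error of coordinate `j` of the state. -/
def coordErr (w : Vec d) (j : Fin d) (s : Vec d × Vec d) : ℝ × ℝ := (s.1 j - w j, s.2 j - w j)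

lemma measurable_coordErr (w : Vec d) (j : Fin d) : Measurable (coordErr w j) := by
  unfold coordErr
  refine Continuous.measurable ?_
  fun_prop

/-- The last part bounds the variance of the gradient from below by `v λ_j`: the label noise
contributes exactly this, and the random design only adds to it. -/
lemma integral_grad_signModel (hl : ∀ i, 0 ≤ lam i) (u : Vec d) (j : Fin d) :
    Integrable (fun z => grad w u z j) (signModel lam v w) ∧
    Integrable (fun z => grad w u z j ^ 2) (signModel lam v w) ∧
    ∫ z, grad w u z j ∂(signModel lam v w) = lam j * u j ∧
    (lam j * u j) ^ 2 + v * lam j ≤ ∫ z, grad w u z j ^ 2 ∂(signModel lam v w) := by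
  -- Target and ellipsoid are irrelevant here; trivial ones make the moment lemmas for problem
  -- instances available.
  have hQ : ∀ i, MemLp (fun x : Vec d => x i) 2 (Measure.dirac (0 : Vec d)) := fun i =>
    MemLp.of_bound (measurable_pi_apply i).aestronglyMeasurable 0 (by
      rw [ae_dirac_eq]; simp)
  have hP := isProblem_signModel (σ := √v) (w := w) (M := 0) hl le_rfl (by simp [quadForm])
    (Measure.dirac.isProbabilityMeasure (x := (0 : Vec d))) hQ
  rw [Real.sq_sqrt v.coe_nonneg, Real.toNNReal_coe] at hP
  refine ⟨hP.integrable_grad u j, hP.integrable_grad_sq u j, hP.integral_grad u j, ?_⟩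
  have e : ∀ z : Sample d, grad w u z j ^ 2 = (z.2 - (w + u) ⬝ᵥ z.1) ^ 2 * z.1 j ^ 2 := by
    intro z
    rw [grad, add_dotProduct, dotProduct_comm u]; ring
  simp only [e]
  rw [(integral_sq_residual_mul_signModel (w + u) (f := fun x => x j ^ 2)
    ((measurable_pi_apply j).pow_const 2)).2]
  have h2 := sum_signVec_mul hl u u
  simp only [← sq] at h2
  have h3 : ∀ η : Fin d → Bool, (signVec lam η ⬝ᵥ (w - (w + u))) ^ 2 = (signVec lam η ⬝ᵥ u) ^ 2 := by
    intro η
    rw [show w - (w + u) = -u by abel, dotProduct_neg, neg_sq]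
  simp only [signVec_sq hl, h3, ← Finset.sum_mul, Finset.sum_add_distrib, h2]
  simp only [Finset.sum_const, Finset.card_univ, Fintype.card_fun, Fintype.card_bool,
    Fintype.card_fin, nsmul_eq_mul, Nat.cast_pow, Nat.cast_ofNat]
  have h4 : lam j * u j ^ 2 ≤ ∑ i, lam i * u i ^ 2 :=
    Finset.single_le_sum (f := fun i => lam i * u i ^ 2)
      (fun i _ => mul_nonneg (hl i) (sq_nonneg _)) (Finset.mem_univ j)
  have h5 : ((2 : ℝ) ^ d)⁻¹ * ((2 ^ d * v + 2 ^ d * ∑ i, lam i * u i ^ 2) * lam j)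
      = (v + ∑ i, lam i * u i ^ 2) * lam j := by field_simp
  rw [h5]
  nlinarith [hl j, mul_le_mul_of_nonneg_right h4 (hl j)]

lemma coordErr_step (α β δ γ l : ℝ) (w : Vec d) (s : Vec d × Vec d) (z : Sample d) (j : Fin d) :
    coordErr w j (step α β δ γ z s)
      = ((meanStep α β δ γ l (coordErr w j s)).1
          - (grad w (queryErr α w s) z j - l * queryErr α w s j) * (δ, γ).1,
        (meanStep α β δ γ l (coordErr w j s)).2
          - (grad w (queryErr α w s) z j - l * queryErr α w s j) * (δ, γ).2) := by
  rw [coordErr, step_fst_sub, step_snd_sub]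
  simp only [meanStep, coordErr, queryErr, Prod.mk.injEq]
  constructor <;> ring

/-- One step of the noise contributes at least the response to the kick `(δ, γ)`. -/
lemma le_lintegral_response_step (hl : ∀ i, 0 ≤ lam i) (θ : Params) (K k t : ℕ) (j : Fin d)
    (s : Vec d × Vec d) :
    ENNReal.ofReal (response θ K (lam j) (k + 1) t (coordErr w j s) ^ 2 + v * lam j *
        response θ K (lam j) k (t + 1) (θ.δ / 4 ^ (t / K), θ.γ / 4 ^ (t / K)) ^ 2)
      ≤ ∫⁻ z, ENNReal.ofReal (response θ K (lam j) k (t + 1)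
        (coordErr w j (step θ.α θ.β (θ.δ / 4 ^ (t / K)) (θ.γ / 4 ^ (t / K)) z s)) ^ 2)
        ∂(signModel lam v w) := by
  obtain ⟨h1, h2, h3, h4⟩ := integral_grad_signModel (v := v) (w := w) hl (queryErr θ.α w s) j
  set u := queryErr θ.α w s with hu
  set A := response θ K (lam j) (k + 1) t (coordErr w j s) with hA
  set b := response θ K (lam j) k (t + 1) (θ.δ / 4 ^ (t / K), θ.γ / 4 ^ (t / K)) with hb
  have e : ∀ z, response θ K (lam j) k (t + 1)
      (coordErr w j (step θ.α θ.β (θ.δ / 4 ^ (t / K)) (θ.γ / 4 ^ (t / K)) z s)) ^ 2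
      = (A + lam j * u j * b) ^ 2 + ((-2 * (A + lam j * u j * b) * b) * grad w u z j
        + b ^ 2 * grad w u z j ^ 2) := by
    intro z
    rw [coordErr_step _ _ _ _ (lam j), response_sub_mul]
    change (A - (grad w u z j - lam j * u j) * b) ^ 2 = _
    ring
  have h5 : Integrable (fun z => (-2 * (A + lam j * u j * b) * b) * grad w u z j
        + b ^ 2 * grad w u z j ^ 2) (signModel lam v w) := (h1.const_mul _).add (h2.const_mul _)
  rw [← ofReal_integral_eq_lintegral_ofReal]
  · refine ENNReal.ofReal_le_ofReal ?_
    simp only [e]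
    rw [integral_add (integrable_const _) h5, integral_add (h1.const_mul _) (h2.const_mul _),
      integral_const_mul, integral_const_mul, h3, integral_const]
    simp only [probReal_univ, one_smul]
    nlinarith [mul_le_mul_of_nonneg_left h4 (sq_nonneg b)]
  · simp only [e]
    exact (integrable_const _).add h5
  · exact ae_of_all _ fun z => sq_nonneg _

/-- The expected squared error dominates the response to the initial error and to all kicks. -/
lemma le_lintegral_response (hl : ∀ i, 0 ≤ lam i) (θ : Params) (j : Fin d) {N : ℕ} (hN : N ≤ n)
    (t : ℕ) (ht : t ≤ N) :
    ENNReal.ofReal (response θ (phaseLength n) (lam j) N 0 (-w j, -w j) ^ 2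
      + v * lam j * ∑ τ ∈ Finset.range t, response θ (phaseLength n) (lam j) (N - τ - 1) (τ + 1)
        (θ.δ / 4 ^ (τ / phaseLength n), θ.γ / 4 ^ (τ / phaseLength n)) ^ 2)
      ≤ ∫⁻ z : Data n d, ENNReal.ofReal (response θ (phaseLength n) (lam j) (N - t) t
        (coordErr w j (iterate θ z t)) ^ 2) ∂(Measure.pi fun _ => signModel lam v w) := by
  induction t with
  | zero => simp [iterate, coordErr]
  | succ t ih =>
    have hNt : N - t = (N - t - 1) + 1 := by omega
    have hm : ∀ k τ, Measurable fun s : Vec d × Vec d => ENNReal.ofReal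
        (response θ (phaseLength n) (lam j) k τ (coordErr w j s) ^ 2) := fun k τ =>
      ENNReal.measurable_ofReal.comp
        (((continuous_response k τ).measurable.comp (measurable_coordErr w j)).pow_const 2)
    set b := v * lam j * response θ (phaseLength n) (lam j) (N - t - 1) (t + 1)
        (θ.δ / 4 ^ (t / phaseLength n), θ.γ / 4 ^ (t / phaseLength n)) ^ 2 with hb
    have hb0 : 0 ≤ b := mul_nonneg (mul_nonneg v.coe_nonneg (hl j)) (sq_nonneg _)
    rw [← Nat.sub_sub N t 1, lintegral_iterate_succ _ θ (by omega) (fun s => ENNReal.ofReal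
        (response θ (phaseLength n) (lam j) (N - t - 1) (t + 1) (coordErr w j s) ^ 2)) (hm _ _),
      Finset.sum_range_succ, mul_add, ← hb, ← add_assoc]
    calc _ ≤ ENNReal.ofReal (response θ (phaseLength n) (lam j) N 0 (-w j, -w j) ^ 2
          + v * lam j * ∑ τ ∈ Finset.range t, response θ (phaseLength n) (lam j) (N - τ - 1) (τ + 1)
          (θ.δ / 4 ^ (τ / phaseLength n), θ.γ / 4 ^ (τ / phaseLength n)) ^ 2)
          + ENNReal.ofReal b := ENNReal.ofReal_add_le
      _ ≤ ∫⁻ z : Data n d, ENNReal.ofReal (response θ (phaseLength n) (lam j) (N - t) t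
          (coordErr w j (iterate θ z t)) ^ 2) ∂(Measure.pi fun _ => signModel lam v w)
          + ∫⁻ _ : Data n d, ENNReal.ofReal b ∂(Measure.pi fun _ => signModel lam v w) := by
          refine add_le_add (ih (by omega)) (le_of_eq ?_)
          rw [lintegral_const, measure_univ, mul_one]
      _ = ∫⁻ z : Data n d, (ENNReal.ofReal (response θ (phaseLength n) (lam j) (N - t) t
          (coordErr w j (iterate θ z t)) ^ 2) + ENNReal.ofReal b)
          ∂(Measure.pi fun _ => signModel lam v w) :=
          (lintegral_add_right _ measurable_const).symm
      _ ≤ _ := by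
          refine lintegral_mono fun z => ?_
          rw [← ENNReal.ofReal_add (sq_nonneg _) hb0, hNt]
          exact le_lintegral_response_step hl θ (phaseLength n) (N - t - 1) t j (iterate θ z t)

/-- Lower bound of the risk by the error of one coordinate. -/
lemma le_asgdRisk {m : Fin d → ℝ} {ψ σ r C c : ℝ} (hψ : 3 ≤ ψ) (hl : ∀ i, 0 < lam i) (hc : 0 ≤ c)
    {𝒬 : Set (Measure (Vec d))} (h𝒬 : IsSmoothClass r C c lam 𝒬)
    (hw : ∑ i, m i * w i ^ 2 ≤ 1) (θ : Params) (j : Fin d) :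
    ENNReal.ofReal (c * lam j ^ (1 + r) *
      (response θ (phaseLength n) (lam j) (numPhases n * phaseLength n) 0 (-w j, -w j) ^ 2
      + σ ^ 2 * lam j * ∑ τ ∈ Finset.range (numPhases n * phaseLength n),
        response θ (phaseLength n) (lam j) (numPhases n * phaseLength n - τ - 1) (τ + 1)
        (θ.δ / 4 ^ (τ / phaseLength n), θ.γ / 4 ^ (τ / phaseLength n)) ^ 2))
      ≤ asgdRisk n (diagonal lam) (diagonal m) ψ σ 𝒬 θ := by
  obtain ⟨Q₀, hQ₀, hlow⟩ := h𝒬.lower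
  have hP := isProblem_signModel (σ := σ) (M := diagonal m) (fun i => (hl i).le) hψ
    (by rwa [quadForm_diagonal]) (h𝒬.prob _ hQ₀) (h𝒬.sq_integrable _ hQ₀)
  have hσ2 : (((σ ^ 2).toNNReal : ℝ≥0) : ℝ) = σ ^ 2 := Real.coe_toNNReal _ (sq_nonneg σ)
  have hck : 0 ≤ c * lam j ^ (1 + r) := mul_nonneg hc (Real.rpow_nonneg (hl j).le _)
  have h1 := le_lintegral_response (n := n) (w := w) (v := (σ ^ 2).toNNReal) (fun i => (hl i).le) θ j
    (numPhases_mul_phaseLength_le n) _ le_rfl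
  rw [Nat.sub_self, hσ2] at h1
  calc _ ≤ ENNReal.ofReal (c * lam j ^ (1 + r)) * ∫⁻ z : Data n d,
        ENNReal.ofReal ((asgd θ z j - w j) ^ 2)
        ∂(Measure.pi fun _ => signModel lam (σ ^ 2).toNNReal w) := by
        rw [ENNReal.ofReal_mul hck]
        exact mul_le_mul_right h1 _
    _ ≤ ∫⁻ z : Data n d, ENNReal.ofReal (quadForm (secondMoment Q₀) (asgd θ z - w))
        ∂(Measure.pi fun _ => signModel lam (σ ^ 2).toNNReal w) := by
        rw [← lintegral_const_mul' _ _ ENNReal.ofReal_ne_top]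
        refine lintegral_mono fun z => ?_
        rw [← ENNReal.ofReal_mul hck]
        refine ENNReal.ofReal_le_ofReal (le_trans ?_ (le_quadForm_secondMoment hl hlow _))
        rw [mul_assoc]
        refine mul_le_mul_of_nonneg_left ?_ hc
        exact Finset.single_le_sum (f := fun i => lam i ^ (1 + r) * (asgd θ z - w) i ^ 2)
          (fun i _ => mul_nonneg (Real.rpow_nonneg (hl i).le _) (sq_nonneg _)) (Finset.mem_univ j)
    _ = ∫⁻ z : Data n d, ∫⁻ u, ENNReal.ofReal (quadForm (secondMoment Q₀) (u - w))
        ∂(Measure.dirac (asgd θ z)) ∂(Measure.pi fun _ => signModel lam (σ ^ 2).toNNReal w) := by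
        refine lintegral_congr fun z => ?_
        rw [lintegral_dirac' _ (by
          refine ENNReal.measurable_ofReal.comp (Continuous.measurable ?_)
          simp only [quadForm, dotProduct, mulVec]; fun_prop)]
    _ ≤ _ := by
        unfold asgdRisk worstRisk
        exact le_iSup₂_of_le Q₀ hQ₀ <| le_iSup₂_of_le _ _ <| le_iSup₂_of_le w hP le_rfl

end Gradient

/-! ### Estimates of the response -/

section Estimates

variable {θ : Params} {K : ℕ} {l : ℝ}

/-- A geometric series with ratio `1/4` over the phases from `ℓ` on. -/
lemma sum_div_phase_le {K : ℕ} (hK : 0 < K) {γ : ℝ} (hγ : 0 ≤ γ) (ℓ k : ℕ) :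
    ∑ i ∈ Finset.range k, γ / 4 ^ ((ℓ * K + i) / K) ≤ 4 / 3 * (γ / 4 ^ ℓ * K) := by
  have hL : ∀ L : ℕ, ∑ i ∈ Finset.range (L * K), γ / 4 ^ ((ℓ * K + i) / K)
      ≤ 4 / 3 * (γ / 4 ^ ℓ * K) * (1 - (1 / 4) ^ L) := by
    intro L
    induction L with
    | zero => simp
    | succ L ih =>
      have e : ∑ i ∈ Finset.range K, γ / 4 ^ ((ℓ * K + (L * K + i)) / K)
          = γ / 4 ^ ℓ * K * (1 / 4) ^ L := by
        rw [Finset.sum_congr rfl fun i hi => by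
          rw [show ℓ * K + (L * K + i) = i + (ℓ + L) * K by ring, Nat.add_mul_div_right _ _ hK,
            Nat.div_eq_of_lt (Finset.mem_range.1 hi), zero_add], Finset.sum_const,
          Finset.card_range, nsmul_eq_mul, pow_add, one_div, inv_pow]
        field_simp
      rw [show (L + 1) * K = L * K + K by ring, Finset.sum_range_add, e, pow_succ]
      nlinarith
  have h0 : 0 ≤ γ / 4 ^ ℓ * K := by positivity
  refine (Finset.sum_le_sum_of_subset_of_nonneg (t := Finset.range (k * K)) ?_ fun i _ _ => by
    positivity).trans ((hL k).trans ?_)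
  · exact Finset.range_mono (Nat.le_mul_of_pos_right k hK)
  · have : (0 : ℝ) ≤ (1 / 4) ^ k := by positivity
    nlinarith

/-- While the step size is small, the mean flow keeps both errors above a slowly decreasing
threshold. -/
lemma le_response (hβ1 : θ.β ≤ 1) (hα : 0 ≤ θ.α) (hα1 : θ.α ≤ 1) (hδγ : θ.δ ≤ θ.γ)
    (hl : 0 ≤ l) (k t : ℕ) (hγ : ∀ i < k, θ.γ / 4 ^ ((t + i) / K) * l ≤ θ.β)
    (hγ0 : 0 ≤ θ.γ) {e : ℝ × ℝ} {b : ℝ} (hb : 0 ≤ b) (h1 : b ≤ e.1) (h2 : b ≤ e.2) :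
    b * (1 - l * ∑ i ∈ Finset.range k, θ.γ / 4 ^ ((t + i) / K)) ≤ response θ K l k t e := by
  induction k generalizing t e b with
  | zero => simpa [response] using h1
  | succ k ih =>
    have h0 := hγ 0 (Nat.succ_pos k)
    rw [add_zero] at h0
    set γ := θ.γ / 4 ^ (t / K) with hγd
    set δ := θ.δ / 4 ^ (t / K) with hδd
    have hγp : 0 ≤ γ * l := by positivity
    have hδγ' : δ ≤ γ := by rw [hδd, hγd]; gcongr
    have hδl : δ * l ≤ γ * l := by gcongr
    set u := θ.α * e.1 + (1 - θ.α) * e.2 with hu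
    have hub : b ≤ u := by nlinarith
    have hstep := ih (t + 1) (e := meanStep θ.α θ.β δ γ l e) (b := b * (1 - γ * l))
      (fun i hi => by
        have := hγ (i + 1) (by omega)
        rwa [show t + (i + 1) = t + 1 + i by ring] at this)
      (mul_nonneg hb (by linarith)) (by
        change _ ≤ (1 - δ * l) * u
        nlinarith) (by
        change _ ≤ (θ.β - γ * l) * u + (1 - θ.β) * e.2
        nlinarith)
    rw [response]
    refine le_trans ?_ hstep
    rw [Finset.sum_range_succ', add_zero, ← hγd]
    have e1 : ∀ i, θ.γ / 4 ^ ((t + (i + 1)) / K) = θ.γ / 4 ^ ((t + 1 + i) / K) := fun i => by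
      rw [show t + (i + 1) = t + 1 + i by ring]
    simp only [e1]
    have h3 : 0 ≤ ∑ i ∈ Finset.range k, θ.γ / 4 ^ ((t + 1 + i) / K) :=
      Finset.sum_nonneg fun i _ => by positivity
    nlinarith [mul_nonneg (mul_nonneg hb hγp) (mul_nonneg hl h3)]

/-- The response to a kick: the two errors are averaged in the long run. -/
lemma kick_le_response (hβ : 0 < θ.β) (hβ1 : θ.β ≤ 1) (hα : θ.α = 1 / (1 + θ.β)) (hδ0 : 0 ≤ θ.δ)
    (hδγ : θ.δ ≤ θ.γ) (hl : 0 ≤ l) (k t : ℕ) (hγ : ∀ i < k, θ.γ / 4 ^ ((t + i) / K) * l ≤ θ.β)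
    {e : ℝ × ℝ} {b D : ℝ} (h1 : 0 ≤ e.1) (h2 : 0 ≤ e.2) (h1b : e.1 ≤ b) (h2b : e.2 ≤ b)
    (hD : e.2 - e.1 ≤ D) (hD0 : 0 ≤ D) :
    e.1 + e.2 - 2 * b * l * ∑ i ∈ Finset.range k, θ.γ / 4 ^ ((t + i) / K) - (1 - θ.β) ^ k * D
      ≤ 2 * response θ K l k t e := by
  induction k generalizing t e D with
  | zero =>
    simp only [Finset.range_zero, Finset.sum_empty, mul_zero, sub_zero, pow_zero, one_mul, response]
    linarith
  | succ k ih =>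
    have h0 := hγ 0 (Nat.succ_pos k)
    rw [add_zero] at h0
    have hγ0 : 0 ≤ θ.γ := hδ0.trans hδγ
    set γ := θ.γ / 4 ^ (t / K) with hγd
    set δ := θ.δ / 4 ^ (t / K) with hδd
    have hγp : 0 ≤ γ * l := by positivity
    have hδp : 0 ≤ δ * l := by positivity
    have hδγ' : δ ≤ γ := by rw [hδd, hγd]; gcongr
    have hδl : δ * l ≤ γ * l := by gcongr
    set u := θ.α * e.1 + (1 - θ.α) * e.2 with hu
    have hue : (1 + θ.β) * u = e.1 + θ.β * e.2 := by
      rw [hu, hα]; field_simp; ring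
    have hu0 : 0 ≤ u := by nlinarith
    have hub : u ≤ b := by nlinarith
    have hqu : (1 + θ.β) * (e.2 - u) = e.2 - e.1 := by linarith
    have hquD : e.2 - u ≤ D := by
      by_contra hcon
      push Not at hcon
      nlinarith
    -- `D` bounds the gap between the two errors. A step shrinks it by `1 - β`, up to a term whose
    -- sign is favourable because `δ ≤ γ`.
    have hstep := ih (t + 1) (e := meanStep θ.α θ.β δ γ l e) (D := (1 - θ.β) * D)
      (fun i hi => by
        have := hγ (i + 1) (by omega)
        rwa [show t + (i + 1) = t + 1 + i by ring] at this)
      (by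
        change 0 ≤ (1 - δ * l) * u
        exact mul_nonneg (by linarith) hu0)
      (by
        change 0 ≤ (θ.β - γ * l) * u + (1 - θ.β) * e.2
        have := mul_nonneg (sub_nonneg.2 h0) hu0
        have := mul_nonneg (sub_nonneg.2 hβ1) h2
        linarith)
      (by
        change (1 - δ * l) * u ≤ b
        nlinarith [mul_nonneg hδp hu0])
      (by
        change (θ.β - γ * l) * u + (1 - θ.β) * e.2 ≤ b
        nlinarith [mul_nonneg hγp hu0, mul_le_mul_of_nonneg_left hub hβ.le,
          mul_le_mul_of_nonneg_left h2b (sub_nonneg.2 hβ1)])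
      (by
        change (θ.β - γ * l) * u + (1 - θ.β) * e.2 - (1 - δ * l) * u ≤ _
        nlinarith [mul_nonneg (sub_nonneg.2 hδl) hu0,
          mul_le_mul_of_nonneg_left hquD (sub_nonneg.2 hβ1)])
      (mul_nonneg (sub_nonneg.2 hβ1) hD0)
    rw [response]
    refine le_trans ?_ hstep
    rw [Finset.sum_range_succ', add_zero, ← hγd]
    have e1 : ∀ i, θ.γ / 4 ^ ((t + (i + 1)) / K) = θ.γ / 4 ^ ((t + 1 + i) / K) := fun i => by
      rw [show t + (i + 1) = t + 1 + i by ring]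
    simp only [e1]
    -- For `α = 1 / (1 + β)` the averaging preserves the sum of the two errors; only the gradients
    -- reduce it.
    have e2 : (meanStep θ.α θ.β δ γ l e).1 + (meanStep θ.α θ.β δ γ l e).2
        = e.1 + e.2 - (δ * l + γ * l) * u := by
      change (1 - δ * l) * u + ((θ.β - γ * l) * u + (1 - θ.β) * e.2) = _
      linear_combination hue
    rw [e2, pow_succ]
    nlinarith [mul_le_mul_of_nonneg_left hub hγp, mul_nonneg (sub_nonneg.2 hδl) hu0]

end Estimates

end CovShift

/-! ### The lower bound for SGD with the chosen parameters -/

namespace CovShift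

open Filter

section

variable {a s r ε ϑ η A D δ₀ B ψ σ C c : ℝ} {n d : ℕ} {lam m : Fin d → ℝ}

/-- The bias of a coordinate whose total step size is small. -/
lemma LargeSample.le_response_sq (h : LargeSample a s ε ϑ η 2 D n) (hε1 : ε ≤ 1) (hδ₀ : 0 < δ₀)
    {l b : ℝ} (hl : 0 < l) (hlΓ : totalStep a s n * l ≤ 1 / 2) (hb : 0 ≤ b) :
    b ^ 2 / 9 ≤ response (sgdParams a s ε δ₀ n) (phaseLength n) l
      (numPhases n * phaseLength n) 0 (b, b) ^ 2 := by
  have hn2 := h.two_le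
  obtain ⟨hα, hα1, hβ, hβ1, hδ, hδγ⟩ := sgdParams_admissible (a := a) (s := s) hε1 hδ₀ n
  have hK := h.K_pos
  have hγ := sgdParams_γ (a := a) (s := s) (ε := ε) (δ₀ := δ₀) hn2
  have hwarm := h.warm
  have hlog := h.log_ge
  rw [← sgdParams_β (a := a) (s := s) (δ₀ := δ₀) hn2] at hwarm
  set θ := sgdParams a s ε δ₀ n
  have hγ0 : 0 ≤ θ.γ := hδ.le.trans hδγ
  have hγl : θ.γ * l ≤ θ.β := by
    have h1 : θ.γ * l * phaseLength n ≤ θ.β * phaseLength n := by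
      have e : θ.γ * l * phaseLength n = totalStep a s n * l := by rw [hγ]; field_simp
      rw [e]; linarith
    exact le_of_mul_le_mul_right h1 hK
  have h1 := le_response (K := phaseLength n) (l := l) hβ1 hα hα1 hδγ hl.le
    (numPhases n * phaseLength n) 0 (e := (b, b)) (b := b) (fun i _ => by
      refine le_trans ?_ hγl
      gcongr
      exact div_le_self hγ0 (one_le_pow₀ (by norm_num))) hγ0 hb le_rfl le_rfl
  have h2 := sum_div_phase_le (phaseLength_pos hn2) hγ0 0 (numPhases n * phaseLength n)
  simp only [zero_mul, pow_zero, div_one] at h2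
  have e2 : l * (4 / 3 * (θ.γ * phaseLength n)) = 4 / 3 * (totalStep a s n * l) := by
    rw [hγ]; field_simp
  -- The mean flow removes at most `4/3 · 1/2 = 2/3` of the initial error.
  have h3 : l * ∑ i ∈ Finset.range (numPhases n * phaseLength n), θ.γ / 4 ^ ((0 + i) / phaseLength n)
      ≤ 2 / 3 := (mul_le_mul_of_nonneg_left h2 hl.le).trans (by rw [e2]; linarith)
  have h4 : b / 3 ≤ response θ (phaseLength n) l (numPhases n * phaseLength n) 0 (b, b) :=
    le_trans (by nlinarith) h1
  calc b ^ 2 / 9 = (b / 3) ^ 2 := by ring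
    _ ≤ _ := by gcongr

/-- The variance caused by the noise of one late phase. -/
lemma LargeSample.le_sum_response_sq (h : LargeSample a s ε ϑ η 2 D n) (hε1 : ε ≤ 1)
    (hδ₀ : 0 < δ₀) {l : ℝ} (hl : 0 < l) (hlΓ : 1 ≤ 64 * (totalStep a s n * l)) (hlD : 1024 * l ≤ D) :
    1 / (2000000 * l * phaseLength n) ≤ l * ∑ τ ∈ Finset.range (numPhases n * phaseLength n),
      response (sgdParams a s ε δ₀ n) (phaseLength n) l (numPhases n * phaseLength n - τ - 1) (τ + 1)
        ((sgdParams a s ε δ₀ n).δ / 4 ^ (τ / phaseLength n),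
          (sgdParams a s ε δ₀ n).γ / 4 ^ (τ / phaseLength n)) ^ 2 := by
  have hn2 := h.two_le
  obtain ⟨hα, hα1, hβ, hβ1, hδ, hδγ⟩ := sgdParams_admissible (a := a) (s := s) hε1 hδ₀ n
  have hK := h.K_pos
  have hKn := phaseLength_pos hn2
  have hLn := numPhases_pos hn2
  have hγ := sgdParams_γ (a := a) (s := s) (ε := ε) (δ₀ := δ₀) hn2
  have hαe := sgdParams_α (a := a) (s := s) (ε := ε) (δ₀ := δ₀) hn2
  have hwarm := h.warm
  have hlog := h.log_ge
  have hΓ := totalStep_pos (a := a) (s := s) hn2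
  rw [← sgdParams_β (a := a) (s := s) (δ₀ := δ₀) hn2] at hwarm
  set θ := sgdParams a s ε δ₀ n with hθ
  set K := phaseLength n with hKd
  set L := numPhases n with hLd
  have hγ0 : 0 < θ.γ := hδ.trans_le hδγ
  have hβK : 16 ≤ θ.β * K := by linarith
  have hβ0 : 0 < θ.β := by
    by_contra hcon
    have := mul_nonpos_of_nonpos_of_nonneg (not_lt.1 hcon) hK.le
    linarith
  -- This selects the phase `q` with `γ_q l K` between `1/256` and `1/64`: large enough for its
  -- noise to have the final order, small enough for this noise not to be forgotten afterwards.
  obtain ⟨p, hp1, hp2⟩ := exists_nat_pow_near hlΓ (by norm_num : (1 : ℝ) < 4)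
  set q := p + 1 with hq
  have hq1 : (4 : ℝ) ^ q ≤ 256 * (totalStep a s n * l) := by rw [hq, pow_succ]; linarith
  -- A whole phase has to follow, in which the two errors can average.
  have hqL : q + 2 ≤ L := by
    have h1 : (4 : ℝ) ^ (q + 1) ≤ 4 ^ (L - 1) := by
      refine le_trans ?_ (h.total_le.trans h.four_pow)
      rw [pow_succ]
      calc (4 : ℝ) ^ q * 4 ≤ 1024 * l * totalStep a s n := by linarith
        _ ≤ D * totalStep a s n := by gcongr
    have h2 := (pow_le_pow_iff_right₀ (by norm_num : (1 : ℝ) < 4)).1 h1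
    omega
  set g := θ.γ / 4 ^ q with hg
  have hg0 : 0 < g := by positivity
  have hx : g * l * K = totalStep a s n * l / 4 ^ q := by rw [hg, hγ]; field_simp
  have hx1 : g * l * K ≤ 1 / 64 := by
    rw [hx, div_le_iff₀ (by positivity)]; linarith
  have hx2 : 1 / 256 ≤ g * l * K := by
    rw [hx, le_div_iff₀ (by positivity)]; linarith
  have hgl : g * l ≤ θ.β := by
    refine le_of_mul_le_mul_right ?_ hK
    linarith
  have hkick : ∀ τ ∈ Finset.Ico (q * K) (q * K + K), g ^ 2 / 16 ≤
      response θ K l (L * K - τ - 1) (τ + 1) (θ.δ / 4 ^ (τ / K), θ.γ / 4 ^ (τ / K)) ^ 2 := by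
    intro τ hτ
    rw [Finset.mem_Ico] at hτ
    have hτq : τ / K = q := Nat.div_eq_of_lt_le hτ.1 (by rw [Nat.succ_mul]; exact hτ.2)
    have hk : K ≤ L * K - τ - 1 := by
      have h1 : (q + 2) * K ≤ L * K := Nat.mul_le_mul_right K hqL
      have h2 : (q + 2) * K = q * K + K + K := by ring
      omega
    set k := L * K - τ - 1 with hkd
    have hle : ∀ i, θ.γ / 4 ^ ((τ + 1 + i) / K) ≤ θ.γ / 4 ^ ((q * K + i) / K) := fun i => by
      gcongr
      · norm_num
      · omega
    have hgle : ∀ i, θ.γ / 4 ^ ((q * K + i) / K) ≤ g := fun i => by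
      rw [hg, mul_comm q K, Nat.mul_add_div hKn]
      gcongr
      · norm_num
      · exact Nat.le_add_right _ _
    rw [hτq]
    have hδg : θ.δ / 4 ^ q ≤ g := by rw [hg]; gcongr
    have hδg0 : 0 ≤ θ.δ / 4 ^ q := by positivity
    have h1 := kick_le_response (K := K) hβ0 hβ1 hαe hδ.le hδγ hl.le k (τ + 1)
      (fun i _ => le_trans (mul_le_mul_of_nonneg_right ((hle i).trans (hgle i)) hl.le) hgl)
      (e := (θ.δ / 4 ^ q, g)) (b := g) (D := g) hδg0 hg0.le hδg le_rfl
      (by simp only; linarith) hg0.le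
    have h2 : ∑ i ∈ Finset.range k, θ.γ / 4 ^ ((τ + 1 + i) / K) ≤ 4 / 3 * (g * K) :=
      (Finset.sum_le_sum fun i _ => hle i).trans (sum_div_phase_le hKn hγ0.le q k)
    have h3 : (1 - θ.β) ^ k ≤ 1 / 4 := by
      calc (1 - θ.β) ^ k ≤ (1 - θ.β) ^ K :=
            pow_le_pow_of_le_one (by linarith) (by linarith) hk
        _ ≤ Real.exp (-θ.β) ^ K := by
            gcongr
            linarith [Real.add_one_le_exp (-θ.β)]
        _ = Real.exp (-(θ.β * K)) := by rw [← Real.exp_nat_mul]; congr 1; ring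
        _ ≤ 1 / 4 := by
            rw [Real.exp_neg, one_div]
            refine inv_anti₀ (by norm_num) ?_
            linarith [Real.add_one_le_exp (θ.β * K)]
    have h4 : 2 * g * l * ∑ i ∈ Finset.range k, θ.γ / 4 ^ ((τ + 1 + i) / K) ≤ g * (1 / 24) := by
      calc _ ≤ 2 * g * l * (4 / 3 * (g * K)) := by gcongr
        _ = g * (8 / 3 * (g * l * K)) := by ring
        _ ≤ g * (1 / 24) := by gcongr; linarith
    -- Twice the response is at least `g (1 - 1/24 - 1/4)`, hence more than `g / 2`.
    have h5 : g / 4 ≤ response θ K l k (τ + 1) (θ.δ / 4 ^ q, g) := by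
      have := mul_le_mul_of_nonneg_right h3 hg0.le
      simp only at h1
      linarith
    calc g ^ 2 / 16 = (g / 4) ^ 2 := by ring
      _ ≤ _ := by gcongr
  have hsub : Finset.Ico (q * K) (q * K + K) ⊆ Finset.range (L * K) := by
    intro τ hτ
    rw [Finset.mem_Ico] at hτ
    have h1 : (q + 2) * K ≤ L * K := Nat.mul_le_mul_right K hqL
    have h2 : (q + 2) * K = q * K + K + K := by ring
    exact Finset.mem_range.2 (by omega)
  have hsum : K * (g ^ 2 / 16) ≤ ∑ τ ∈ Finset.range (L * K),
      response θ K l (L * K - τ - 1) (τ + 1) (θ.δ / 4 ^ (τ / K), θ.γ / 4 ^ (τ / K)) ^ 2 := by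
    have h1 := Finset.card_nsmul_le_sum _ _ _ hkick
    rw [Nat.card_Ico, Nat.add_sub_cancel_left, nsmul_eq_mul] at h1
    exact h1.trans (Finset.sum_le_sum_of_subset_of_nonneg hsub fun _ _ _ => sq_nonneg _)
  refine le_trans ?_ (mul_le_mul_of_nonneg_left hsum hl.le)
  have e : l * (K * (g ^ 2 / 16)) = (g * l * K) ^ 2 / (16 * l * K) := by field_simp
  rw [e, div_le_div_iff₀ (by positivity) (by positivity)]
  have : (1 / 256 : ℝ) ^ 2 ≤ (g * l * K) ^ 2 := by gcongr
  nlinarith [mul_pos hl hK]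

lemma sgdRate_eq_of_le (ha : 1 < a) (hs : 0 < s) (hr : ¬1 / a < r) (hn : 2 ≤ n) :
    sgdRate a s r n = totalStep a s n ^ (-(r + s)) := by
  rw [totalStep_rpow_neg hn, sgdRate, if_neg hr]
  split_ifs with hr2
  · have h1 := one_sub_rateExp (r := r) ha hs
    have h2 : 1 / a - r = 0 := by rw [hr2, sub_self]
    have : rateExp a s r = 1 := by rw [h2, mul_zero] at h1; linarith
    rw [this, effSize_rpow_neg_one]
  · rw [effSize_rpow_neg hn]

/-- A single coordinate with `λ ≍ 1/Γ`, just too small to be learned, with the regressor on the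
boundary of the ellipsoid in this direction. The role of `hΓ` is to place its index below `d`. -/
lemma LargeSample.bias_lower_bound (h : LargeSample a s ε ϑ η 2 D n) (hε1 : ε ≤ 1) (hδ₀ : 0 < δ₀)
    (ha : 1 < a) (hs : 0 < s) (hrs : 0 < r + s) (hB : 1 ≤ B) (hψ : 3 ≤ ψ) (hc : 0 < c)
    (hΓ : 2 * B * totalStep a s n < (n : ℝ) ^ stepExp a s)
    (hd : (n : ℝ) ^ (1 / (s * a + 1)) ≤ d) (hp : PowerLaw a s B lam m)
    {𝒬 : Set (Measure (Vec d))} (h𝒬 : IsSmoothClass r C c lam 𝒬) :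
    ENNReal.ofReal (c / (9 * B) * (B⁻¹ * (2 : ℝ) ^ (-a) / (2 * B)) ^ (r + s)
        * totalStep a s n ^ (-(r + s)))
      ≤ asgdRisk n (diagonal lam) (diagonal m) ψ σ 𝒬 (sgdParams a s ε δ₀ n) := by
  have hn0 := h.n_pos
  have ha0 : 0 < a := by linarith
  have hB0 : 0 < B := by linarith
  have hΓ0 := totalStep_pos (a := a) (s := s) h.two_le
  have hΓ1 : 1 ≤ totalStep a s n := Real.one_le_rpow h.eff_ge (stepExp_pos ha hs).le
  have hlam := hp.lam_pos hB
  -- `B x^{-a} = 1 / (2 Γ)`. As indices count from zero, the coordinate `⌊x⌋` has the eigenvalue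
  -- bound at `⌊x⌋ + 1 ≥ x`.
  set x := (2 * B * totalStep a s n) ^ (1 / a) with hx
  have hx1 : 1 ≤ x := Real.one_le_rpow (by nlinarith) (by positivity)
  have hxa : x ^ a = 2 * B * totalStep a s n := by
    rw [hx, ← Real.rpow_mul (by positivity), one_div, inv_mul_cancel₀ ha0.ne', Real.rpow_one]
  have hxd : x < d := by
    refine lt_of_lt_of_le ?_ hd
    have e : (n : ℝ) ^ (1 / (s * a + 1)) = ((n : ℝ) ^ stepExp a s) ^ (1 / a) := by
      rw [← Real.rpow_mul hn0.le]; congr 1; unfold stepExp; field_simp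
    rw [e]
    exact Real.rpow_lt_rpow (by positivity) hΓ (by positivity)
  have hkd : ⌊x⌋₊ < d := (Nat.floor_lt (by linarith)).2 hxd
  set k : Fin d := ⟨⌊x⌋₊, hkd⟩ with hk
  have hkx : x ≤ ((k : ℕ) : ℝ) + 1 := (Nat.lt_floor_add_one x).le
  have hkx2 : ((k : ℕ) : ℝ) + 1 ≤ 2 * x := by
    have : (⌊x⌋₊ : ℝ) ≤ x := Nat.floor_le (by linarith)
    change (⌊x⌋₊ : ℝ) + 1 ≤ 2 * x
    linarith
  have hl := hlam k
  have hup : lam k ≤ 1 / (2 * totalStep a s n) := by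
    calc lam k ≤ B * (((k : ℕ) : ℝ) + 1) ^ (-a) := hp.lam_upper k
      _ ≤ B * x ^ (-a) := by
          have := Real.rpow_le_rpow_of_nonpos (by linarith : 0 < x) hkx (by linarith : -a ≤ 0)
          gcongr
      _ = _ := by rw [Real.rpow_neg (by linarith), hxa]; field_simp
  have hlow : B⁻¹ * (2 : ℝ) ^ (-a) / (2 * B) * (totalStep a s n)⁻¹ ≤ lam k := by
    calc B⁻¹ * (2 : ℝ) ^ (-a) / (2 * B) * (totalStep a s n)⁻¹ = B⁻¹ * (2 * x) ^ (-a) := by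
          rw [Real.mul_rpow (by norm_num) (by linarith), Real.rpow_neg (by linarith : 0 ≤ x), hxa]
          field_simp
      _ ≤ B⁻¹ * (((k : ℕ) : ℝ) + 1) ^ (-a) := by
          have := Real.rpow_le_rpow_of_nonpos (by positivity : 0 < ((k : ℕ) : ℝ) + 1) hkx2
            (by linarith : -a ≤ 0)
          gcongr
      _ ≤ lam k := hp.lam_lower k
  have hm := hp.m_pos hB k
  set b := 1 / √(m k) with hb
  have hb2 : b ^ 2 = 1 / m k := by rw [hb, div_pow, Real.sq_sqrt hm.le, one_pow]
  -- The iteration starts at zero, so the entry `-b` makes the initial error the nonnegative number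
  -- `b`.
  have hw : ∑ i, m i * (Pi.single k (-b) : Vec d) i ^ 2 ≤ 1 := by
    rw [Finset.sum_eq_single k]
    · rw [Pi.single_eq_same, neg_sq, hb2]; field_simp; rfl
    · intro i _ hik
      rw [Pi.single_eq_of_ne hik]; ring
    · simp
  refine le_trans (ENNReal.ofReal_le_ofReal ?_)
    (le_asgdRisk (σ := σ) hψ hlam hc.le h𝒬 hw (sgdParams a s ε δ₀ n) k)
  rw [Pi.single_eq_same, neg_neg]
  have hresp := h.le_response_sq (δ₀ := δ₀) hε1 hδ₀ hl (b := b) (by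
    have h1 := mul_le_mul_of_nonneg_left hup hΓ0.le
    have e : totalStep a s n * (1 / (2 * totalStep a s n)) = 1 / 2 := by field_simp
    linarith) (by positivity)
  have hsum : 0 ≤ σ ^ 2 * lam k * ∑ τ ∈ Finset.range (numPhases n * phaseLength n),
      response (sgdParams a s ε δ₀ n) (phaseLength n) (lam k)
        (numPhases n * phaseLength n - τ - 1) (τ + 1)
        ((sgdParams a s ε δ₀ n).δ / 4 ^ (τ / phaseLength n),
          (sgdParams a s ε δ₀ n).γ / 4 ^ (τ / phaseLength n)) ^ 2 :=
    mul_nonneg (mul_nonneg (sq_nonneg _) hl.le) (Finset.sum_nonneg fun _ _ => sq_nonneg _)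
  have hmk := hp.m_upper k
  have hpow : (B⁻¹ * (2 : ℝ) ^ (-a) / (2 * B)) ^ (r + s) * totalStep a s n ^ (-(r + s))
      ≤ lam k ^ (r + s) := by
    rw [Real.rpow_neg hΓ0.le, ← Real.inv_rpow hΓ0.le, ← Real.mul_rpow (by positivity) (by positivity)]
    exact Real.rpow_le_rpow (by positivity) hlow hrs.le
  calc _ = c / (9 * B) * ((B⁻¹ * (2 : ℝ) ^ (-a) / (2 * B)) ^ (r + s)
        * totalStep a s n ^ (-(r + s))) := by ring
    _ ≤ c / (9 * B) * lam k ^ (r + s) := by gcongr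
    _ = c * lam k ^ (1 + r) * (1 / (B * lam k ^ (1 - s)) / 9) := by
        rw [show r + s = (1 + r) - (1 - s) by ring, Real.rpow_sub hl]; field_simp
    _ ≤ c * lam k ^ (1 + r) * (b ^ 2 / 9) := by rw [hb2]; gcongr
    _ ≤ _ := by gcongr; linarith

/-- The first coordinate suffices, with `w = 0`: the noise of one phase leaves an error of order
`1/K`. -/
lemma LargeSample.variance_lower_bound (h : LargeSample a s ε ϑ η 2 (1024 * B) n) (hε1 : ε ≤ 1)
    (hδ₀ : 0 < δ₀) (ha : 1 < a) (hB : 1 ≤ B) (hψ : 3 ≤ ψ) (hc : 0 < c)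
    (hΓ : B ≤ totalStep a s n) (hd : 0 < d) (hp : PowerLaw a s B lam m)
    {𝒬 : Set (Measure (Vec d))} (h𝒬 : IsSmoothClass r C c lam 𝒬) :
    ENNReal.ofReal (c * (B ^ |r|)⁻¹ * σ ^ 2 / 4000000 * (Real.log n / n))
      ≤ asgdRisk n (diagonal lam) (diagonal m) ψ σ 𝒬 (sgdParams a s ε δ₀ n) := by
  have hB0 : 0 < B := by linarith
  have hn0 := h.n_pos
  have hK := h.K_pos
  have hlog := h.log_ge
  have hlam := hp.lam_pos hB
  set k : Fin d := ⟨0, hd⟩ with hk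
  have hl := hlam k
  have h1 : B⁻¹ ≤ lam k := by simpa [hk] using hp.lam_lower k
  have h2 : (B ^ |r|)⁻¹ ≤ lam k ^ r := by simpa [hk] using hp.le_rpow_lam hB r k
  have hvar := h.le_sum_response_sq (δ₀ := δ₀) hε1 hδ₀ hl (by
    have : 1 ≤ totalStep a s n * lam k := by
      calc (1 : ℝ) = B * B⁻¹ := (mul_inv_cancel₀ hB0.ne').symm
        _ ≤ _ := by
            have := hB0.le.trans hΓ
            gcongr
    linarith) (by have := hp.lam_le hB (by linarith) k; linarith)
  refine le_trans (ENNReal.ofReal_le_ofReal ?_)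
    (le_asgdRisk (σ := σ) (w := 0) hψ hlam hc.le h𝒬 (by simp) (sgdParams a s ε δ₀ n) k)
  have hKinv : Real.log n / n ≤ 2 * (1 / phaseLength n) := by
    have := h.K_le
    rw [le_div_iff₀ (by linarith)] at this
    rw [mul_one_div, div_le_div_iff₀ hn0 hK]
    linarith
  calc c * (B ^ |r|)⁻¹ * σ ^ 2 / 4000000 * (Real.log n / n)
      ≤ c * lam k ^ r * σ ^ 2 / 4000000 * (2 * (1 / phaseLength n)) := by gcongr
    _ = c * lam k ^ (1 + r) * (σ ^ 2 * (1 / (2000000 * lam k * phaseLength n))) := by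
        rw [Real.rpow_add hl, Real.rpow_one]; field_simp; ring
    _ ≤ c * lam k ^ (1 + r) * (σ ^ 2 * (lam k * _)) := by gcongr
    _ ≤ _ := by
        rw [← mul_assoc (σ ^ 2)]
        gcongr
        exact le_add_of_nonneg_left (sq_nonneg _)

/-- For `r > 1/a` the noise of one phase decides, otherwise the bias. In the second case the
logarithms in the step size matter: they push `Γ` below any fixed multiple of `n^{a/(sa+1)}`, so the
critical coordinate exists for every admitted `d`. -/
theorem exists_sgd_lower_bound (ha : 1 < a) (hs : 0 < s) (hrs : 0 < r + s) (hB : 1 ≤ B)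
    (hψ : 3 ≤ ψ) (hσ : 0 < σ) (hc : 0 < c) (hq2 : stepExp a s < 2) (hε : 0 < ε) (hε1 : ε < 1)
    (hδ₀ : 0 < δ₀) (hϑ : stepExp a s - 1 < (1 - ε) * ϑ) :
    ∃ K₂ > 0, ∀ᶠ n : ℕ in atTop, ∀ (C : ℝ) (d : ℕ) (lam m : Fin d → ℝ) (𝒬 : Set (Measure (Vec d))),
      (n : ℝ) ^ (1 / (s * a + 1)) ≤ d → PowerLaw a s B lam m → IsSmoothClass r C c lam 𝒬 →
        ENNReal.ofReal (K₂ * (1 + σ ^ 2) * sgdRate a s r n)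
          ≤ asgdRisk n (diagonal lam) (diagonal m) ψ σ 𝒬 (sgdParams a s ε δ₀ n) := by
  have hq := stepExp_pos ha hs
  have hB0 : 0 < B := by linarith
  have hlarge := eventually_largeSample (A := 2) (D := 1024 * B) hq.le hq2 hε one_pos hϑ
  by_cases hr : 1 / a < r
  -- As `σ` is fixed, `1 + σ²` can be divided out of the constant.
  · refine ⟨c * (B ^ |r|)⁻¹ * σ ^ 2 / 4000000 / (1 + σ ^ 2), by positivity, ?_⟩
    filter_upwards [hlarge, eventually_log_pow_le 3 1 (by norm_num : (0 : ℝ) < 1 / 2),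
      eventually_log_pow_le 0 B (by positivity : 0 < stepExp a s / 2)]
      with n hn h3 hBn C d lam m 𝒬 hd hp h𝒬
    have hn0 := hn.n_pos
    have hlog := hn.log_ge
    have hd0 : 0 < d := by
      have : (0 : ℝ) < d := lt_of_lt_of_le (by positivity) hd
      exact_mod_cast this
    have hΓ : B ≤ totalStep a s n := by
      rw [pow_zero, mul_one] at hBn
      have hge : (n : ℝ) ^ (1 / 2 : ℝ) ≤ effSize n := by
        rw [effSize, le_div_iff₀ (by positivity)]
        calc (n : ℝ) ^ (1 / 2 : ℝ) * Real.log n ^ 3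
            ≤ (n : ℝ) ^ (1 / 2 : ℝ) * (n : ℝ) ^ (1 / 2 : ℝ) := by gcongr; linarith
          _ = n := by rw [← Real.rpow_add hn0]; norm_num
      calc B ≤ (n : ℝ) ^ (stepExp a s / 2) := hBn
        _ = ((n : ℝ) ^ (1 / 2 : ℝ)) ^ stepExp a s := by
            rw [← Real.rpow_mul hn0.le]; congr 1; ring
        _ ≤ _ := Real.rpow_le_rpow (by positivity) hge hq.le
    refine le_trans (le_of_eq ?_) (hn.variance_lower_bound (σ := σ) hε1.le hδ₀ ha hB hψ hc hΓ hd0 hp h𝒬)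
    rw [sgdRate, if_pos hr, div_mul_cancel₀ _ (by positivity)]
  · refine ⟨c / (9 * B) * (B⁻¹ * (2 : ℝ) ^ (-a) / (2 * B)) ^ (r + s) / (1 + σ ^ 2), by positivity, ?_⟩
    filter_upwards [hlarge, eventually_log_ge ((2 * B + 1) ^ (1 / stepExp a s))]
      with n hn hBn C d lam m 𝒬 hd hp h𝒬
    have hn0 := hn.n_pos
    have hlog := hn.log_ge
    have hΓ : 2 * B * totalStep a s n < (n : ℝ) ^ stepExp a s := by
      have h1 : 2 * B < (Real.log n ^ 3) ^ stepExp a s := by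
        calc 2 * B < 2 * B + 1 := by linarith
          _ = ((2 * B + 1) ^ (1 / stepExp a s)) ^ stepExp a s := by
              rw [← Real.rpow_mul (by positivity), one_div, inv_mul_cancel₀ hq.ne', Real.rpow_one]
          _ ≤ (Real.log n ^ 3) ^ stepExp a s := by
              refine Real.rpow_le_rpow (by positivity) (hBn.trans ?_) hq.le
              exact le_self_pow₀ (by linarith) (by norm_num)
      rw [totalStep, effSize, Real.div_rpow hn0.le (by positivity), ← mul_div_assoc,
        div_lt_iff₀ (by positivity), mul_comm]
      gcongr
    refine le_trans (le_of_eq ?_)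
      (hn.bias_lower_bound (σ := σ) hε1.le hδ₀ ha hs hrs hB hψ hc hΓ hd hp h𝒬)
    rw [sgdRate_eq_of_le ha hs hr hn.two_le, div_mul_cancel₀ _ (by positivity)]

/-- SGD loses at most a factor `(ln n)³` against the minimax rate. -/
lemma sgdRate_le (ha : 1 < a) (hs : 0 < s) (hn : 1 ≤ Real.log n) :
    sgdRate a s r n ≤ Real.log n ^ 3 * minimaxRate a s r n := by
  have hn0 : (0 : ℝ) ≤ n := by positivity
  unfold sgdRate minimaxRate
  split_ifs with h1 h2
  · rw [mul_one_div]
    gcongr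
    exact le_self_pow₀ hn (by norm_num)
  · rw [mul_div_assoc']
    gcongr
    exact le_mul_of_one_le_right (by positivity) hn
  · rw [mul_comm]
    gcongr
    rw [← Real.rpow_natCast]
    -- In this case `rateExp a s r ≤ 1`, so three logarithms are enough.
    refine Real.rpow_le_rpow_of_exponent_le hn ?_
    have h3 := one_sub_rateExp (r := r) ha hs
    have h4 := stepExp_pos ha hs
    have h5 : 0 ≤ 1 / a - r := by linarith
    push_cast
    nlinarith

end

end CovShift

theorem theorem5 (a s r ψ B C c : ℝ) (ha : 1 < a)
    (hs : (a - 1) ^ 2 / (a * (2 * a - 1)) < s) (hr : max (1 / a - 2) (-s) < r)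
    (hψ : 1 ≤ ψ) (hB : 1 ≤ B) (hC : 0 < C) (hc : 0 < c) :
    ∃ θ : ℕ → Params,
      (∀ n, (θ n).Admissible) ∧
      -- vanilla SGD in the region `s ≥ 1 - 1/a`
      (1 - 1 / a ≤ s → ∀ n, (θ n).Vanilla) ∧
      -- upper bound of the worst-case risk, in every dimension
      (∃ K₁ > 0, ∃ N : ℕ, ∀ n ≥ N, ∀ (d : ℕ) (lam m : Fin d → ℝ) (𝒬 : Set (Measure (Vec d))),
        PowerLaw a s B lam m → IsSmoothClass r C c lam 𝒬 → ∀ σ : ℝ, 0 ≤ σ →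
          asgdRisk n (diagonal lam) (diagonal m) ψ σ 𝒬 (θ n)
            ≤ ENNReal.ofReal (K₁ * (1 + σ ^ 2) * sgdRate a s r n)) ∧
      -- matching lower bound of the worst-case risk, minimax lower bound, optimality
      (3 ≤ ψ → ∀ σ : ℝ, 0 < σ → ∃ K₂ > 0, ∃ K₃ > 0, ∃ K₄ > 0, ∃ N : ℕ, ∀ n ≥ N,
        ∀ (d : ℕ) (lam m : Fin d → ℝ) (𝒬 : Set (Measure (Vec d))),
        (n : ℝ) ^ (1 / (s * a + 1)) ≤ d →
        PowerLaw a s B lam m → IsSmoothClass r C c lam 𝒬 →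
          ENNReal.ofReal (K₂ * (1 + σ ^ 2) * sgdRate a s r n)
              ≤ asgdRisk n (diagonal lam) (diagonal m) ψ σ 𝒬 (θ n) ∧
          ENNReal.ofReal (K₃ * minimaxRate a s r n)
              ≤ minimaxRisk n (diagonal lam) (diagonal m) ψ σ 𝒬 ∧
          asgdRisk n (diagonal lam) (diagonal m) ψ σ 𝒬 (θ n)
              ≤ ENNReal.ofReal (K₄ * Real.log n ^ 3) *
                minimaxRisk n (diagonal lam) (diagonal m) ψ σ 𝒬) := by
  have hs0 := pos_of_threshold_lt ha hs
  have hrs : 0 < r + s := by linarith [lt_of_le_of_lt (le_max_right _ _) hr]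
  have hq2 : stepExp a s < 2 := by
    have h1 := stepExp_lt ha hs
    have h2 : 0 < 1 / a := by positivity
    linarith
  -- The exponents are exposed because the lower bound concerns the same parameters.
  obtain ⟨ε, δ₀, ϑ, η, hε, hε1, hδ₀, -, -, -, hϑ, K₁, hK₁, hup⟩ :=
    exists_params_upper_bound (c := c) ha hs hr hψ hB hC
  refine ⟨sgdParams a s ε δ₀, sgdParams_admissible hε1.le hδ₀, fun h n => sgdParams_vanilla h n,
    ⟨K₁, hK₁, Filter.eventually_atTop.1 hup⟩, fun hψ3 σ hσ => ?_⟩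
  obtain ⟨K₂, hK₂, hlow⟩ := exists_sgd_lower_bound ha hs0 hrs hB hψ3 hσ hc hq2 hε hε1 hδ₀ hϑ
  obtain ⟨K₃, hK₃, hmin⟩ := exists_minimax_lower_bound (r := r) ha hs0 hB hψ3 hσ hc
  -- The last constant is the upper bound divided by the minimax lower bound; the ratio of the rates
  -- is at most `(ln n)³`.
  refine ⟨K₂, hK₂, K₃, hK₃, K₁ * (1 + σ ^ 2) / K₃, by positivity, ?_⟩
  obtain ⟨N, hN⟩ := Filter.eventually_atTop.1 (hup.and (hlow.and
    ((eventually_log_ge 1).and (Filter.eventually_ge_atTop 2))))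
  refine ⟨N, fun n hn d lam m 𝒬 hd hp h𝒬 => ?_⟩
  obtain ⟨h1, h2, h3, h4⟩ := hN n hn
  refine ⟨h2 C d lam m 𝒬 hd hp h𝒬, hmin n h4 C d lam m 𝒬 hd hp h𝒬,
    (h1 d lam m 𝒬 hp h𝒬 σ hσ.le).trans ?_⟩
  refine le_trans ?_ (mul_le_mul_right (hmin n h4 C d lam m 𝒬 hd hp h𝒬) _)
  rw [← ENNReal.ofReal_mul (by positivity)]
  refine ENNReal.ofReal_le_ofReal ?_
  calc K₁ * (1 + σ ^ 2) * sgdRate a s r n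
      ≤ K₁ * (1 + σ ^ 2) * (Real.log n ^ 3 * minimaxRate a s r n) := by
        gcongr
        exact sgdRate_le ha hs0 h3
    _ = _ := by field_simp
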